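/- **Setting.** Let $d\ge 1$, let $(\mathsf Z,\mathcal Z)$ be a complete separable metric space with its Borel $\sigma$-algebra, $\mathrm Q$ a Markov kernel on it with unique invariant distribution $\pi$, and $\tau\ge 1$ an integer with $$\sup_{z,z'}\tfrac12\|\mathrm Q^k(z,\cdot)-\mathrm Q^k(z',\cdot)\|_{TV}\le (1/4)^{\lfloor k/\tau\rfloor}\quad\text{for all }k\in\mathbb N .$$ Let $F:\mathbb R^d\times\mathsf Z\to\mathbb R$, with $F(x,\cdot)$ measurable and $\pi$-integrable for each $x$, and $f(x)=\mathbb E_{Z\sim\pi}F(x,Z)$. Assume for constants $L,\mu>0$, $\sigma_2\ge0$: * for every $z$, $F(\cdot,z)$ is differentiable with $L$-Lipschitz gradient; * $f$ is continuously differentiable and $\frac\mu2\|x-y\|^2\le f(x)-f(y)-\langle\nabla f(y),x-y\rangle$ for all $x,y$; * $\mathbb E_\pi\nabla F(x,Z)=\nabla f(x)$ for all $x$, and $\|\nabla F(x,z)-\nabla f(x)\|^2\le\sigma_2^2$ for all $x,z$. Let $x^*$ be the minimizer of $f$. **Randomness.** $(Z_i)_{i\ge0}$ is a Markov chain with kernel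 $\mathrm Q$ and arbitrary initial distribution; $e_0,e_1,\dots$ are i.i.d. uniform on the unit sphere; $J_0,J_1,\dots$ are i.i.d. with $\mathbb P(J_k=j)=2^{-j}$, $j\ge1$; the three families are independent. **Algorithm (Randomized Accelerated Zero-Order GD, two-point feedback).** Given $p\in(0,1)$, $\gamma\in(0,\frac3{4L}]$, $t>0$, an integer $B\ge1$ and $x^0\in\mathbb R^d$, put $$\beta=\sqrt{\tfrac{4p^2\mu\gamma}3},\quad \eta=\sqrt{\tfrac3{\mu\gamma}},\quad \theta=\frac{p\eta^{-1}-1}{\beta p\eta^{-1}-1},\quad M=\tfrac1p+\tfrac2\beta,\quad l=(\lfloor\log_2M\rfloor+1)B .$$ For noise states $z_1,z_2,\dots$ and directions $e_1,e_2,\dots$ let $\hat g_{rd}[n](x)=\frac1n\sum_{i=1}^n d\,\frac{F(x+te_i,z_i)-F(x-te_i,z_i)}{2t}\,e_i$, and, for a level $J$, $$\hat g_{ml}(x)=\hat g_{rd}[l](x)+\begin{cases}2^J\big(\hat g_{rd}[2^Jl](x)-\hat g_{rd}[2^{J-1}l](x)\big),&2^J\le M,\\0,&\text{otherwise.}\end{cases}$$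 Start with $x_f^0=x^0$. In iteration $k$ let $x_g^k=\theta x_f^k+(1-\theta)x^k$, let $\hat g^k=\hat g_{ml}(x_g^k)$ with level $J_k$ and the first $b_k$ not yet used pairs $(Z_i,e_i)$, where $b_k=2^{J_k}l$ if $2^{J_k}\le M$ and $b_k=l$ otherwise, and set $$x_f^{k+1}=x_g^k-p\gamma\hat g^k,\qquad x^{k+1}=\eta x_f^{k+1}+(p-\eta)x_f^k+(1-p)(1-\beta)x^k+(1-p)\beta x_g^k .$$ A two-point oracle call is the evaluation of $F(x+te,z)$ and $F(x-te,z)$ at the same noise state $z$; the first $N$ iterations use $T_N=\sum_{k<N}b_k$ of them. **Theorem.** There are a universal constant $c\in(0,1]$ and a universal real polynomial $\mathrm{poly}$ such that for all $d,B,\tau,L,\mu,\sigma_2$ as above, all $R$ and every target accuracy $\varepsilon>0$ there are $\gamma\in(0,\frac3{4L}]$, $t>0$ and $N\in\mathbb N$, depending only on these quantities, such that with $p=c\frac B{B+d}$ every problem in the setting above and every $x^0$ with $\|x^0-x^*\|\le R$ satisfy $$\mathbb E\|x^N-x^*\|^2\le\varepsilon .$$ Moreover, put $$D=\max\Big[1,\frac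 dB\Big]\sqrt{\frac L\mu},\qquad V=\frac{(d+\tau)\sigma_2^2}{B\mu^2\varepsilon},\qquad S=D\log\frac1\varepsilon+V .$$ If $\varepsilon\le\frac12$ and $\varepsilon R^2\le1$, the expected number of oracle calls satisfies $$\mathbb E\,T_N\le B\cdot\mathrm{poly}\big(\log(S/\varepsilon)\big)\cdot S ,$$ and if in addition $V\le D$ or $V\ge\varepsilon^{-1/2}$ (for each fixed problem one of these holds once $\varepsilon$ is small enough), then $$\mathbb E\,T_N\le B\cdot\mathrm{poly}(\log S)\cdot S ,$$ that is, $\mathbb E\,T_N\le B\cdot\tilde{\mathcal O}\Big(\max[1,\frac dB]\sqrt{\frac L\mu}\log\frac1\varepsilon+\frac{(d+\tau)\sigma_2^2}{B\mu^2\varepsilon}\Big)$ as $\varepsilon\to0$. -/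

import Mathlib

open MeasureTheory ProbabilityTheory
open scoped ENNReal

universe u v

noncomputable section

namespace ZeroOrder

/-- The Euclidean space `ℝ^d`. -/
abbrev Vec (d : ℕ) := EuclideanSpace ℝ (Fin d)

/-! ### Assumptions on the objective -/

/-- `f` is differentiable with `L`-Lipschitz gradient. -/
def IsLSmooth {d : ℕ} (L : ℝ) (f : Vec d → ℝ) : Prop :=
  Differentiable ℝ f ∧ ∀ x y, ‖gradient f x - gradient f y‖ ≤ L * ‖x - y‖

/-- `f` is continuously differentiable and `μ`-strongly convex. -/
def IsStronglyConvex {d : ℕ} (μ : ℝ) (f : Vec d → ℝ) : Prop :=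
  ContDiff ℝ 1 f ∧
    ∀ x y, μ / 2 * ‖x - y‖ ^ 2 ≤ f x - f y - inner ℝ (gradient f y) (x - y)

/-- The objective `f(x) = E_{Z ∼ π} F(x, Z)`. -/
def objective {d : ℕ} {S : Type*} [MeasurableSpace S] (F : Vec d → S → ℝ) (π : Measure S) :
    Vec d → ℝ :=
  fun x => ∫ z, F x z ∂π

/-! ### Assumptions on the Markov noise -/

section Markov

variable {S : Type*} [MeasurableSpace S]

instance isMarkovKernel_pow (Q : Kernel S S) [IsMarkovKernel Q] (k : ℕ) :
    IsMarkovKernel (Q ^ k) := by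
  induction k with
  | zero => exact inferInstanceAs (IsMarkovKernel (Kernel.id : Kernel S S))
  | succ n ih =>
    rw [Kernel.pow_add, pow_one]
    infer_instance

/-- The Dobrushin coefficient `sup_{z,z'} (1/2) ‖Q(z,·) - Q(z',·)‖_TV`, where the norm is the total
mass of the total variation of the signed measure. -/
def dobrushin (Q : Kernel S S) [IsMarkovKernel Q] : ℝ≥0∞ :=
  ⨆ (z : S) (z' : S),
    2⁻¹ * ((Q z).toSignedMeasure - (Q z').toSignedMeasure).totalVariation Set.univ

/-- `π` is the unique invariant distribution of `Q`, and `Q` is uniformly geometrically ergodic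
with mixing time `τ ≥ 1`. -/
structure IsMixing (Q : Kernel S S) [IsMarkovKernel Q] (π : Measure S) (τ : ℕ) : Prop where
  one_le : 1 ≤ τ
  prob : IsProbabilityMeasure π
  invariant : Kernel.Invariant Q π
  unique : ∀ π' : Measure S, IsProbabilityMeasure π' → Kernel.Invariant Q π' → π' = π
  decay : ∀ k : ℕ, dobrushin (Q ^ k) ≤ (1 / 4 : ℝ≥0∞) ^ (k / τ)

/-- `Z` is a time-homogeneous Markov chain with kernel `Q` (and arbitrary initial distribution):
`P(Z_{n+1} ∈ A | Z_0, …, Z_n) = Q(Z_n, A)` almost surely. -/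
def IsMarkovChain {Ω : Type*} [MeasurableSpace Ω] (P : Measure Ω) (Q : Kernel S S)
    (Z : ℕ → Ω → S) : Prop :=
  (∀ n, Measurable (Z n)) ∧
    ∀ (n : ℕ) (A : Set S), MeasurableSet A →
      P⟦Z (n + 1) ⁻¹' A | ⨆ i ∈ Set.Iic n, MeasurableSpace.comap (Z i) inferInstance⟧
        =ᵐ[P] fun ω => (Q (Z n ω)).real A

end Markov

/-- The standing assumptions in the smooth two-point setting: every `F(·, z)` is `L`-smooth, `f` is
`μ`-strongly convex, the kernel `Q` mixes in time `τ` to `π`, and the stochastic gradients are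
unbiased under `π` and uniformly at distance at most `σ` from the true gradient. -/
structure TwoPointAssumptions {d : ℕ} {S : Type*} [MeasurableSpace S] (F : Vec d → S → ℝ)
    (Q : Kernel S S) [IsMarkovKernel Q] (π : Measure S) (L μ σ : ℝ) (τ : ℕ) : Prop where
  measurable : ∀ x, Measurable (F x)
  integrable : ∀ x, Integrable (F x) π
  smooth : ∀ z, IsLSmooth L (fun x => F x z)
  convex : IsStronglyConvex μ (objective F π)
  mixing : IsMixing Q π τ
  unbiased : ∀ x, ∫ z, gradient (fun y => F y z) x ∂π = gradient (objective F π) x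
  noise : ∀ x z, ‖gradient (fun y => F y z) x - gradient (objective F π) x‖ ^ 2 ≤ σ ^ 2

/-! ### Randomness used by the algorithm -/

/-- The uniform distribution on the unit sphere of `ℝ^d`, as a measure on `ℝ^d`. -/
def uniformSphere (d : ℕ) : Measure (Vec d) :=
  (((volume : Measure (Vec d)).toSphere Set.univ)⁻¹ • (volume : Measure (Vec d)).toSphere).map
    Subtype.val

/-- `Z` is a Markov chain with kernel `Q`, the `e i` are i.i.d. uniform on the unit sphere, the
`J k` are i.i.d. geometric with parameter `1/2` on `{1, 2, …}`, and the three families are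
independent of each other. -/
structure IsSampling {d : ℕ} {S Ω : Type*} [MeasurableSpace S] [MeasurableSpace Ω] (P : Measure Ω)
    (Q : Kernel S S) (Z : ℕ → Ω → S) (e : ℕ → Ω → Vec d) (J : ℕ → Ω → ℕ) : Prop where
  chain : IsMarkovChain P Q Z
  measurable_dir : ∀ i, Measurable (e i)
  law_dir : ∀ i, P.map (e i) = uniformSphere d
  indep_dir : iIndepFun e P
  measurable_level : ∀ k, Measurable (J k)
  law_level : ∀ k j, 1 ≤ j → P {ω | J k ω = j} = (1 / 2 : ℝ≥0∞) ^ j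
  indep_level : iIndepFun J P
  indep_dir_level : IndepFun (fun ω i => e i ω) (fun ω k => J k ω) P
  indep_chain : IndepFun (fun ω i => Z i ω) (fun ω => (fun i => e i ω, fun k => J k ω)) P

/-! ### The algorithm -/

/-- Free parameters: momentum parameter `p`, stepsize `γ`, approximation step `t`, strong convexity
constant `μ`, batch size multiplier `B`. -/
structure Params where
  p : ℝ
  γ : ℝ
  t : ℝ
  μ : ℝ
  B : ℕ

namespace Params

variable (a : Params)

def β : ℝ := √(4 * a.p ^ 2 * a.μ * a.γ / 3)

def η : ℝ := √(3 / (a.μ * a.γ))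

def θ : ℝ := (a.p * a.η⁻¹ - 1) / (a.β * a.p * a.η⁻¹ - 1)

/-- The batch size limit `M = 1/p + 2/β`. -/
def M : ℝ := 1 / a.p + 2 / a.β

/-- The base batch size `l = (⌊log₂ M⌋ + 1) B`. -/
def l : ℕ := (⌊Real.logb 2 a.M⌋₊ + 1) * a.B

/-- The number of samples, i.e. of two-point oracle calls, of one gradient estimate at level `j`. -/
def batchSize (j : ℕ) : ℕ := if (2 : ℝ) ^ j ≤ a.M then 2 ^ j * a.l else a.l

end Params

section Estimators

variable {d : ℕ} {S : Type*}

/-- The two-point estimator `d (F(x + t e, z) - F(x - t e, z)) / (2 t) · e`. It uses one two-point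
oracle call, i.e. one pair of values of `F` at the same noise state `z`. -/
def gHat (F : Vec d → S → ℝ) (t : ℝ) (x : Vec d) (z : S) (e : Vec d) : Vec d :=
  ((d : ℝ) * ((F (x + t • e) z - F (x - t • e) z) / (2 * t))) • e

/-- The random-direction batch estimator, on the first `n` noise states and directions. -/
def gRd (F : Vec d → S → ℝ) (t : ℝ) (x : Vec d) (n : ℕ) (z : ℕ → S) (e : ℕ → Vec d) : Vec d :=
  (1 / (n : ℝ)) • ∑ i ∈ Finset.range n, gHat F t x (z i) (e i)

/-- The multilevel Monte Carlo estimator at level `j`. -/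
def gMl (F : Vec d → S → ℝ) (a : Params) (x : Vec d) (j : ℕ) (z : ℕ → S) (e : ℕ → Vec d) :
    Vec d :=
  gRd F a.t x a.l z e +
    if (2 : ℝ) ^ j ≤ a.M then
      (2 : ℝ) ^ j • (gRd F a.t x (2 ^ j * a.l) z e - gRd F a.t x (2 ^ (j - 1) * a.l) z e)
    else 0

/-- State of the algorithm: the iterates `x^k`, `x_f^k` and the number of two-point oracle calls
made so far, which is also the number of noise states consumed so far. -/
structure AlgState (d : ℕ) where
  x : Vec d
  xf : Vec d
  calls : ℕ

/-- One iteration, with level `j`, on the noise sequence `z` and the direction sequence `e`; the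
estimator uses the entries following those already consumed. -/
def step (F : Vec d → S → ℝ) (a : Params) (z : ℕ → S) (e : ℕ → Vec d) (j : ℕ) (s : AlgState d) :
    AlgState d :=
  let xg := a.θ • s.xf + (1 - a.θ) • s.x
  let g := gMl F a xg j (fun i => z (s.calls + i)) (fun i => e (s.calls + i))
  let xf' := xg - (a.p * a.γ) • g
  { x := a.η • xf' + (a.p - a.η) • s.xf + ((1 - a.p) * (1 - a.β)) • s.x
      + ((1 - a.p) * a.β) • xg
    xf := xf'
    calls := s.calls + a.batchSize j }

/-- The state after `k` iterations from `x^0 = x_f^0 = x0`. -/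
def run (F : Vec d → S → ℝ) (a : Params) (x0 : Vec d) (z : ℕ → S) (e : ℕ → Vec d) (J : ℕ → ℕ) :
    ℕ → AlgState d
  | 0 => ⟨x0, x0, 0⟩
  | k + 1 => step F a z e (J k) (run F a x0 z e J k)

/-- The random state after `k` iterations. -/
def trajectory {Ω : Type*} (F : Vec d → S → ℝ) (a : Params) (x0 : Vec d) (Z : ℕ → Ω → S)
    (e : ℕ → Ω → Vec d) (J : ℕ → Ω → ℕ) (k : ℕ) (ω : Ω) : AlgState d :=
  run F a x0 (fun i => Z i ω) (fun i => e i ω) (fun i => J i ω) k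

end Estimators

/-- The deterministic factor `max[1, d/B] √(L/μ)`. -/
def detPart (d B : ℕ) (L μ : ℝ) : ℝ := max 1 ((d : ℝ) / B) * √(L / μ)

/-- The stochastic term `(d + τ) σ² / (B μ² ε)`. -/
def stochPart (d B τ : ℕ) (μ σ ε : ℝ) : ℝ := ((d : ℝ) + τ) * σ ^ 2 / (B * μ ^ 2 * ε)

/-- The quantity `max[1, d/B] √(L/μ) log(1/ε) + (d + τ) σ² / (B μ² ε)`. -/
def rate (d B τ : ℕ) (L μ σ ε : ℝ) : ℝ :=
  detPart d B L μ * Real.log (1 / ε) + stochPart d B τ μ σ ε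

end ZeroOrder

end

open ZeroOrder

open ZeroOrder

namespace ZeroOrder

/-! ### Smooth functions -/

/-! Put `γ = 3h²/μ` and `r = p h`. Then `η = 1/h`, `β = 2r`, `M = 1/p + 1/r`, and with the anchor `y
= (1-β)x + βx_g` one iteration is a pair of gradient steps: `x⁺ = y - (3r/μ)ĝ` and `x_f⁺ = x_g -
pγĝ`. The potential `Ψ = ‖x - x*‖² + (6/μ)(f(x_f) - f(x*))` of the new state is bounded by a
quadratic in `ĝ` (`lyapunov_step_le`). If `E‖ĝ‖² ≤ (4/(7p))‖∇f(x_g)‖² + W` and the squared bias of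
`ĝ` is at most `b₂`, strong convexity gives `E Ψ⁺ ≤ (1-r)Ψ + O(r²/μ²)(W + M b₂)`
(`lyapunov_average_le`). Random directions produce a variance of order `(d/B)‖∇f‖²`, which dictates
`p ≈ B/(B+d)`; the weight of the bias dictates that levels are truncated at `M`.

The error of a batch of size `n` has three parts (`gRd_sub_gradient`). Direction noise is centred
and uncorrelated given the Markov noise, with second moment at most `d‖g‖²` per sample, by isotropy
of the sphere. Markov noise has covariances decaying like `4^{-⌊k/τ⌋}`, so its mean has second
moment `O(τσ²/n)` (`integral_norm_sum_sq_le`). The finite difference error is at most `dLt/2`. Only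
the last two parts contribute to the bias.

In the multilevel estimator `P(J=j)·2^j = 1`, so the mean telescopes to that of a batch of size `2^K
l`, where `2^K` is the largest power of two below `M` (`levelAvg_telescope`). Its bias is therefore
that of a batch of size about `M B`. Each level adds `O(v/l)` to the second moment, `v` being the
one-sample variance; the factor `K+1` in `l = (K+1)B` compensates for the sum over the levels. The
mean cost of an iteration is at most `(K+1)²B`.

Batches begin at random times, but these depend on the levels alone. With the levels fixed, the path
of the chain after a deterministic time is resampled from its conditional law, and the directions
from their product law (`lintegral_resample`). The one-step bound is uniform in the past
(`lintegral_lyapunov_step_le`), so it iterates to a geometric recursion for `E Ψ`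
(`lintegral_lyapunov_le`). Working with integrals in `[0, ∞]` avoids integrability questions for the
iterates.

The choice `1/h = 2√(L/μ) + 28800pV` makes the stepsize admissible and the stationary variance term
at most `ε/4`; it yields `1/r = O(D + V)`, and `O(r⁻¹ log(D/ε))` iterations suffice when `εR² ≤ 1`.
The target `S = D log(1/ε) + V` has no logarithm on `V`; the extra one is bounded by `log(S/ε)`
always, and by `log S` when `V ≥ ε^{-1/2}`. When `V ≤ D` it falls on `D`, where `S` already contains
it (`mul_sq_le_poly_log`). -/

theorem IsLSmooth.neg {d : ℕ} {L : ℝ} {f : Vec d → ℝ} (hf : IsLSmooth L f) :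
    IsLSmooth L (fun x => -f x) := by
  have hg : ∀ x, gradient (fun x => -f x) x = -gradient f x := fun x => by
    rw [gradient, gradient, fderiv_fun_neg, map_neg]
  refine ⟨hf.1.neg, fun x y => ?_⟩
  rw [hg, hg, neg_sub_neg, norm_sub_rev]
  exact hf.2 x y

theorem hasDerivAt_along_line {d : ℕ} {f : Vec d → ℝ} (hf : Differentiable ℝ f) (x v : Vec d)
    (s : ℝ) :
    HasDerivAt (fun s : ℝ => f (x + s • v)) (inner ℝ (gradient f (x + s • v)) v) s := by
  have h1 : HasDerivAt (fun s : ℝ => x + s • v) v s := by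
    simpa using ((hasDerivAt_id s).smul_const v).const_add x
  have h2 := (hf (x + s • v)).hasGradientAt.hasFDerivAt.comp_hasDerivAt s h1
  exact h2.congr_deriv (InnerProductSpace.toDual_apply_apply)

/-- The descent lemma. -/
theorem IsLSmooth.le_quadratic {d : ℕ} {L : ℝ} {f : Vec d → ℝ} (hf : IsLSmooth L f)
    (x v : Vec d) : f (x + v) ≤ f x + inner ℝ (gradient f x) v + L / 2 * ‖v‖ ^ 2 := by
  let φ : ℝ → ℝ := fun s => f (x + s • v) - s * inner ℝ (gradient f x) v - s ^ 2 * (L / 2 * ‖v‖ ^ 2)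
  have hd : ∀ s, HasDerivAt φ (inner ℝ (gradient f (x + s • v)) v - inner ℝ (gradient f x) v
      - 2 * s * (L / 2 * ‖v‖ ^ 2)) s := fun s => by
    have h1 := (hasDerivAt_id s).mul_const (inner ℝ (gradient f x) v)
    have h2 := (hasDerivAt_pow 2 s).mul_const (L / 2 * ‖v‖ ^ 2)
    have h3 := ((hasDerivAt_along_line hf.1 x v s).sub h1).sub h2
    exact h3.congr_deriv (by simp)
  have hanti : AntitoneOn φ (Set.Ici 0) := by
    refine antitoneOn_of_deriv_nonpos (convex_Ici 0)
      (fun s _ => (hd s).continuousAt.continuousWithinAt)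
      (fun s _ => (hd s).differentiableAt.differentiableWithinAt) fun s hs => ?_
    rw [interior_Ici, Set.mem_Ioi] at hs
    rw [(hd s).deriv, ← inner_sub_left]
    have h1 := real_inner_le_norm (gradient f (x + s • v) - gradient f x) v
    have h2 := hf.2 (x + s • v) x
    rw [add_sub_cancel_left, norm_smul, Real.norm_of_nonneg hs.le] at h2
    nlinarith [mul_le_mul_of_nonneg_right h2 (norm_nonneg v)]
  have := hanti (Set.mem_Ici.2 le_rfl) (Set.mem_Ici.2 zero_le_one) zero_le_one
  simp only [φ, one_smul, zero_smul, add_zero] at this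
  linarith

/-- The descent lemma for `f` and `-f` at `x ± te` leaves an error `Lt²/2` at each of the two
points; together they give `Lt²`, and division by `2t` leaves `Lt/2`. -/
theorem IsLSmooth.abs_central_difference_le {d : ℕ} {L : ℝ} {f : Vec d → ℝ} (hf : IsLSmooth L f)
    (x e : Vec d) (he : ‖e‖ = 1) {t : ℝ} (ht : 0 < t) :
    |(f (x + t • e) - f (x - t • e)) / (2 * t) - inner ℝ (gradient f x) e| ≤ L * t / 2 := by
  have hng : gradient (fun x => -f x) x = -gradient f x := by
    rw [gradient, gradient, fderiv_fun_neg, map_neg]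
  have h1 := hf.le_quadratic x (t • e)
  have h2 := hf.le_quadratic x (-(t • e))
  have h3 := hf.neg.le_quadratic x (t • e)
  have h4 := hf.neg.le_quadratic x (-(t • e))
  rw [hng] at h3 h4
  simp only [inner_neg_left, inner_neg_right, norm_neg, inner_smul_right, norm_smul, he,
    Real.norm_of_nonneg ht.le, mul_one, ← sub_eq_add_neg] at h1 h2 h3 h4
  have hsplit : (f (x + t • e) - f (x - t • e)) / (2 * t) - inner ℝ (gradient f x) e
      = (f (x + t • e) - f (x - t • e) - 2 * t * inner ℝ (gradient f x) e) / (2 * t) := by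
    field_simp
  rw [hsplit, abs_div, abs_of_pos (by positivity : 0 < 2 * t), div_le_iff₀ (by positivity), abs_le]
  constructor <;> nlinarith

/-- Both quadratic bounds are compared along one unit vector, which exists because `d ≥ 1`. It
yields a condition number at least 1, which is not among the hypotheses of the theorem. -/
theorem IsStronglyConvex.le_of_isLSmooth {d : ℕ} (hd : 1 ≤ d) {L μ : ℝ} {f : Vec d → ℝ}
    (hc : IsStronglyConvex μ f) (hs : IsLSmooth L f) : μ ≤ L := by
  have h1 := hs.le_quadratic 0 (EuclideanSpace.single ⟨0, hd⟩ 1)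
  have h2 := hc.2 (EuclideanSpace.single ⟨0, hd⟩ 1) 0
  simp only [zero_add, sub_zero, PiLp.norm_single, norm_one, one_pow, mul_one] at h1 h2
  linarith

theorem gradient_eq_zero_of_forall_le {d : ℕ} {f : Vec d → ℝ} {x : Vec d} (hx : ∀ y, f x ≤ f y) :
    gradient f x = 0 := by
  have : IsLocalMin f x := Filter.Eventually.of_forall hx
  rw [gradient, this.fderiv_eq_zero, map_zero]

/-! ### The Lyapunov function -/

/-- The Lyapunov function of the accelerated method. -/
noncomputable def lyapunov {d : ℕ} (f : Vec d → ℝ) (μ : ℝ) (xstar : Vec d) (s : AlgState d) : ℝ :=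
  ‖s.x - xstar‖ ^ 2 + 6 / μ * (f s.xf - f xstar)

theorem lyapunov_nonneg {d : ℕ} {f : Vec d → ℝ} {μ : ℝ} (hμ : 0 < μ) {xstar : Vec d}
    (hx : ∀ y, f xstar ≤ f y) (s : AlgState d) : 0 ≤ lyapunov f μ xstar s := by
  have := sub_nonneg.2 (hx s.xf)
  unfold lyapunov
  positivity

theorem norm_sq_le_lyapunov {d : ℕ} {f : Vec d → ℝ} {μ : ℝ} (hμ : 0 < μ) {xstar : Vec d}
    (hx : ∀ y, f xstar ≤ f y) (s : AlgState d) : ‖s.x - xstar‖ ^ 2 ≤ lyapunov f μ xstar s := by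
  have := sub_nonneg.2 (hx s.xf)
  unfold lyapunov
  have : 0 ≤ 6 / μ * (f s.xf - f xstar) := by positivity
  linarith

theorem lyapunov_init_le {d : ℕ} {f : Vec d → ℝ} {L μ R : ℝ} (hμ : 0 < μ) (hL : 0 < L)
    (hs : IsLSmooth L f) {xstar : Vec d} (hx : ∀ y, f xstar ≤ f y) {x0 : Vec d}
    (hR : ‖x0 - xstar‖ ≤ R) (n : ℕ) :
    lyapunov f μ xstar ⟨x0, x0, n⟩ ≤ R ^ 2 * (1 + 3 * (L / μ)) := by
  have h1 := hs.le_quadratic xstar (x0 - xstar)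
  rw [gradient_eq_zero_of_forall_le hx, inner_zero_left, add_zero, add_sub_cancel] at h1
  have h2 : ‖x0 - xstar‖ ^ 2 ≤ R ^ 2 := by gcongr
  calc lyapunov f μ xstar ⟨x0, x0, n⟩
      ≤ ‖x0 - xstar‖ ^ 2 + 6 / μ * (L / 2 * ‖x0 - xstar‖ ^ 2) := by
        unfold lyapunov; gcongr; linarith
    _ = ‖x0 - xstar‖ ^ 2 * (1 + 3 * (L / μ)) := by ring
    _ ≤ R ^ 2 * (1 + 3 * (L / μ)) := by gcongr

/-- The extrapolated point `x_g`. -/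
noncomputable def extrapolate {d : ℕ} (a : Params) (s : AlgState d) : Vec d :=
  a.θ • s.xf + (1 - a.θ) • s.x

/-- The point `(1 - β) x + β x_g`, at which the gradient step of the main sequence starts. -/
noncomputable def anchor {d : ℕ} (a : Params) (s : AlgState d) : Vec d :=
  (1 - a.β) • s.x + a.β • extrapolate a s

/-- The parameters for which `η = h⁻¹`. -/
noncomputable def paramsOf (p h t μ : ℝ) (B : ℕ) : Params := ⟨p, 3 * h ^ 2 / μ, t, μ, B⟩

/-! ### Rational form of the parameters and the algebra of one step -/

section Params

variable {p h t μ : ℝ} {B : ℕ}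

/-- The substitution `γ = 3h²/μ` turns both square roots into perfect squares; afterwards `β`, `θ`
and `M` are rational in `p` and `p h`. -/
theorem paramsOf_η (hh : 0 < h) (hμ : 0 < μ) : (paramsOf p h t μ B).η = h⁻¹ := by
  have : 3 / (μ * (3 * h ^ 2 / μ)) = h⁻¹ ^ 2 := by field_simp
  rw [Params.η, paramsOf, this, Real.sqrt_sq (by positivity)]

theorem paramsOf_β (hp : 0 < p) (hh : 0 < h) (hμ : 0 < μ) :
    (paramsOf p h t μ B).β = 2 * (p * h) := by
  have : 4 * p ^ 2 * μ * (3 * h ^ 2 / μ) / 3 = (2 * (p * h)) ^ 2 := by field_simp; ring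
  rw [Params.β, paramsOf, this, Real.sqrt_sq (by positivity)]

theorem paramsOf_M (hp : 0 < p) (hh : 0 < h) (hμ : 0 < μ) :
    (paramsOf p h t μ B).M = 1 / p + 1 / (p * h) := by
  rw [Params.M, paramsOf_β hp hh hμ]
  simp only [paramsOf]
  field_simp

theorem paramsOf_θ (hp : 0 < p) (hh : 0 < h) (hμ : 0 < μ) :
    (paramsOf p h t μ B).θ = (1 - p * h) / (1 - 2 * (p * h) ^ 2) := by
  rw [Params.θ, paramsOf_β hp hh hμ, paramsOf_η hh hμ, inv_inv, ← neg_div_neg_eq]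
  simp only [paramsOf]
  ring_nf

/-- The gradient step starts from `x_g + (η / p - 1) (x_g - x_f)`. -/
theorem anchor_eq {d : ℕ} (hp : 0 < p) (hh : 0 < h) (hμ : 0 < μ) (hph : p * h ≤ 1 / 2)
    (s : AlgState d) :
    anchor (paramsOf p h t μ B) s = extrapolate (paramsOf p h t μ B) s
      + (1 / (p * h) - 1) • (extrapolate (paramsOf p h t μ B) s - s.xf) := by
  have hpos : 0 < p * h := by positivity
  have hden : 1 - 2 * (p * h) ^ 2 ≠ 0 := by nlinarith
  simp only [anchor, extrapolate, paramsOf_β hp hh hμ, paramsOf_θ hp hh hμ]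
  generalize p * h = r at *
  match_scalars <;> · field_simp; ring

/-- By `anchor_eq`, `η x_g + (p - η) x_f` is `p` times the anchor, and the remaining terms are `1 -
p` times the anchor. The gradient coefficient is `η·pγ = 3ph/μ`. -/
theorem step_x_eq {d : ℕ} {S : Type*} (hp : 0 < p) (hh : 0 < h) (hμ : 0 < μ)
    (hph : p * h ≤ 1 / 2) (F : Vec d → S → ℝ) (z : ℕ → S) (e : ℕ → Vec d) (j : ℕ)
    (s : AlgState d) :
    (step F (paramsOf p h t μ B) z e j s).x = anchor (paramsOf p h t μ B) s
      - (3 * (p * h) / μ) • gMl F (paramsOf p h t μ B) (extrapolate (paramsOf p h t μ B) s) j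
          (fun i => z (s.calls + i)) (fun i => e (s.calls + i)) := by
  have key := anchor_eq (t := t) (B := B) hp hh hμ hph s
  simp only [step]
  change _ • (extrapolate (paramsOf p h t μ B) s - _) + _ + _ +
    _ • extrapolate (paramsOf p h t μ B) s = _
  set g := gMl F (paramsOf p h t μ B) _ j _ _
  have key' : p • anchor (paramsOf p h t μ B) s = h⁻¹ • extrapolate (paramsOf p h t μ B) s
      + (p - h⁻¹) • s.xf := by
    rw [key]; match_scalars <;> (field_simp; try ring)
  have h1 : anchor (paramsOf p h t μ B) s = p • anchor (paramsOf p h t μ B) s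
      + (1 - p) • ((1 - (paramsOf p h t μ B).β) • s.x
          + (paramsOf p h t μ B).β • extrapolate (paramsOf p h t μ B) s) := by
    rw [← anchor]; module
  have hg : gMl F (paramsOf p h t μ B) (extrapolate (paramsOf p h t μ B) s) j
      (fun i => z (s.calls + i)) (fun i => e (s.calls + i)) = g := rfl
  rw [hg, h1, key', paramsOf_η hh hμ]
  simp only [paramsOf]
  match_scalars <;> (field_simp; try ring)

/-- One step changes the Lyapunov function by a quadratic polynomial in the gradient estimate. -/
theorem lyapunov_step_le {d : ℕ} {S : Type*} {L : ℝ} {f : Vec d → ℝ} (hf : IsLSmooth L f)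
    (hp : 0 < p) (hh : 0 < h) (hμ : 0 < μ) (hph : p * h ≤ 1 / 2) (hL : L * (3 * h ^ 2 / μ) ≤ 3 / 4)
    (F : Vec d → S → ℝ) (z : ℕ → S) (e : ℕ → Vec d) (j : ℕ) (s : AlgState d) (xstar : Vec d)
    {xg g : Vec d} (hxg : xg = extrapolate (paramsOf p h t μ B) s)
    (hg : g = gMl F (paramsOf p h t μ B) xg j
      (fun i => z (s.calls + i)) (fun i => e (s.calls + i))) :
    lyapunov f μ xstar (step F (paramsOf p h t μ B) z e j s) ≤
      ‖anchor (paramsOf p h t μ B) s - xstar‖ ^ 2 + 6 / μ * (f xg - f xstar)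
      + inner ℝ (-(6 * (p * h) / μ) • (anchor (paramsOf p h t μ B) s - xstar)
          - (18 * p * h ^ 2 / μ ^ 2) • gradient f xg) g
      + 63 / 4 * (p ^ 2 * h ^ 2 / μ ^ 2) * ‖g‖ ^ 2 := by
  have hx := step_x_eq (t := t) (B := B) hp hh hμ hph F z e j s
  rw [← hxg, ← hg] at hx
  have hxf : (step F (paramsOf p h t μ B) z e j s).xf = xg + (-(p * (3 * h ^ 2 / μ))) • g := by
    rw [neg_smul, ← sub_eq_add_neg, hg, hxg]; rfl
  have hdesc := hf.le_quadratic xg ((-(p * (3 * h ^ 2 / μ))) • g)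
  rw [inner_smul_right, norm_smul, mul_pow, norm_neg, Real.norm_of_nonneg (by positivity)] at hdesc
  rw [lyapunov, hx, hxf]
  set y := anchor (paramsOf p h t μ B) s
  have h1 : ‖y - (3 * (p * h) / μ) • g - xstar‖ ^ 2
      = ‖y - xstar‖ ^ 2 - 6 * (p * h) / μ * inner ℝ (y - xstar) g
        + 9 * (p ^ 2 * h ^ 2 / μ ^ 2) * ‖g‖ ^ 2 := by
    rw [sub_right_comm, norm_sub_sq_real, inner_smul_right, norm_smul, mul_pow,
      Real.norm_of_nonneg (by positivity)]
    ring
  have h2 : 6 / μ * (f (xg + (-(p * (3 * h ^ 2 / μ))) • g) - f xstar)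
      ≤ 6 / μ * (f xg - f xstar) - 18 * p * h ^ 2 / μ ^ 2 * inner ℝ (gradient f xg) g
        + 27 / 4 * (p ^ 2 * h ^ 2 / μ ^ 2) * ‖g‖ ^ 2 := by
    have h3 : 6 / μ * (f (xg + (-(p * (3 * h ^ 2 / μ))) • g) - f xstar)
        ≤ 6 / μ * (f xg + -(p * (3 * h ^ 2 / μ)) * inner ℝ (gradient f xg) g
          + L / 2 * ((p * (3 * h ^ 2 / μ)) ^ 2 * ‖g‖ ^ 2) - f xstar) := by gcongr
    -- The condition `Lγ ≤ 3/4` turns the quadratic remainder of the descent lemma into `9·(3/4) =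
    -- 27/4`; with the 9 from the `x`-step this makes `63/4`.
    have h4 : 9 * (p ^ 2 * h ^ 2 / μ ^ 2) * ‖g‖ ^ 2 * (L * (3 * h ^ 2 / μ))
        ≤ 9 * (p ^ 2 * h ^ 2 / μ ^ 2) * ‖g‖ ^ 2 * (3 / 4) := by gcongr
    calc _ ≤ _ := h3
      _ = 6 / μ * (f xg - f xstar) - 18 * p * h ^ 2 / μ ^ 2 * inner ℝ (gradient f xg) g
        + 9 * (p ^ 2 * h ^ 2 / μ ^ 2) * ‖g‖ ^ 2 * (L * (3 * h ^ 2 / μ)) := by ring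
      _ ≤ _ := by linarith
  have h3 : inner ℝ (-(6 * (p * h) / μ) • (y - xstar) - (18 * p * h ^ 2 / μ ^ 2) • gradient f xg) g
      = -(6 * (p * h) / μ) * inner ℝ (y - xstar) g
        - 18 * p * h ^ 2 / μ ^ 2 * inner ℝ (gradient f xg) g := by
    rw [inner_sub_left, inner_smul_left, inner_smul_left]
    simp only [conj_trivial]
  rw [h1, h3]
  linarith

/-- The average over the gradient estimates of the bound of `lyapunov_step_le`: `m` is their mean
and `s₂` their second moment. -/
theorem lyapunov_average_le {d : ℕ} {f : Vec d → ℝ} (hf : IsStronglyConvex μ f)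
    (hp : 0 < p) (hh : 0 < h) (hμ : 0 < μ) (hph : p * h ≤ 1 / 2)
    (s : AlgState d) (xstar : Vec d) {xg : Vec d}
    (hxg : xg = extrapolate (paramsOf p h t μ B) s) (m : Vec d) {s₂ b₂ W : ℝ}
    (hm : ‖m - gradient f xg‖ ^ 2 ≤ b₂)
    (hs₂ : s₂ ≤ 4 / (7 * p) * ‖gradient f xg‖ ^ 2 + W) :
    ‖anchor (paramsOf p h t μ B) s - xstar‖ ^ 2 + 6 / μ * (f xg - f xstar)
      + inner ℝ (-(6 * (p * h) / μ) • (anchor (paramsOf p h t μ B) s - xstar)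
          - (18 * p * h ^ 2 / μ ^ 2) • gradient f xg) m
      + 63 / 4 * (p ^ 2 * h ^ 2 / μ ^ 2) * s₂
    ≤ (1 - p * h) * lyapunov f μ xstar s
      + 9 * (p ^ 2 * h ^ 2 / μ ^ 2) * (7 / 4 * W + (1 / p + 1 / (p * h)) * b₂) := by
  have hpos : 0 < p * h := by positivity
  set y := anchor (paramsOf p h t μ B) s - xstar with hy
  set G := gradient f xg with hG
  obtain ⟨b, rfl⟩ : ∃ b, m = G + b := ⟨m - G, by abel⟩
  rw [add_sub_cancel_left] at hm
  have hy1 : y = (xg - xstar) + (1 / (p * h) - 1) • (xg - s.xf) := by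
    rw [hy, anchor_eq hp hh hμ hph, ← hxg]; abel
  -- Convexity of the squared norm along the combination with weights `1 - β` and `β = 2ph`.
  have hy2 : ‖y‖ ^ 2 ≤ (1 - 2 * (p * h)) * ‖s.x - xstar‖ ^ 2 + 2 * (p * h) * ‖xg - xstar‖ ^ 2 := by
    have : y = (1 - 2 * (p * h)) • (s.x - xstar) + (2 * (p * h)) • (xg - xstar) := by
      rw [hy, anchor, ← hxg, paramsOf_β hp hh hμ]; module
    rw [this]
    exact (convexOn_univ_norm.pow (fun _ _ => norm_nonneg _) 2).2 (Set.mem_univ _) (Set.mem_univ _)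
      (by linarith) (by linarith) (by ring)
  have hsc1 := hf.2 xstar xg
  have hsc2 := hf.2 s.xf xg
  -- The form of the anchor splits the inner product into a part toward `x*`, where strong convexity
  -- is used in full, and a part toward `x_f` with nonnegative weight `1/(ph) - 1`, where plain
  -- convexity is enough.
  have hyG : f xg - f xstar + μ / 2 * ‖xg - xstar‖ ^ 2 + (1 / (p * h) - 1) * (f xg - f s.xf)
      ≤ inner ℝ y G := by
    have e1 : inner ℝ y G = inner ℝ G (xg - xstar) + (1 / (p * h) - 1) * inner ℝ G (xg - s.xf) := by
      rw [hy1, inner_add_left, inner_smul_left, real_inner_comm, real_inner_comm G (xg - s.xf)]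
      simp
    have e2 : 0 ≤ 1 / (p * h) - 1 := by
      rw [sub_nonneg, le_div_iff₀ hpos]; linarith
    rw [← hG, ← neg_sub xg xstar, inner_neg_right, norm_neg] at hsc1
    rw [← hG, ← neg_sub xg s.xf, inner_neg_right, norm_neg] at hsc2
    have e3 : 0 ≤ μ / 2 * ‖xg - s.xf‖ ^ 2 := by positivity
    have e4 : f xg - f s.xf ≤ inner ℝ G (xg - s.xf) := by linarith
    have := mul_le_mul_of_nonneg_left e4 e2
    linarith
  -- Young's inequality with the weight `p h` on `‖y‖²`: this loses half of the contraction `2ph`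
  -- available in `hy2`, and leaves the bias with the factor `1/(ph)` that appears in `M`.
  have hyoung : -(6 * (p * h) / μ) * inner ℝ y b
      ≤ (p * h) * ‖y‖ ^ 2 + 9 * (p * h) / μ ^ 2 * ‖b‖ ^ 2 := by
    have e1 : 0 ≤ ‖y + (3 / μ) • b‖ ^ 2 := by positivity
    rw [norm_add_sq_real, inner_smul_right, norm_smul, mul_pow,
      Real.norm_of_nonneg (by positivity)] at e1
    have := mul_nonneg hpos.le e1
    have e2 : p * h * (‖y‖ ^ 2 + 2 * (3 / μ * inner ℝ y b) + (3 / μ) ^ 2 * ‖b‖ ^ 2)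
      = (p * h) * ‖y‖ ^ 2 + 6 * (p * h) / μ * inner ℝ y b + 9 * (p * h) / μ ^ 2 * ‖b‖ ^ 2 := by
      ring
    linarith
  -- This is `-2⟨G, G+b⟩ = ‖b‖² - ‖G‖² - ‖G+b‖²`. The negative `‖G‖²` is what pays for the second
  -- moment of the estimate.
  have hGb : -(18 * p * h ^ 2 / μ ^ 2) * inner ℝ G (G + b)
      ≤ 9 * p * h ^ 2 / μ ^ 2 * (‖b‖ ^ 2 - ‖G‖ ^ 2) := by
    have e1 : 0 ≤ ‖G + b‖ ^ 2 := by positivity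
    have e2 : 0 ≤ 9 * p * h ^ 2 / μ ^ 2 := by positivity
    rw [norm_add_sq_real] at e1
    rw [inner_add_right, real_inner_self_eq_norm_sq]
    have := mul_nonneg e2 e1
    have e3 : 9 * p * h ^ 2 / μ ^ 2 * (‖G‖ ^ 2 + 2 * inner ℝ G b + ‖b‖ ^ 2)
      = 9 * p * h ^ 2 / μ ^ 2 * (‖b‖ ^ 2 - ‖G‖ ^ 2)
        + 18 * p * h ^ 2 / μ ^ 2 * (‖G‖ ^ 2 + inner ℝ G b) := by ring
    linarith
  -- The constant `4/(7p)` is chosen so that `(63/4)·(4/7) = 9`, matching the coefficient of `-‖G‖²`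
  -- in `hGb`.
  have hs2 : 63 / 4 * (p ^ 2 * h ^ 2 / μ ^ 2) * s₂
      ≤ 9 * p * h ^ 2 / μ ^ 2 * ‖G‖ ^ 2 + 63 / 4 * (p ^ 2 * h ^ 2 / μ ^ 2) * W := by
    calc _ ≤ 63 / 4 * (p ^ 2 * h ^ 2 / μ ^ 2) * (4 / (7 * p) * ‖G‖ ^ 2 + W) := by gcongr
      _ = _ := by field_simp; ring
  have hb : 9 * (p ^ 2 * h ^ 2 / μ ^ 2) * ((1 / p + 1 / (p * h)) * ‖b‖ ^ 2)
      ≤ 9 * (p ^ 2 * h ^ 2 / μ ^ 2) * ((1 / p + 1 / (p * h)) * b₂) := by gcongr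
  have hb' : 9 * (p ^ 2 * h ^ 2 / μ ^ 2) * ((1 / p + 1 / (p * h)) * ‖b‖ ^ 2)
      = 9 * p * h ^ 2 / μ ^ 2 * ‖b‖ ^ 2 + 9 * (p * h) / μ ^ 2 * ‖b‖ ^ 2 := by
    field_simp
  -- With `r = ph`, the distance terms close because `(1+r)(1-2r) ≤ 1-r` and, as `r ≤ 1/2`, `2r(1+r)
  -- ≤ 3r`; the weight `6/μ` of the function gap makes the strong convexity gain exactly `3r‖x_g -
  -- x*‖²`.
  have hmain : (1 + p * h) * ‖y‖ ^ 2 + 6 / μ * (f xg - f xstar) - 6 * (p * h) / μ * inner ℝ y G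
      ≤ (1 - p * h) * lyapunov f μ xstar s := by
    have e1 : 6 * (p * h) / μ * (f xg - f xstar + μ / 2 * ‖xg - xstar‖ ^ 2
        + (1 / (p * h) - 1) * (f xg - f s.xf)) ≤ 6 * (p * h) / μ * inner ℝ y G := by gcongr
    have e2 : 6 * (p * h) / μ * (f xg - f xstar + μ / 2 * ‖xg - xstar‖ ^ 2
        + (1 / (p * h) - 1) * (f xg - f s.xf))
        = 6 / μ * (f xg - f xstar) - (1 - p * h) * (6 / μ * (f s.xf - f xstar))
          + 3 * (p * h) * ‖xg - xstar‖ ^ 2 := by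
      field_simp; ring
    have e3 := mul_le_mul_of_nonneg_left hy2 (by linarith : 0 ≤ 1 + p * h)
    rw [lyapunov]
    nlinarith [mul_nonneg (mul_nonneg hpos.le hpos.le) (sq_nonneg ‖s.x - xstar‖),
      mul_nonneg (mul_nonneg hpos.le (by linarith : 0 ≤ 1 - 2 * (p * h)))
        (sq_nonneg ‖xg - xstar‖)]
  have hin : inner ℝ (-(6 * (p * h) / μ) • y - (18 * p * h ^ 2 / μ ^ 2) • G) (G + b)
      = -(6 * (p * h) / μ) * inner ℝ y G + -(6 * (p * h) / μ) * inner ℝ y b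
        + -(18 * p * h ^ 2 / μ ^ 2) * inner ℝ G (G + b) := by
    rw [inner_sub_left, inner_smul_left, inner_smul_left, inner_add_right (x := y)]
    simp only [conj_trivial]
    ring
  rw [hin]
  linarith

end Params

/-! ### Isotropy of the uniform distribution on the sphere -/

open scoped Pointwise in
/-- The spherical measure is invariant under linear isometries. -/
theorem map_toSphere_isometry {d : ℕ} (U : Vec d ≃ₗᵢ[ℝ] Vec d) :
    (((volume : Measure (Vec d)).toSphere).map Subtype.val).map U
      = ((volume : Measure (Vec d)).toSphere).map Subtype.val := by
  ext s hs
  have hU : Measurable U := U.continuous.measurable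
  have hset : ∀ A : Set (Vec d), MeasurableSet A →
      (((volume : Measure (Vec d)).toSphere).map Subtype.val) A
        = d * volume (Set.Ioo (0 : ℝ) 1 • (Metric.sphere (0 : Vec d) 1 ∩ A)) := fun A hA => by
    rw [Measure.map_apply measurable_subtype_coe hA,
      Measure.toSphere_apply' _ (measurable_subtype_coe hA), Subtype.image_preimage_coe]
    simp
  rw [Measure.map_apply hU hs, hset _ (hU hs), hset _ hs]
  congr 1
  symm
  rw [← (LinearIsometryEquiv.measurePreserving U).measure_preimage_equiv
    (f := U.toMeasurableEquiv)]
  congr 1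
  ext x
  simp only [Set.mem_preimage, Set.mem_smul, Set.mem_inter_iff, mem_sphere_zero_iff_norm]
  constructor
  · rintro ⟨r, hr, y, ⟨hy, hys⟩, hx⟩
    refine ⟨r, hr, U.symm y, ⟨by simpa using hy, by simpa using hys⟩, ?_⟩
    apply U.injective
    simpa using hx
  · rintro ⟨r, hr, y, ⟨hy, hys⟩, rfl⟩
    exact ⟨r, hr, U y, ⟨by simpa using hy, hys⟩, by simp⟩

theorem isProbabilityMeasure_uniformSphere {d : ℕ} (hd : 1 ≤ d) :
    IsProbabilityMeasure (uniformSphere d) := by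
  have : Nonempty (Fin d) := ⟨⟨0, hd⟩⟩
  refine ⟨?_⟩
  rw [uniformSphere, Measure.map_apply measurable_subtype_coe .univ, Set.preimage_univ,
    Measure.smul_apply, smul_eq_mul]
  exact ENNReal.inv_mul_cancel (Measure.measure_univ_ne_zero.2
    (mt (Measure.toSphere_eq_zero_iff_finrank _).1 (by rw [finrank_euclideanSpace_fin]; omega))) (measure_ne_top _ _)

theorem ae_norm_eq_one_uniformSphere (d : ℕ) : ∀ᵐ e ∂uniformSphere d, ‖e‖ = 1 := by
  rw [uniformSphere, ae_map_iff measurable_subtype_coe.aemeasurable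
    (measurableSet_eq_fun continuous_norm.measurable measurable_const)]
  exact Filter.Eventually.of_forall fun e => by simp

theorem map_uniformSphere_isometry {d : ℕ} (U : Vec d ≃ₗᵢ[ℝ] Vec d) :
    (uniformSphere d).map U = uniformSphere d := by
  rw [uniformSphere, Measure.map_smul, Measure.map_smul, map_toSphere_isometry]

theorem integral_uniformSphere_comp_isometry {d : ℕ} (U : Vec d ≃ₗᵢ[ℝ] Vec d) (f : Vec d → ℝ) :
    ∫ e, f (U e) ∂uniformSphere d = ∫ e, f e ∂uniformSphere d := by
  conv_rhs => rw [← map_uniformSphere_isometry U]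
  exact (integral_map_equiv U.toMeasurableEquiv f).symm

theorem integrable_inner_mul_inner {d : ℕ} (hd : 1 ≤ d) (a b : Vec d) :
    Integrable (fun e => inner ℝ a e * inner ℝ b e) (uniformSphere d) := by
  have := isProbabilityMeasure_uniformSphere hd
  refine Integrable.of_bound (by fun_prop) (‖a‖ * ‖b‖) ?_
  filter_upwards [ae_norm_eq_one_uniformSphere d] with e he
  rw [norm_mul]
  have h1 := norm_inner_le_norm (𝕜 := ℝ) a e
  have h2 := norm_inner_le_norm (𝕜 := ℝ) b e
  rw [he, mul_one] at h1 h2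
  gcongr

/-- The reflection in the hyperplane orthogonal to `a - b` maps `a` to `b` and preserves the uniform
law. -/
theorem integral_inner_sq_eq_of_norm_eq {d : ℕ} {a b : Vec d} (hab : ‖a‖ = ‖b‖) :
    ∫ e, inner ℝ a e ^ 2 ∂uniformSphere d = ∫ e, inner ℝ b e ^ 2 ∂uniformSphere d := by
  let U := Submodule.reflection (ℝ ∙ (a - b))ᗮ
  have hU : U a = b := Submodule.reflection_sub hab
  rw [← integral_uniformSphere_comp_isometry U (fun e => inner ℝ b e ^ 2), ← hU]
  simp only [LinearIsometryEquiv.inner_map_map]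

/-- The uniform distribution on the sphere is isotropic. -/
theorem integral_inner_sq_uniformSphere {d : ℕ} (hd : 1 ≤ d) (a : Vec d) :
    ∫ e, inner ℝ a e ^ 2 ∂uniformSphere d = ‖a‖ ^ 2 / d := by
  have := isProbabilityMeasure_uniformSphere hd
  have hd' : (d : ℝ) ≠ 0 := by positivity
  let b := EuclideanSpace.basisFun (Fin d) ℝ
  -- The squared coordinates of a unit vector add up to 1 and have equal means by symmetry, so each
  -- mean is `1/d`.
  have hsum : ∑ i, ∫ e, inner ℝ (b i) e ^ 2 ∂uniformSphere d = 1 := by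
    rw [← integral_finsetSum _ fun i _ => by
      simpa only [sq] using integrable_inner_mul_inner hd (b i) (b i)]
    have : (fun e => ∑ i, inner ℝ (b i) e ^ 2) =ᵐ[uniformSphere d] fun _ => 1 := by
      filter_upwards [ae_norm_eq_one_uniformSphere d] with e he
      have := b.sum_sq_norm_inner_right e
      simp only [Real.norm_eq_abs, sq_abs] at this
      rw [this, he, one_pow]
    rw [integral_congr_ae this]
    simp
  have hunit : ∀ i, ∫ e, inner ℝ (b i) e ^ 2 ∂uniformSphere d
      = ∫ e, inner ℝ (b ⟨0, hd⟩) e ^ 2 ∂uniformSphere d := fun i =>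
    integral_inner_sq_eq_of_norm_eq (by rw [b.norm_eq_one, b.norm_eq_one])
  simp only [hunit, Finset.sum_const, Finset.card_univ, Fintype.card_fin, nsmul_eq_mul] at hsum
  rw [integral_inner_sq_eq_of_norm_eq (b := ‖a‖ • b ⟨0, hd⟩)
    (by rw [norm_smul, b.norm_eq_one, norm_norm, mul_one])]
  simp only [inner_smul_left, mul_pow, conj_trivial, integral_const_mul]
  rw [eq_div_iff hd', mul_assoc, mul_comm _ (d : ℝ), hsum, mul_one]

theorem integral_inner_mul_inner_uniformSphere {d : ℕ} (hd : 1 ≤ d) (a b : Vec d) :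
    ∫ e, inner ℝ a e * inner ℝ b e ∂uniformSphere d = inner ℝ a b / d := by
  have h1 := integral_inner_sq_uniformSphere hd (a + b)
  have h2 := integral_inner_sq_uniformSphere hd (a - b)
  have h3 : ∫ e, inner ℝ a e * inner ℝ b e ∂uniformSphere d
      = ∫ e, (1 / 4 * inner ℝ (a + b) e ^ 2 - 1 / 4 * inner ℝ (a - b) e ^ 2) ∂uniformSphere d := by
    congr 1 with e
    rw [inner_add_left, inner_sub_left]
    ring
  have hint : ∀ c : Vec d, Integrable (fun e => 1 / 4 * inner ℝ c e ^ 2) (uniformSphere d) :=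
    fun c => by simpa only [sq] using (integrable_inner_mul_inner hd c c).const_mul (1 / 4)
  rw [h3, integral_sub (hint _) (hint _), integral_const_mul, integral_const_mul, h1, h2,
    norm_add_sq_real, norm_sub_sq_real]
  ring

/-- The fluctuation `d ⟨g, e⟩ e - g` of the directional estimate of the vector `g`. -/
noncomputable def dirNoise {d : ℕ} (g e : Vec d) : Vec d := ((d : ℝ) * inner ℝ g e) • e - g

theorem measurable_dirNoise {d : ℕ} : Measurable (fun p : Vec d × Vec d => dirNoise p.1 p.2) := by
  unfold dirNoise; fun_prop

theorem norm_dirNoise_le {d : ℕ} (g : Vec d) {e : Vec d} (he : ‖e‖ = 1) :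
    ‖dirNoise g e‖ ≤ (d + 1) * ‖g‖ := by
  refine (norm_sub_le _ _).trans ?_
  have h1 := norm_inner_le_norm (𝕜 := ℝ) g e
  rw [he, mul_one] at h1
  rw [norm_smul, he, mul_one, norm_mul, Real.norm_natCast, add_mul, one_mul]
  gcongr

theorem integrable_dirNoise {d : ℕ} (hd : 1 ≤ d) (g : Vec d) :
    Integrable (dirNoise g) (uniformSphere d) := by
  have := isProbabilityMeasure_uniformSphere hd
  refine Integrable.of_bound
    (measurable_dirNoise.comp measurable_prodMk_left).aestronglyMeasurable ((d + 1) * ‖g‖) ?_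
  filter_upwards [ae_norm_eq_one_uniformSphere d] with e he
  exact norm_dirNoise_le g he

/-- Isotropy says that the mean of `⟨g, e⟩⟨v, e⟩` is `⟨g, v⟩/d`, so the factor `d` makes the
directional estimate unbiased; this is tested against every `v`. -/
theorem integral_dirNoise {d : ℕ} (hd : 1 ≤ d) (g : Vec d) :
    ∫ e, dirNoise g e ∂uniformSphere d = 0 := by
  have := isProbabilityMeasure_uniformSphere hd
  have hd' : (d : ℝ) ≠ 0 := by positivity
  refine ext_inner_left ℝ fun v => ?_
  rw [← integral_inner (integrable_dirNoise hd g), inner_zero_right]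
  have : ∀ e, inner ℝ v (dirNoise g e) = d * (inner ℝ g e * inner ℝ v e) - inner ℝ v g := fun e => by
    rw [dirNoise, inner_sub_right, inner_smul_right]; ring
  simp only [this]
  rw [integral_sub ((integrable_inner_mul_inner hd g v).const_mul _) (integrable_const _),
    integral_const_mul, integral_inner_mul_inner_uniformSphere hd, integral_const, real_inner_comm]
  simp
  field_simp
  simp

/-- The exact value is `(d - 1)‖g‖²`. A bound linear in `d`, instead of the pointwise `(d+1)²‖g‖²`,
is what allows momentum of order `B/(B+d)`. -/
theorem integral_norm_dirNoise_sq_le {d : ℕ} (hd : 1 ≤ d) (g : Vec d) :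
    ∫ e, ‖dirNoise g e‖ ^ 2 ∂uniformSphere d ≤ d * ‖g‖ ^ 2 := by
  have := isProbabilityMeasure_uniformSphere hd
  have hd' : (d : ℝ) ≠ 0 := by positivity
  have : (fun e => ‖dirNoise g e‖ ^ 2) =ᵐ[uniformSphere d]
      fun e => (d ^ 2 - 2 * d) * inner ℝ g e ^ 2 + ‖g‖ ^ 2 := by
    filter_upwards [ae_norm_eq_one_uniformSphere d] with e he
    rw [dirNoise, norm_sub_sq_real, norm_smul, he, inner_smul_left, real_inner_comm, mul_one,
      norm_mul, Real.norm_natCast, mul_pow, Real.norm_eq_abs, sq_abs]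
    simp only [conj_trivial]
    ring
  rw [integral_congr_ae this, integral_add _ (integrable_const _), integral_const_mul,
    integral_inner_sq_uniformSphere hd, integral_const]
  · simp only [probReal_univ, one_smul]
    have : ((d : ℝ) ^ 2 - 2 * d) * (‖g‖ ^ 2 / d) + ‖g‖ ^ 2 = d * ‖g‖ ^ 2 - ‖g‖ ^ 2 := by
      field_simp; ring
    rw [this]
    have := sq_nonneg ‖g‖
    linarith
  · simpa only [sq] using (integrable_inner_mul_inner hd g g).const_mul _

/-! ### Markov chains -/

section Mixing

variable {S : Type*} [MeasurableSpace S] {d : ℕ}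

/-- The Jordan decomposition replaces `ν₁ - ν₂` by a difference of two positive measures whose total
masses add up to the total variation, and `Y` is bounded by `C` on each. -/
theorem norm_integral_sub_le_totalVariation (ν₁ ν₂ : Measure S) [IsFiniteMeasure ν₁]
    [IsFiniteMeasure ν₂] {Y : S → Vec d} (hY : Measurable Y) {C : ℝ} (hC : ∀ z, ‖Y z‖ ≤ C) :
    ‖∫ z, Y z ∂ν₁ - ∫ z, Y z ∂ν₂‖
      ≤ C * ((ν₁.toSignedMeasure - ν₂.toSignedMeasure).totalVariation Set.univ).toReal := by
  set s := ν₁.toSignedMeasure - ν₂.toSignedMeasure with hs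
  set j := s.toJordanDecomposition with hj
  have hint : ∀ (ν : Measure S) [IsFiniteMeasure ν], Integrable Y ν := fun ν _ =>
    Integrable.of_bound hY.aestronglyMeasurable C (Filter.Eventually.of_forall hC)
  have h1 : ν₁ + j.negPart = j.posPart + ν₂ := by
    rw [← Measure.toSignedMeasure_eq_toSignedMeasure_iff, Measure.toSignedMeasure_add,
      Measure.toSignedMeasure_add]
    have h2 : j.posPart.toSignedMeasure - j.negPart.toSignedMeasure
        = ν₁.toSignedMeasure - ν₂.toSignedMeasure := by
      rw [← hs, ← s.toSignedMeasure_toJordanDecomposition]; rfl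
    rw [← sub_eq_zero] at h2 ⊢
    rw [← neg_eq_zero, ← h2]
    abel
  have h2 : ∫ z, Y z ∂ν₁ + ∫ z, Y z ∂j.negPart = ∫ z, Y z ∂j.posPart + ∫ z, Y z ∂ν₂ := by
    rw [← integral_add_measure (hint _) (hint _), h1, integral_add_measure (hint _) (hint _)]
  have h3 : ∫ z, Y z ∂ν₁ - ∫ z, Y z ∂ν₂ = ∫ z, Y z ∂j.posPart - ∫ z, Y z ∂j.negPart := by
    rw [sub_eq_sub_iff_add_eq_add, h2]
  have h4 : s.totalVariation Set.univ = j.posPart Set.univ + j.negPart Set.univ := rfl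
  rw [h3, h4, ENNReal.toReal_add (measure_ne_top _ _) (measure_ne_top _ _), mul_add]
  exact (norm_sub_le _ _).trans (add_le_add
    (norm_integral_le_of_norm_le_const (Filter.Eventually.of_forall hC))
    (norm_integral_le_of_norm_le_const (Filter.Eventually.of_forall hC)))

theorem invariant_pow {Q : Kernel S S} {π : Measure S} (h : Kernel.Invariant Q π) (k : ℕ) :
    Kernel.Invariant (Q ^ k) π := by
  induction k with
  | zero => exact Measure.id_comp
  | succ k ih =>
    rw [Kernel.pow_add, pow_one]
    exact ih.comp h

/-- A bounded function that is centred at stationarity has geometrically small conditional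
expectations. -/
theorem IsMixing.norm_integral_pow_le {Q : Kernel S S} [IsMarkovKernel Q] {π : Measure S} {τ : ℕ}
    (h : IsMixing Q π τ) {Y : S → Vec d} (hY : Measurable Y) {C : ℝ} (hC : ∀ z, ‖Y z‖ ≤ C)
    (h0 : ∫ z, Y z ∂π = 0) (k : ℕ) (z : S) :
    ‖∫ y, Y y ∂(Q ^ k) z‖ ≤ 2 * C * (1 / 4) ^ (k / τ) := by
  have := h.prob
  have hC0 : 0 ≤ C := (norm_nonneg _).trans (hC z)
  have hint : ∀ (ν : Measure S) [IsFiniteMeasure ν], Integrable Y ν := fun ν _ =>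
    Integrable.of_bound hY.aestronglyMeasurable C (Filter.Eventually.of_forall hC)
  have h1 : ∫ z', ∫ y, Y y ∂(Q ^ k) z' ∂π = 0 := by
    rw [← h0]
    conv_rhs => rw [← (invariant_pow h.invariant k).def]
    have h2 : Integrable (fun q : S × S => Y q.2) (π ⊗ₘ (Q ^ k)) :=
      Integrable.of_bound (hY.comp measurable_snd).aestronglyMeasurable C
        (Filter.Eventually.of_forall fun q => hC q.2)
    rw [← Measure.snd_compProd, Measure.snd, integral_map measurable_snd.aemeasurable
      hY.aestronglyMeasurable, Measure.integral_compProd h2]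
  have hmeas : StronglyMeasurable fun z' => ∫ y, Y y ∂(Q ^ k) z' :=
    hY.stronglyMeasurable.integral_kernel
  have hb : ∀ z', ‖∫ y, Y y ∂(Q ^ k) z'‖ ≤ C := fun z' => by
    simpa using norm_integral_le_of_norm_le_const (μ := (Q ^ k) z') (Filter.Eventually.of_forall hC)
  -- Subtracting the stationary mean, which is zero, exhibits the quantity as an average of
  -- differences of two starting points.
  have h2 : ∫ y, Y y ∂(Q ^ k) z = ∫ z', (∫ y, Y y ∂(Q ^ k) z - ∫ y, Y y ∂(Q ^ k) z') ∂π := by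
    rw [integral_sub (integrable_const _) (Integrable.of_bound hmeas.aestronglyMeasurable C
      (Filter.Eventually.of_forall hb)), h1]
    simp
  rw [h2]
  have h3 : ∀ z', ‖∫ y, Y y ∂(Q ^ k) z - ∫ y, Y y ∂(Q ^ k) z'‖ ≤ 2 * C * (1 / 4) ^ (k / τ) :=
    fun z' => by
      refine (norm_integral_sub_le_totalVariation _ _ hY hC).trans ?_
      -- The Dobrushin coefficient contains half of the total variation, hence the factor 2 in the
      -- bound.
      have h4 : 2⁻¹ * (((Q ^ k) z).toSignedMeasure
          - ((Q ^ k) z').toSignedMeasure).totalVariation Set.univ ≤ (1 / 4 : ℝ≥0∞) ^ (k / τ) :=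
        (le_iSup₂ (f := fun z z' => 2⁻¹ * (((Q ^ k) z).toSignedMeasure
          - ((Q ^ k) z').toSignedMeasure).totalVariation Set.univ) z z').trans (h.decay k)
      have h5 := ENNReal.toReal_mono (by simp) h4
      rw [ENNReal.toReal_mul, ENNReal.toReal_pow] at h5
      simp only [ENNReal.toReal_inv, ENNReal.toReal_ofNat, ENNReal.toReal_div,
        ENNReal.toReal_one] at h5
      rw [mul_comm 2 C, mul_assoc]
      gcongr
      linarith
  simpa using norm_integral_le_of_norm_le_const (μ := π) (Filter.Eventually.of_forall h3)

/-- The summand is constant on blocks of length `τ`, so the full series equals `τ(1 + 1/4 + 1/16 +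
⋯)`. The induction peels off one block. -/
theorem sum_pow_div_le {τ : ℕ} (hτ : 1 ≤ τ) (N : ℕ) :
    ∑ r ∈ Finset.range N, (1 / 4 : ℝ) ^ (r / τ) ≤ 4 / 3 * τ := by
  induction N using Nat.strong_induction_on with
  | _ N ih =>
    rcases le_or_gt N τ with h | h
    · have h1 : ∑ r ∈ Finset.range N, (1 / 4 : ℝ) ^ (r / τ) ≤ ∑ r ∈ Finset.range N, (1 : ℝ) :=
        Finset.sum_le_sum fun r _ => pow_le_one₀ (by norm_num) (by norm_num)
      have h2 : (N : ℝ) ≤ τ := by exact_mod_cast h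
      simp only [Finset.sum_const, Finset.card_range, nsmul_eq_mul, mul_one] at h1
      linarith [(Nat.cast_nonneg τ : (0 : ℝ) ≤ τ)]
    · obtain ⟨M, rfl⟩ := Nat.exists_eq_add_of_le h.le
      have h1 : ∑ r ∈ Finset.range τ, (1 / 4 : ℝ) ^ (r / τ) = τ := by
        rw [Finset.sum_congr rfl fun r hr => by rw [Nat.div_eq_of_lt (Finset.mem_range.1 hr)]]
        simp
      have h2 : ∀ r, (1 / 4 : ℝ) ^ ((τ + r) / τ) = 1 / 4 * (1 / 4) ^ (r / τ) := fun r => by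
        rw [Nat.add_div_left _ hτ, pow_succ']
      rw [Finset.sum_range_add, h1]
      simp only [h2, ← Finset.mul_sum]
      linarith [ih M (by omega)]

end Mixing

/-! ### Path measures of the chain and the variance of sums along it -/

section Path

variable {S : Type*} [MeasurableSpace S]

/-- The transition kernels of a time-homogeneous Markov chain, depending on the whole past. -/
noncomputable def stepKernel (Q : Kernel S S) (n : ℕ) :
    Kernel ((i : Finset.Iic n) → (fun _ : ℕ => S) i) ((fun _ : ℕ => S) (n + 1)) :=
  Q.comap (fun u => u ⟨n, Finset.mem_Iic.2 le_rfl⟩) (measurable_pi_apply _)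

instance (Q : Kernel S S) [IsMarkovKernel Q] (n : ℕ) : IsMarkovKernel (stepKernel Q n) := by
  unfold stepKernel; infer_instance

/-- The law of the chain with kernel `Q` given its first `n + 1` states. -/
noncomputable def pathKernel (Q : Kernel S S) [IsMarkovKernel Q] (n : ℕ) :
    Kernel ((i : Finset.Iic n) → (fun _ : ℕ => S) i) (ℕ → S) :=
  Kernel.traj (X := fun _ => S) (stepKernel Q) n

instance (Q : Kernel S S) [IsMarkovKernel Q] (n : ℕ) : IsMarkovKernel (pathKernel Q n) := by
  unfold pathKernel; infer_instance

theorem ae_pathKernel_eq [MeasurableEq S] (Q : Kernel S S) [IsMarkovKernel Q] (n : ℕ)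
    (u : (i : Finset.Iic n) → S) (i : Finset.Iic n) :
    ∀ᵐ w ∂pathKernel Q n u, w i = u i := by
  rw [pathKernel, ← Kernel.traj_map_updateFinset, ae_map_iff
    (Measurable.aemeasurable measurable_updateFinset_left)]
  · exact Filter.Eventually.of_forall fun w => by simp [Function.updateFinset]
  · exact measurableSet_eq_fun (by fun_prop) (by fun_prop)

theorem map_partialTraj_last (Q : Kernel S S) [IsMarkovKernel Q] (n : ℕ)
    (u : (i : Finset.Iic n) → S) :
    (Kernel.partialTraj (X := fun _ => S) (stepKernel Q) n (n + 1) u).map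
      (fun x => x ⟨n + 1, Finset.mem_Iic.2 le_rfl⟩) = Q (u ⟨n, Finset.mem_Iic.2 le_rfl⟩) := by
  have h := DFunLike.congr_fun (Kernel.map_partialTraj_succ_self (X := fun _ => S) (κ := stepKernel Q) n) u
  rwa [Kernel.map_apply _ (measurable_pi_apply _)] at h

/-- Chapman–Kolmogorov: a path started at time `n` is a path started at `n + 1` after one
transition, so the induction on the lag `r` moves the starting time as well. -/
theorem pathKernel_eval_apply (Q : Kernel S S) [IsMarkovKernel Q] (n r : ℕ)
    (u : (i : Finset.Iic n) → S) {A : Set S} (hA : MeasurableSet A) :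
    pathKernel Q n u ((fun w => w (n + r + 1)) ⁻¹' A)
      = (Q ^ (r + 1)) (u ⟨n, Finset.mem_Iic.2 le_rfl⟩) A := by
  induction r generalizing n with
  | zero =>
    have h := DFunLike.congr_fun (Kernel.map_traj_succ_self (X := fun _ => S) (κ := stepKernel Q) (a := n)) u
    rw [Kernel.map_apply _ (measurable_pi_apply _)] at h
    rw [zero_add, pow_one, ← Measure.map_apply (measurable_pi_apply _) hA]
    exact congrArg (fun ν => ν A) h
  | succ r ih =>
    have h1 : pathKernel Q n u = (pathKernel Q (n + 1) ∘ₖ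
        Kernel.partialTraj (X := fun _ => S) (stepKernel Q) n (n + 1)) u :=
      (DFunLike.congr_fun (Kernel.traj_comp_partialTraj (X := fun _ => S) (κ := stepKernel Q) n.le_succ) u).symm
    have h2 : n + (r + 1) + 1 = (n + 1) + r + 1 := by ring
    rw [h2, h1, Kernel.comp_apply' _ _ _ (measurable_pi_apply _ hA)]
    simp only [ih (n + 1)]
    rw [add_comm (r + 1) 1, Kernel.pow_add_apply_eq_lintegral Q 1 (r + 1) _ hA, pow_one, ← map_partialTraj_last Q n u,
      lintegral_map (Kernel.measurable_coe _ hA) (measurable_pi_apply _)]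

theorem integral_pathKernel_eval {E : Type*} [NormedAddCommGroup E] [NormedSpace ℝ E]
    (Q : Kernel S S) [IsMarkovKernel Q] (n r : ℕ)
    (u : (i : Finset.Iic n) → S) {Y : S → E} (hY : StronglyMeasurable Y) :
    ∫ w, Y (w (n + r + 1)) ∂pathKernel Q n u
      = ∫ y, Y y ∂(Q ^ (r + 1)) (u ⟨n, Finset.mem_Iic.2 le_rfl⟩) := by
  have h : (pathKernel Q n u).map (fun w => w (n + r + 1))
      = (Q ^ (r + 1)) (u ⟨n, Finset.mem_Iic.2 le_rfl⟩) := by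
    ext A hA
    rw [Measure.map_apply (measurable_pi_apply _) hA, pathKernel_eval_apply Q n r u hA]
  rw [← h, integral_map (measurable_pi_apply _).aemeasurable hY.aestronglyMeasurable]

/-- Given the path up to time `a`, the first factor is a constant of norm at most `C`, and the
second has a conditional mean controlled by mixing. The bound is uniform in the past, hence survives
averaging over it. -/
theorem abs_integral_inner_le [MeasurableEq S] {d : ℕ} {Q : Kernel S S} [IsMarkovKernel Q]
    {π : Measure S} {τ : ℕ} (h : IsMixing Q π τ) {Y : S → Vec d} (hY : Measurable Y) {C : ℝ}
    (hC : ∀ z, ‖Y z‖ ≤ C) (h0 : ∫ z, Y z ∂π = 0) {n a : ℕ} (hna : n ≤ a) (r : ℕ)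
    (u : (i : Finset.Iic n) → S) :
    |∫ w, inner ℝ (Y (w a)) (Y (w (a + r + 1))) ∂pathKernel Q n u|
      ≤ 2 * C ^ 2 * (1 / 4) ^ ((r + 1) / τ) := by
  have hm : ∀ i, Measurable fun w : ℕ → S => Y (w i) := fun i => hY.comp (measurable_pi_apply i)
  have hint : Integrable (fun w : ℕ → S => inner ℝ (Y (w a)) (Y (w (a + r + 1))))
      (Kernel.traj (X := fun _ => S) (stepKernel Q) n u) := by
    refine Integrable.of_bound ((hm a).inner (hm _)).aestronglyMeasurable (C * C)
      (Filter.Eventually.of_forall fun w => (norm_inner_le_norm _ _).trans ?_)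
    exact mul_le_mul (hC _) (hC _) (norm_nonneg _) ((norm_nonneg _).trans (hC (w a)))
  have key : ∀ x : (i : Finset.Iic a) → S,
      ‖∫ w, inner ℝ (Y (w a)) (Y (w (a + r + 1))) ∂pathKernel Q a x‖
        ≤ 2 * C ^ 2 * (1 / 4) ^ ((r + 1) / τ) := fun x => by
    have h1 : (fun w : ℕ → S => inner ℝ (Y (w a)) (Y (w (a + r + 1)))) =ᵐ[pathKernel Q a x]
        fun w => inner ℝ (Y (x ⟨a, Finset.mem_Iic.2 le_rfl⟩)) (Y (w (a + r + 1))) := by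
      filter_upwards [ae_pathKernel_eq Q a x ⟨a, Finset.mem_Iic.2 le_rfl⟩] with w hw
      rw [hw]
    rw [integral_congr_ae h1, integral_inner (Integrable.of_bound (hm _).aestronglyMeasurable C
      (Filter.Eventually.of_forall fun w => hC _)), integral_pathKernel_eval _ _ _ _
      hY.stronglyMeasurable]
    refine (norm_inner_le_norm _ _).trans ?_
    have h2 := h.norm_integral_pow_le hY hC h0 (r + 1) (x ⟨a, Finset.mem_Iic.2 le_rfl⟩)
    calc _ ≤ C * (2 * C * (1 / 4) ^ ((r + 1) / τ)) :=
          mul_le_mul (hC _) h2 (norm_nonneg _) ((norm_nonneg _).trans (hC (x ⟨a, Finset.mem_Iic.2 le_rfl⟩)))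
      _ = _ := by ring
  have h2 := Kernel.integral_traj_partialTraj hna hint
  rw [pathKernel, ← h2, ← Real.norm_eq_abs]
  refine (norm_integral_le_of_norm_le_const
    (μ := Kernel.partialTraj (X := fun _ => S) (stepKernel Q) n a u)
    (Filter.Eventually.of_forall key)).trans_eq ?_
  rw [probReal_univ, mul_one]

/-- The variance of a sum of centred bounded functions along a mixing chain. -/
theorem integral_norm_sum_sq_le [MeasurableEq S] {d : ℕ} {Q : Kernel S S} [IsMarkovKernel Q]
    {π : Measure S} {τ : ℕ} (h : IsMixing Q π τ) {Y : S → Vec d} (hY : Measurable Y) {C : ℝ}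
    (hC : ∀ z, ‖Y z‖ ≤ C) (h0 : ∫ z, Y z ∂π = 0) (n : ℕ) (u : (i : Finset.Iic n) → S) (N : ℕ) :
    ∫ w, ‖∑ i ∈ Finset.range N, Y (w (n + i))‖ ^ 2 ∂pathKernel Q n u ≤ 6 * N * τ * C ^ 2 := by
  have hm : ∀ i, Measurable fun w : ℕ → S => Y (w i) := fun i => hY.comp (measurable_pi_apply i)
  have hms : ∀ N, Measurable fun w : ℕ → S => ∑ i ∈ Finset.range N, Y (w (n + i)) := fun N =>
    Finset.measurable_fun_sum _ fun i _ => hm _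
  have hbs : ∀ N (w : ℕ → S), ‖∑ i ∈ Finset.range N, Y (w (n + i))‖ ≤ N * C := fun N w => by
    refine (norm_sum_le_of_le _ fun i _ => hC (w (n + i))).trans (by simp)
  have hii : ∀ i j, Integrable (fun w : ℕ → S => inner ℝ (Y (w i)) (Y (w j)))
      (pathKernel Q n u) := fun i j => by
    refine Integrable.of_bound ((hm i).inner (hm j)).aestronglyMeasurable (C * C)
      (Filter.Eventually.of_forall fun w => (norm_inner_le_norm _ _).trans ?_)
    exact mul_le_mul (hC _) (hC _) (norm_nonneg _) ((norm_nonneg _).trans (hC (w i)))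
  induction N with
  | zero => simp
  | succ N ih =>
    have h1 : ∀ w : ℕ → S, ‖∑ i ∈ Finset.range (N + 1), Y (w (n + i))‖ ^ 2
        = ‖∑ i ∈ Finset.range N, Y (w (n + i))‖ ^ 2
          + (2 * ∑ i ∈ Finset.range N, inner ℝ (Y (w (n + i))) (Y (w (n + N)))
            + inner ℝ (Y (w (n + N))) (Y (w (n + N)))) := fun w => by
      rw [Finset.sum_range_succ, norm_add_sq_real, sum_inner, real_inner_self_eq_norm_sq, add_assoc]
    simp only [h1]
    have hi1 : Integrable (fun w : ℕ → S => ‖∑ i ∈ Finset.range N, Y (w (n + i))‖ ^ 2)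
        (pathKernel Q n u) := by
      refine Integrable.of_bound ((hms N).norm.pow_const 2).aestronglyMeasurable ((N * C) ^ 2)
        (Filter.Eventually.of_forall fun w => ?_)
      rw [norm_pow, norm_norm]
      gcongr
      exact hbs N w
    have hi2 : Integrable (fun w : ℕ → S => ∑ i ∈ Finset.range N,
        inner ℝ (Y (w (n + i))) (Y (w (n + N)))) (pathKernel Q n u) :=
      integrable_finsetSum _ fun i _ => hii _ _
    have hi3 : Integrable (fun w : ℕ → S => 2 * ∑ i ∈ Finset.range N,
        inner ℝ (Y (w (n + i))) (Y (w (n + N))) + inner ℝ (Y (w (n + N))) (Y (w (n + N))))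
        (pathKernel Q n u) := (hi2.const_mul 2).add (hii _ _)
    rw [integral_add hi1 hi3, integral_add (hi2.const_mul 2) (hii _ _),
      integral_const_mul, integral_finsetSum _ fun i _ => hii _ _]
    have h2 : ∫ w, inner ℝ (Y (w (n + N))) (Y (w (n + N))) ∂pathKernel Q n u ≤ C ^ 2 := by
      calc _ ≤ ∫ _w, C ^ 2 ∂pathKernel Q n u := by
            refine integral_mono (hii _ _) (integrable_const _) fun w => ?_
            simp only [real_inner_self_eq_norm_sq]
            gcongr
            exact hC _
        _ = _ := by simp
    -- Only lags at least 1 occur, so the term of lag 0, equal to 1, is removed from the geometric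
    -- sum `4τ/3`.
    have h3 : ∑ i ∈ Finset.range N, ∫ w, inner ℝ (Y (w (n + i))) (Y (w (n + N))) ∂pathKernel Q n u
        ≤ 2 * C ^ 2 * (4 / 3 * τ - 1) := by
      calc _ ≤ ∑ i ∈ Finset.range N, 2 * C ^ 2 * (1 / 4) ^ ((N - 1 - i + 1) / τ) := by
            refine Finset.sum_le_sum fun i hi => ?_
            have hi' := Finset.mem_range.1 hi
            have : n + N = n + i + (N - 1 - i) + 1 := by omega
            rw [this]
            exact (le_abs_self _).trans
              (abs_integral_inner_le h hY hC h0 (Nat.le_add_right n i) _ u)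
        _ = 2 * C ^ 2 * ∑ i ∈ Finset.range N, (1 / 4 : ℝ) ^ ((i + 1) / τ) := by
            rw [← Finset.mul_sum, Finset.sum_range_reflect (fun i => (1 / 4 : ℝ) ^ ((i + 1) / τ))]
        _ ≤ _ := by
            have h4 := sum_pow_div_le h.one_le (N + 1)
            rw [Finset.sum_range_succ'] at h4
            simp only [Nat.zero_div, pow_zero] at h4
            gcongr
            linarith
    -- Adding one summand costs at most `C² + 4C²(4τ/3 - 1)`, which is below `6τC²`.
    push_cast
    nlinarith [sq_nonneg C, mul_nonneg (sq_nonneg C) (Nat.cast_nonneg τ : (0 : ℝ) ≤ τ)]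

end Path

/-! ### From the conditional probabilities of a Markov chain to its law on paths -/

section ChainLaw

variable {S : Type*} [MeasurableSpace S] {Ω : Type*} [mΩ : MeasurableSpace Ω]

/-- The law of the next state given the whole past, for a Markov chain. -/
theorem IsMarkovChain.compProd_eq {P : Measure Ω} [IsProbabilityMeasure P] {Q : Kernel S S}
    [IsMarkovKernel Q] {Z : ℕ → Ω → S} (h : IsMarkovChain P Q Z) (n : ℕ) :
    (P.map (fun ω i => Z i ω)).map (Preorder.frestrictLe (π := fun _ => S) n) ⊗ₘ stepKernel Q n
      = (P.map (fun ω i => Z i ω)).map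
          (fun w => (Preorder.frestrictLe (π := fun _ => S) n w, w (n + 1))) := by
  have hZ : Measurable fun ω i => Z i ω := measurable_pi_lambda _ h.1
  have hfr : Measurable (Preorder.frestrictLe (π := fun _ => S) n) :=
    Preorder.measurable_frestrictLe n
  have hpair : Measurable
      (fun w : ℕ → S => (Preorder.frestrictLe (π := fun _ => S) n w, w (n + 1))) :=
    hfr.prodMk (measurable_pi_apply _)
  have := Measure.isProbabilityMeasure_map (μ := P) hZ.aemeasurable
  have := Measure.isProbabilityMeasure_map (μ := P.map (fun ω i => Z i ω)) hfr.aemeasurable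
  refine Measure.ext_prod fun {s t} hs ht => ?_
  have hq : Measurable fun w : ℕ → S => stepKernel Q n (Preorder.frestrictLe (π := fun _ => S) n w) t :=
    (Kernel.measurable_coe _ ht).comp hfr
  rw [Measure.compProd_apply_prod hs ht, Measure.map_apply hpair (hs.prod ht),
    setLIntegral_map hs (Kernel.measurable_coe _ ht) hfr,
    setLIntegral_map (hfr hs) hq hZ,
    Measure.map_apply hZ (hpair (hs.prod ht))]
  have htm : MeasurableSet (Z (n + 1) ⁻¹' t) := h.1 _ ht
  set m : MeasurableSpace Ω := ⨆ i ∈ Set.Iic n, MeasurableSpace.comap (Z i) inferInstance with hm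
  have hmle : m ≤ mΩ := iSup₂_le fun i _ => (h.1 i).comap_le
  set A : Set Ω := (fun ω i => Z i ω) ⁻¹' (Preorder.frestrictLe (π := fun _ => S) n ⁻¹' s) with hA
  have hAm : MeasurableSet[m] A := by
    have : Measurable[m] fun ω => Preorder.frestrictLe (π := fun _ => S) n (fun i => Z i ω) := by
      refine @measurable_pi_lambda _ _ _ m _ _ fun i => ?_
      have h1 : Measurable[MeasurableSpace.comap (Z i) inferInstance] (Z i) :=
        comap_measurable (Z i)
      exact h1.mono (le_iSup₂_of_le (i : ℕ) (Finset.mem_Iic.1 i.2) le_rfl) le_rfl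
    exact this hs
  have hAm' : MeasurableSet[mΩ] A := hmle _ hAm
  -- The event `A` belongs to the past, so integrating the conditional probability over it gives the
  -- probability of `A` together with a transition into `t`.
  have h1 := setIntegral_condExp (μ := P) hmle
    ((integrable_const (1 : ℝ)).indicator htm) hAm
  rw [setIntegral_congr_ae (g := fun ω => (Q (Z n ω)).real t) hAm' (by
    filter_upwards [h.2 n t ht] with ω hω _ using hω)] at h1
  rw [setIntegral_indicator htm, setIntegral_const, smul_eq_mul, mul_one] at h1
  have h2 : ∫⁻ ω in A, Q (Z n ω) t ∂P = ENNReal.ofReal (∫ ω in A, (Q (Z n ω)).real t ∂P) := by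
    rw [ofReal_integral_eq_lintegral_ofReal]
    · exact lintegral_congr fun ω => (ofReal_measureReal).symm
    · refine Integrable.of_bound
        (((Kernel.measurable_coe Q ht).comp (h.1 n)).ennreal_toReal.aestronglyMeasurable) 1
        (Filter.Eventually.of_forall fun ω => ?_)
      rw [Real.norm_of_nonneg measureReal_nonneg]
      exact measureReal_le_one
    · exact Filter.Eventually.of_forall fun ω => measureReal_nonneg
  rw [h1, ofReal_measureReal] at h2
  exact h2

/-- A probability measure on paths is determined by its restriction to the first `n + 1` states and
the subsequent transition kernels. -/
theorem path_measure_ext {Q : Kernel S S} [IsMarkovKernel Q] {ν₁ ν₂ : Measure (ℕ → S)}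
    [IsProbabilityMeasure ν₁] [IsProbabilityMeasure ν₂] (n : ℕ)
    (h0 : ν₁.map (Preorder.frestrictLe (π := fun _ => S) n)
      = ν₂.map (Preorder.frestrictLe (π := fun _ => S) n))
    (h1 : ∀ b ≥ n, ν₁.map (Preorder.frestrictLe (π := fun _ => S) b) ⊗ₘ stepKernel Q b
      = ν₁.map (fun w => (Preorder.frestrictLe (π := fun _ => S) b w, w (b + 1))))
    (h2 : ∀ b ≥ n, ν₂.map (Preorder.frestrictLe (π := fun _ => S) b) ⊗ₘ stepKernel Q b
      = ν₂.map (fun w => (Preorder.frestrictLe (π := fun _ => S) b w, w (b + 1)))) :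
    ν₁ = ν₂ := by
  have hfr : ∀ n : ℕ, Measurable (Preorder.frestrictLe (π := fun _ => S) n) :=
    fun n => Preorder.measurable_frestrictLe n
  have key : ∀ b ≥ n, ν₁.map (Preorder.frestrictLe (π := fun _ => S) b)
      = ν₂.map (Preorder.frestrictLe (π := fun _ => S) b) := by
    intro b hb
    induction b, hb using Nat.le_induction with
    | base => exact h0
    | succ b hb ih =>
      let ext : ((i : Finset.Iic b) → S) × S → ((i : Finset.Iic (b + 1)) → S) :=
        fun q i => if hi : (i : ℕ) ≤ b then q.1 ⟨i, Finset.mem_Iic.2 hi⟩ else q.2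
      have hext : Measurable ext := by
        refine measurable_pi_lambda _ fun i => ?_
        by_cases hi : (i : ℕ) ≤ b
        · simp only [ext, hi, dite_true]
          exact (measurable_pi_apply _).comp measurable_fst
        · simp only [ext, hi, dite_false]
          exact measurable_snd
      have hcomp : ∀ ν : Measure (ℕ → S), ν.map (Preorder.frestrictLe (π := fun _ => S) (b + 1))
          = (ν.map (fun w => (Preorder.frestrictLe (π := fun _ => S) b w, w (b + 1)))).map ext := by
        intro ν
        rw [Measure.map_map hext ((hfr b).prodMk (measurable_pi_apply _))]
        congr 1
        ext w i
        by_cases hi : (i : ℕ) ≤ b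
        · simp [ext, hi]
        · have : (i : ℕ) = b + 1 := le_antisymm (Finset.mem_Iic.1 i.2) (by omega)
          simp [ext, this]
      rw [hcomp, hcomp, ← h1 b hb, ← h2 b hb, ih]
  -- Every finite set of times lies in an initial segment beyond `n`; hence both measures are
  -- projective limits of the same finite-dimensional laws, and such a limit is unique.
  have hlim : ∀ ν : Measure (ℕ → S), (∀ b ≥ n, ν₁.map (Preorder.frestrictLe (π := fun _ => S) b)
      = ν.map (Preorder.frestrictLe (π := fun _ => S) b)) →
      IsProjectiveLimit ν (fun I : Finset ℕ => ν₁.map (I.restrict (π := fun _ => S))) := by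
    intro ν hν I
    have hI : I ⊆ Finset.Iic (max n (I.sup id)) := fun i hi =>
      Finset.mem_Iic.2 ((Finset.le_sup (f := id) hi).trans (le_max_right _ _))
    have := hν _ (le_max_left n (I.sup id))
    have h3 : ∀ ν : Measure (ℕ → S), ν.map (I.restrict (π := fun _ => S))
        = (ν.map (Preorder.frestrictLe (π := fun _ => S) (max n (I.sup id)))).map
          (Finset.restrict₂ (π := fun _ => S) hI) := fun ν =>
      (Measure.map_map (Finset.measurable_restrict₂ (X := fun _ => S) hI) (hfr _)).symm
    change _ = ν₁.map _
    rw [h3 ν, h3 ν₁, this]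
  have : ∀ I : Finset ℕ, IsFiniteMeasure (ν₁.map (I.restrict (π := fun _ => S))) :=
    fun I => inferInstance
  exact (hlim ν₁ fun _ _ => rfl).unique (hlim ν₂ key)

/-- The law of a Markov chain given its first `n + 1` states. -/
theorem IsMarkovChain.map_eq_comp {P : Measure Ω} [IsProbabilityMeasure P] {Q : Kernel S S}
    [IsMarkovKernel Q] {Z : ℕ → Ω → S} (h : IsMarkovChain P Q Z) (n : ℕ) :
    P.map (fun ω i => Z i ω) = pathKernel Q n ∘ₘ
      (P.map (fun ω i => Z i ω)).map (Preorder.frestrictLe (π := fun _ => S) n) := by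
  have hZ : Measurable fun ω i => Z i ω := measurable_pi_lambda _ h.1
  have hfr : ∀ n : ℕ, Measurable (Preorder.frestrictLe (π := fun _ => S) n) :=
    fun n => Preorder.measurable_frestrictLe n
  have := Measure.isProbabilityMeasure_map (μ := P) hZ.aemeasurable
  have := Measure.isProbabilityMeasure_map (μ := P.map (fun ω i => Z i ω)) (hfr n).aemeasurable
  set ν₀ := (P.map (fun ω i => Z i ω)).map (Preorder.frestrictLe (π := fun _ => S) n)
  refine path_measure_ext (Q := Q) n ?_ (fun b _ => h.compProd_eq b) fun b hb => ?_
  · rw [Measure.map_comp _ _ (hfr n), pathKernel, Kernel.traj_map_frestrictLe,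
      Kernel.partialTraj_self, Measure.id_comp]
  · rw [Measure.compProd_eq_comp_prod, Measure.map_comp _ _ (hfr b), pathKernel,
      Kernel.traj_map_frestrictLe, Measure.comp_assoc,
      Measure.map_comp _ _ ((hfr b).prodMk (measurable_pi_apply _))]
    congr 1
    ext u : 1
    rw [Kernel.comp_apply, ← Measure.compProd_eq_comp_prod,
      Kernel.map_apply _ ((hfr b).prodMk (measurable_pi_apply _)),
      Kernel.partialTraj_compProd_eq_map_traj hb]

/-- The expectation of a function of a Markov chain can be computed by resampling the chain after
time `n`. -/
theorem IsMarkovChain.lintegral_eq [MeasurableEq S] {P : Measure Ω} [IsProbabilityMeasure P]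
    {Q : Kernel S S} [IsMarkovKernel Q] {Z : ℕ → Ω → S} (h : IsMarkovChain P Q Z) (n : ℕ)
    {G : (ℕ → S) → (ℕ → S) → ℝ≥0∞} (hG : Measurable (Function.uncurry G))
    (hdep : ∀ w w' z, (∀ i ≤ n, w i = w' i) → G w z = G w' z) :
    ∫⁻ w, G w w ∂P.map (fun ω i => Z i ω)
      = ∫⁻ w, ∫⁻ z, G w z ∂pathKernel Q n (Preorder.frestrictLe (π := fun _ => S) n w)
          ∂P.map (fun ω i => Z i ω) := by
  have hfr : Measurable (Preorder.frestrictLe (π := fun _ => S) n) :=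
    Preorder.measurable_frestrictLe n
  have hdiag : Measurable fun w : ℕ → S => G w w := hG.comp (measurable_id.prodMk measurable_id)
  conv_lhs => rw [h.map_eq_comp n]
  rw [Measure.lintegral_bind (Kernel.aemeasurable _) hdiag.aemeasurable,
    lintegral_map hdiag.lintegral_kernel hfr]
  refine lintegral_congr fun w => lintegral_congr_ae ?_
  have : ∀ᵐ z ∂pathKernel Q n (Preorder.frestrictLe (π := fun _ => S) n w),
      ∀ i : Finset.Iic n, z i = w i :=
    ae_all_iff.2 fun i => ae_pathKernel_eq Q n _ i
  filter_upwards [this] with z hz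
  exact hdep _ _ _ fun i hi => hz ⟨i, Finset.mem_Iic.2 hi⟩

end ChainLaw

/-! ### Independent sequences -/

section Concat

variable {X : Type*}

/-- The sequence that follows `u` up to time `n` (excluded) and then starts `v`. -/
def concat (n : ℕ) (u v : ℕ → X) : ℕ → X := fun i => if i < n then u i else v (i - n)

theorem concat_of_lt {n i : ℕ} (h : i < n) (u v : ℕ → X) : concat n u v i = u i := if_pos h

theorem concat_add (n i : ℕ) (u v : ℕ → X) : concat n u v (n + i) = v i := by
  simp [concat]

variable [MeasurableSpace X]

theorem measurable_concat (n : ℕ) :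
    Measurable (fun q : (ℕ → X) × (ℕ → X) => concat n q.1 q.2) := by
  refine measurable_pi_lambda _ fun i => ?_
  by_cases hi : i < n
  · simp only [concat, hi, if_true]; fun_prop
  · simp only [concat, hi, if_false]; fun_prop

/-- On a box the event for the concatenation is a product of a box for the prefix and a shifted box
for the tail, and boxes determine the infinite product measure. -/
theorem map_concat_infinitePi (ρ : Measure X) [IsProbabilityMeasure ρ] (n : ℕ) :
    ((Measure.infinitePi fun _ : ℕ => ρ).prod (Measure.infinitePi fun _ : ℕ => ρ)).map
      (fun q => concat n q.1 q.2) = Measure.infinitePi fun _ : ℕ => ρ := by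
  refine Measure.eq_infinitePi _ fun s t ht => ?_
  rw [Measure.map_apply (measurable_concat n)
    (MeasurableSet.pi s.countable_toSet fun i _ => ht i)]
  have hset : (fun q : (ℕ → X) × (ℕ → X) => concat n q.1 q.2) ⁻¹' (Set.pi s t)
      = (Set.pi (s.filter (· < n) : Finset ℕ) t) ×ˢ
        (Set.pi (((s.filter (¬ · < n)).image (· - n)) : Finset ℕ) fun i => t (n + i)) := by
    ext ⟨u, v⟩
    simp only [Set.mem_preimage, Set.mem_pi, Finset.mem_coe, Set.mem_prod, Finset.mem_filter,
      Finset.mem_image]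
    constructor
    · refine fun h => ⟨fun i hi => ?_, ?_⟩
      · simpa [concat, hi.2] using h i hi.1
      · rintro _ ⟨i, ⟨hi, hin⟩, rfl⟩
        have := h i hi
        rw [concat, if_neg hin] at this
        rwa [Nat.add_sub_cancel' (not_lt.1 hin)]
    · rintro ⟨h1, h2⟩ i hi
      by_cases hin : i < n
      · simpa [concat, hin] using h1 i ⟨hi, hin⟩
      · have := h2 (i - n) ⟨i, ⟨hi, hin⟩, rfl⟩
        rw [Nat.add_sub_cancel' (not_lt.1 hin)] at this
        rwa [concat, if_neg hin]
  rw [hset, Measure.prod_prod, Measure.infinitePi_pi _ fun i _ => ht i,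
    Measure.infinitePi_pi _ fun i _ => ht (n + i), Finset.prod_image, ← Finset.prod_filter_mul_prod_filter_not s (· < n)]
  · congr 1
    refine Finset.prod_congr rfl fun i hi => ?_
    rw [Nat.add_sub_cancel' (not_lt.1 (Finset.mem_filter.1 hi).2)]
  · intro i hi j hj hij
    have h1 := (Finset.mem_filter.1 hi).2
    have h2 := (Finset.mem_filter.1 hj).2
    simp only at hij
    omega

/-- The expectation of a function of an independent sequence can be computed by resampling the
sequence after time `n`. -/
theorem lintegral_infinitePi_eq (ρ : Measure X) [IsProbabilityMeasure ρ] (n : ℕ)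
    {G : (ℕ → X) → (ℕ → X) → ℝ≥0∞} (hG : Measurable (Function.uncurry G))
    (hdep : ∀ w w' z, (∀ i < n, w i = w' i) → G w z = G w' z) :
    ∫⁻ w, G w (fun i => w (n + i)) ∂Measure.infinitePi (fun _ : ℕ => ρ)
      = ∫⁻ w, ∫⁻ z, G w z ∂Measure.infinitePi (fun _ : ℕ => ρ)
          ∂Measure.infinitePi (fun _ : ℕ => ρ) := by
  have hshift : Measurable fun w : ℕ → X => (w, fun i => w (n + i)) := by fun_prop
  conv_lhs => rw [← map_concat_infinitePi ρ n]
  have hG' : Measurable fun w : ℕ → X => G w (fun i => w (n + i)) := hG.comp hshift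
  rw [lintegral_map hG' (measurable_concat n)]
  simp only [concat_add]
  rw [lintegral_prod _ (by
    exact (hG.comp ((measurable_concat n).prodMk measurable_snd)).aemeasurable)]
  exact lintegral_congr fun w => lintegral_congr fun z =>
    hdep _ _ _ fun i hi => concat_of_lt hi _ _

end Concat

/-! ### Consequences of the assumptions on the problem -/

section Problem

variable {d : ℕ} {S : Type*} [MeasurableSpace S] {F : Vec d → S → ℝ} {Q : Kernel S S}
  [IsMarkovKernel Q] {π : Measure S} {L μ σ : ℝ} {τ : ℕ}

theorem TwoPointAssumptions.measurable_uncurry (h : TwoPointAssumptions F Q π L μ σ τ) :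
    Measurable (Function.uncurry F) :=
  measurable_uncurry_of_continuous_of_measurable (fun z => (h.smooth z).1.continuous) h.measurable

/-- Directional derivatives are limits of the difference quotients with step `1/(n+1)`, which are
measurable in `z`; the gradient is assembled from those along the coordinate vectors. -/
theorem TwoPointAssumptions.measurable_gradient (h : TwoPointAssumptions F Q π L μ σ τ)
    (x : Vec d) : Measurable fun z => gradient (fun y => F y z) x := by
  have hcoord : ∀ v : Vec d, Measurable fun z => inner ℝ (gradient (fun y => F y z) x) v := by
    intro v
    refine measurable_of_tendsto_metrizable
      (f := fun (n : ℕ) z => ((n : ℝ) + 1) * (F (x + (1 / ((n : ℝ) + 1)) • v) z - F x z)) ?_ ?_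
    · exact fun n => ((h.measurable _).sub (h.measurable _)).const_mul _
    · rw [tendsto_pi_nhds]
      intro z
      have h1 := hasDerivAt_along_line (h.smooth z).1 x v 0
      rw [zero_smul, add_zero, hasDerivAt_iff_tendsto_slope] at h1
      have h2 : Filter.Tendsto (fun n : ℕ => 1 / ((n : ℝ) + 1)) Filter.atTop
          (nhdsWithin 0 {0}ᶜ) :=
        tendsto_nhdsWithin_iff.2 ⟨tendsto_one_div_add_atTop_nhds_zero_nat,
          Filter.Eventually.of_forall fun n => by
            simp only [Set.mem_compl_iff, Set.mem_singleton_iff]; positivity⟩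
      refine (h1.comp h2).congr fun n => ?_
      simp [slope_def_field, div_eq_mul_inv, mul_comm]
  have : (fun z => gradient (fun y => F y z) x) = fun z => WithLp.toLp 2 fun i =>
      inner ℝ (gradient (fun y => F y z) x) (EuclideanSpace.single i (1 : ℝ)) := by
    ext z i
    change _ = inner ℝ _ (EuclideanSpace.single i (1 : ℝ))
    rw [EuclideanSpace.inner_single_right]
    simp
  rw [this]
  exact (WithLp.measurable_toLp 2 _).comp (measurable_pi_lambda _ fun i => hcoord _)

/-- The deviation of the stochastic gradient from the gradient of the objective. -/
noncomputable def gradNoise (F : Vec d → S → ℝ) (π : Measure S) (x : Vec d) (z : S) : Vec d :=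
  gradient (fun y => F y z) x - gradient (objective F π) x

theorem TwoPointAssumptions.measurable_gradNoise (h : TwoPointAssumptions F Q π L μ σ τ)
    (x : Vec d) : Measurable (gradNoise F π x) :=
  (h.measurable_gradient x).sub measurable_const

theorem TwoPointAssumptions.norm_gradNoise_le (h : TwoPointAssumptions F Q π L μ σ τ) (hσ : 0 ≤ σ)
    (x : Vec d) (z : S) : ‖gradNoise F π x z‖ ≤ σ :=
  abs_le_of_sq_le_sq' (h.noise x z) hσ |>.2

theorem TwoPointAssumptions.norm_gradient_le (h : TwoPointAssumptions F Q π L μ σ τ) (hσ : 0 ≤ σ)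
    (x : Vec d) (z : S) :
    ‖gradient (fun y => F y z) x‖ ≤ ‖gradient (objective F π) x‖ + σ := by
  have h1 := h.norm_gradNoise_le hσ x z
  have h2 : gradient (fun y => F y z) x = gradient (objective F π) x + gradNoise F π x z := by
    rw [gradNoise]; abel
  rw [h2]
  exact (norm_add_le _ _).trans (by gcongr)

theorem TwoPointAssumptions.integrable_gradient (h : TwoPointAssumptions F Q π L μ σ τ)
    (hσ : 0 ≤ σ) (x : Vec d) : Integrable (fun z => gradient (fun y => F y z) x) π := by
  have := h.mixing.prob
  exact Integrable.of_bound (h.measurable_gradient x).aestronglyMeasurable _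
    (Filter.Eventually.of_forall (h.norm_gradient_le hσ x))

theorem TwoPointAssumptions.integral_gradNoise (h : TwoPointAssumptions F Q π L μ σ τ)
    (hσ : 0 ≤ σ) (x : Vec d) : ∫ z, gradNoise F π x z ∂π = 0 := by
  have := h.mixing.prob
  unfold gradNoise
  rw [integral_sub (h.integrable_gradient hσ x) (integrable_const _), h.unbiased]
  simp

theorem TwoPointAssumptions.isLSmooth_objective (h : TwoPointAssumptions F Q π L μ σ τ)
    (hσ : 0 ≤ σ) : IsLSmooth L (objective F π) := by
  have := h.mixing.prob
  refine ⟨h.convex.1.differentiable (by simp), fun x y => ?_⟩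
  rw [← h.unbiased, ← h.unbiased, ← integral_sub (h.integrable_gradient hσ x)
    (h.integrable_gradient hσ y)]
  simpa using norm_integral_le_of_norm_le_const (μ := π)
    (Filter.Eventually.of_forall fun z => (h.smooth z).2 x y)

end Problem

/-! ### Moments of the batch estimator -/

theorem _root_.Measurable.dirNoise {α : Type*} [MeasurableSpace α] {d : ℕ} {f g : α → Vec d}
    (hf : Measurable f) (hg : Measurable g) : Measurable fun a => dirNoise (f a) (g a) := by
  unfold ZeroOrder.dirNoise
  exact (((hf.inner hg).const_mul (d : ℝ)).smul hg).sub hf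

/-! ### Sums of direction noise over independent directions -/

section Directions

variable {d : ℕ} [NeZero d]

instance : IsProbabilityMeasure (uniformSphere d) :=
  isProbabilityMeasure_uniformSphere (NeZero.pos d)

variable (d) in
/-- The law of an independent sequence of uniform directions. -/
noncomputable def dirLaw : Measure (ℕ → Vec d) := Measure.infinitePi fun _ => uniformSphere d

instance : IsProbabilityMeasure (dirLaw d) := by unfold dirLaw; infer_instance

theorem measurePreserving_eval_dirLaw (i : ℕ) :
    MeasurePreserving (Function.eval i) (dirLaw d) (uniformSphere d) :=
  measurePreserving_eval_infinitePi (fun _ : ℕ => uniformSphere d) i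

theorem ae_norm_eq_one_dirLaw : ∀ᵐ e ∂dirLaw d, ∀ i, ‖e i‖ = 1 :=
  ae_all_iff.2 fun i =>
    (measurePreserving_eval_dirLaw i).quasiMeasurePreserving.ae (ae_norm_eq_one_uniformSphere d)

omit [NeZero d] in
theorem measurable_dirNoise_right (g : Vec d) : Measurable (dirNoise g) :=
  measurable_const.dirNoise measurable_id

theorem integrable_dirNoise_eval (g : Vec d) (i : ℕ) :
    Integrable (fun e => dirNoise g (e i)) (dirLaw d) :=
  ((measurePreserving_eval_dirLaw i).integrable_comp
    (measurable_dirNoise_right g).aestronglyMeasurable).2 (integrable_dirNoise (NeZero.pos d) g)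

theorem integral_comp_eval_dirLaw {E : Type*} [NormedAddCommGroup E] [NormedSpace ℝ E]
    {f : Vec d → E} (hf : StronglyMeasurable f) (i : ℕ) :
    ∫ e, f (e i) ∂dirLaw d = ∫ e, f e ∂uniformSphere d := by
  rw [← (measurePreserving_eval_dirLaw i).map_eq, integral_map (measurable_pi_apply i).aemeasurable
    hf.aestronglyMeasurable]

theorem integral_dirNoise_eval (g : Vec d) (i : ℕ) : ∫ e, dirNoise g (e i) ∂dirLaw d = 0 := by
  rw [integral_comp_eval_dirLaw (measurable_dirNoise_right g).stronglyMeasurable,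
    integral_dirNoise (NeZero.pos d)]

theorem integral_inner_dirNoise (g g' : Vec d) {i j : ℕ} (hij : i ≠ j) :
    ∫ e, inner ℝ (dirNoise g (e i)) (dirNoise g' (e j)) ∂dirLaw d = 0 := by
  have h1 : iIndepFun (fun (k : ℕ) (e : ℕ → Vec d) => e k) (dirLaw d) :=
    iIndepFun_infinitePi (P := fun _ : ℕ => uniformSphere d) (X := fun _ x => x)
      fun _ => measurable_id
  have h2 : ∫ e, inner ℝ (dirNoise g (e i)) (dirNoise g' (e j)) ∂dirLaw d
      = inner ℝ (∫ e, dirNoise g (e i) ∂dirLaw d) (∫ e, dirNoise g' (e j) ∂dirLaw d) :=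
    ((h1.indepFun hij).comp (measurable_dirNoise_right g)
      (measurable_dirNoise_right g')).integral_bilin (integrable_dirNoise_eval g i)
      (integrable_dirNoise_eval g' j) (innerSL ℝ)
  rw [h2, integral_dirNoise_eval, inner_zero_left]

theorem ae_norm_sum_dirNoise_le (g : ℕ → Vec d) {C : ℝ} (hC : ∀ i, ‖g i‖ ≤ C) (N : ℕ) :
    ∀ᵐ e ∂dirLaw d, ‖∑ i ∈ Finset.range N, dirNoise (g i) (e i)‖ ≤ N * ((d + 1) * C) := by
  filter_upwards [ae_norm_eq_one_dirLaw] with e he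
  refine (norm_sum_le_of_le (Finset.range N) fun i _ => (norm_dirNoise_le (g i) (he i)).trans
    (mul_le_mul_of_nonneg_left (hC i) (by positivity))).trans (by simp)

/-- Distinct directions are independent and their noises centred, so the cross terms vanish even
though the vectors `g i` differ; they are gradients at different noise states. -/
theorem integral_norm_sum_dirNoise_sq_le (g : ℕ → Vec d) {C : ℝ} (hC : ∀ i, ‖g i‖ ≤ C) (N : ℕ) :
    ∫ e, ‖∑ i ∈ Finset.range N, dirNoise (g i) (e i)‖ ^ 2 ∂dirLaw d ≤ N * (d * C ^ 2) := by
  have hm : ∀ i, Measurable fun e : ℕ → Vec d => dirNoise (g i) (e i) := fun i =>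
    (measurable_dirNoise_right (g i)).comp (measurable_pi_apply i)
  have hii : ∀ i j, Integrable (fun e : ℕ → Vec d =>
      inner ℝ (dirNoise (g i) (e i)) (dirNoise (g j) (e j))) (dirLaw d) := fun i j => by
    refine Integrable.of_bound ((hm i).inner (hm j)).aestronglyMeasurable
      (((d + 1) * ‖g i‖) * ((d + 1) * ‖g j‖)) ?_
    filter_upwards [ae_norm_eq_one_dirLaw] with e he
    refine (norm_inner_le_norm _ _).trans ?_
    exact mul_le_mul (norm_dirNoise_le _ (he i)) (norm_dirNoise_le _ (he j)) (norm_nonneg _)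
      (by positivity)
  induction N with
  | zero => simp
  | succ N ih =>
    have h1 : ∀ e : ℕ → Vec d, ‖∑ i ∈ Finset.range (N + 1), dirNoise (g i) (e i)‖ ^ 2
        = ‖∑ i ∈ Finset.range N, dirNoise (g i) (e i)‖ ^ 2
          + (2 * ∑ i ∈ Finset.range N, inner ℝ (dirNoise (g i) (e i)) (dirNoise (g N) (e N))
            + ‖dirNoise (g N) (e N)‖ ^ 2) := fun e => by
      rw [Finset.sum_range_succ, norm_add_sq_real, sum_inner, add_assoc]
    simp only [h1]
    have hi1 : Integrable (fun e : ℕ → Vec d => ‖∑ i ∈ Finset.range N, dirNoise (g i) (e i)‖ ^ 2)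
        (dirLaw d) := by
      refine Integrable.of_bound ((Finset.measurable_fun_sum _ fun i _ => hm
        i).norm.pow_const 2).aestronglyMeasurable ((N * ((d + 1) * C)) ^ 2) ?_
      filter_upwards [ae_norm_sum_dirNoise_le g hC N] with e he
      rw [norm_pow, norm_norm]
      gcongr
    have hi2 : Integrable (fun e : ℕ → Vec d => ∑ i ∈ Finset.range N,
        inner ℝ (dirNoise (g i) (e i)) (dirNoise (g N) (e N))) (dirLaw d) :=
      integrable_finsetSum _ fun i _ => hii _ _
    have hi3 : Integrable (fun e : ℕ → Vec d => ‖dirNoise (g N) (e N)‖ ^ 2) (dirLaw d) := by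
      simpa only [real_inner_self_eq_norm_sq] using hii N N
    have hi4 : Integrable (fun e : ℕ → Vec d => 2 * ∑ i ∈ Finset.range N,
        inner ℝ (dirNoise (g i) (e i)) (dirNoise (g N) (e N)) + ‖dirNoise (g N) (e N)‖ ^ 2)
        (dirLaw d) := (hi2.const_mul 2).add hi3
    rw [integral_add hi1 hi4, integral_add (hi2.const_mul 2) hi3, integral_const_mul,
      integral_finsetSum _ fun i _ => hii _ _,
      Finset.sum_eq_zero fun i hi => integral_inner_dirNoise _ _ (Finset.mem_range.1 hi).ne,
      integral_comp_eval_dirLaw (f := fun e => ‖dirNoise (g N) e‖ ^ 2)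
        ((measurable_dirNoise_right (g N)).norm.pow_const 2).stronglyMeasurable]
    have h2 := integral_norm_dirNoise_sq_le (NeZero.pos d) (g N)
    have h3 : (d : ℝ) * ‖g N‖ ^ 2 ≤ d * C ^ 2 := by gcongr; exact hC N
    push_cast
    linarith

end Directions

theorem norm_integral_sq_le {α : Type*} [MeasurableSpace α] {ν : Measure α} [IsProbabilityMeasure ν]
    {d : ℕ} {f : α → Vec d} (hf : Integrable f ν) (hf2 : Integrable (fun x => ‖f x‖ ^ 2) ν) :
    ‖∫ x, f x ∂ν‖ ^ 2 ≤ ∫ x, ‖f x‖ ^ 2 ∂ν :=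
  (convexOn_univ_norm.pow (fun _ _ => norm_nonneg _) 2).map_integral_le
    (continuous_norm.pow 2).continuousOn isClosed_univ (by simp) hf hf2

/-- No integrability is needed: a non-integrable function has integral 0, which the sign of `C`
covers. -/
theorem integral_le_of_forall_le {α : Type*} [MeasurableSpace α] {ν : Measure α}
    [IsProbabilityMeasure ν] {f : α → ℝ} {C : ℝ} (hC : 0 ≤ C) (hf : ∀ x, f x ≤ C) :
    ∫ x, f x ∂ν ≤ C := by
  by_cases hi : Integrable f ν
  · simpa using integral_mono hi (integrable_const C) hf
  · rwa [integral_undef hi]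

/-! ### Bias and mean square error of one batch, given the past -/

section Batch

variable {d : ℕ} {S : Type*} [MeasurableSpace S] {F : Vec d → S → ℝ} {Q : Kernel S S}
  [IsMarkovKernel Q] {π : Measure S} {L μ σ : ℝ} {τ : ℕ}

/-- The approximation error of the two-point estimator. -/
noncomputable def gErr (F : Vec d → S → ℝ) (t : ℝ) (x : Vec d) (z : S) (e : Vec d) : Vec d :=
  gHat F t x z e - gradient (fun y => F y z) x - dirNoise (gradient (fun y => F y z) x) e

omit [MeasurableSpace S] in
theorem norm_gErr_le {t : ℝ} (ht : 0 < t) {z : S} (hF : IsLSmooth L fun y => F y z)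
    (x : Vec d) {e : Vec d} (he : ‖e‖ = 1) : ‖gErr F t x z e‖ ≤ d * (L * t / 2) := by
  have h1 : gErr F t x z e = ((d : ℝ) * ((F (x + t • e) z - F (x - t • e) z) / (2 * t)
      - inner ℝ (gradient (fun y => F y z) x) e)) • e := by
    rw [gErr, gHat, dirNoise]; module
  rw [h1, norm_smul, he, mul_one, norm_mul, Real.norm_natCast]
  gcongr
  exact hF.abs_central_difference_le x e he ht

/-- Decomposition of the error of the batch estimator. -/
theorem gRd_sub_gradient (F : Vec d → S → ℝ) (π : Measure S) (t : ℝ) (x : Vec d) {N : ℕ}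
    (hN : 1 ≤ N) (z : ℕ → S) (e : ℕ → Vec d) :
    gRd F t x N z e - gradient (objective F π) x
      = (1 / (N : ℝ)) • ∑ i ∈ Finset.range N, dirNoise (gradient (fun y => F y (z i)) x) (e i)
        + (1 / (N : ℝ)) • ∑ i ∈ Finset.range N, gradNoise F π x (z i)
        + (1 / (N : ℝ)) • ∑ i ∈ Finset.range N, gErr F t x (z i) (e i) := by
  have hN' : (N : ℝ) ≠ 0 := by positivity
  have h1 : ∀ i, gHat F t x (z i) (e i) = dirNoise (gradient (fun y => F y (z i)) x) (e i)
      + gradNoise F π x (z i) + gErr F t x (z i) (e i) + gradient (objective F π) x := fun i => by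
    rw [gErr, gradNoise]; abel
  rw [gRd]
  simp only [h1, Finset.sum_add_distrib, smul_add, Finset.sum_const, Finset.card_range]
  rw [← Nat.cast_smul_eq_nsmul ℝ N, smul_smul, one_div_mul_cancel hN', one_smul]
  abel

/-- The joint law of the noise, given its states up to time `n`, and of fresh directions. -/
noncomputable def blockLaw [NeZero d] (Q : Kernel S S) [IsMarkovKernel Q] (n : ℕ)
    (u : (i : Finset.Iic n) → S) : Measure ((ℕ → S) × (ℕ → Vec d)) :=
  (pathKernel Q n u).prod (dirLaw d)

instance [NeZero d] (n : ℕ) (u : (i : Finset.Iic n) → S) :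
    IsProbabilityMeasure (blockLaw (d := d) Q n u) := by unfold blockLaw; infer_instance

theorem measurable_gHat (hF : Measurable (Function.uncurry F)) (t : ℝ) :
    Measurable fun q : Vec d × S × Vec d => gHat F t q.1 q.2.1 q.2.2 := by
  have h1 : Measurable fun q : Vec d × S × Vec d => F (q.1 + t • q.2.2) q.2.1 :=
    hF.comp (f := fun q : Vec d × S × Vec d => (q.1 + t • q.2.2, q.2.1)) (by fun_prop)
  have h2 : Measurable fun q : Vec d × S × Vec d => F (q.1 - t • q.2.2) q.2.1 :=
    hF.comp (f := fun q : Vec d × S × Vec d => (q.1 - t • q.2.2, q.2.1)) (by fun_prop)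
  exact (((h1.sub h2).div_const _).const_mul _).smul (by fun_prop)

theorem measurable_gRd (hF : Measurable (Function.uncurry F)) (t : ℝ) (N : ℕ) :
    Measurable fun q : Vec d × (ℕ → S) × (ℕ → Vec d) => gRd F t q.1 N q.2.1 q.2.2 := by
  have h1 : Measurable fun q : Vec d × (ℕ → S) × (ℕ → Vec d) =>
      ∑ i ∈ Finset.range N, gHat F t q.1 (q.2.1 i) (q.2.2 i) :=
    Finset.measurable_fun_sum _ fun i _ => (measurable_gHat hF t).comp
      (f := fun q : Vec d × (ℕ → S) × (ℕ → Vec d) => (q.1, q.2.1 i, q.2.2 i)) (by fun_prop)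
  exact h1.const_smul (1 / (N : ℝ))

variable [NeZero d]

/-- The batch estimator on the block that starts at time `n`. -/
noncomputable def blockRd (F : Vec d → S → ℝ) (t : ℝ) (x : Vec d) (n N : ℕ)
    (q : (ℕ → S) × (ℕ → Vec d)) : Vec d :=
  gRd F t x N (fun i => q.1 (n + i)) q.2

omit [NeZero d] in
theorem TwoPointAssumptions.measurable_blockRd (h : TwoPointAssumptions F Q π L μ σ τ) (t : ℝ)
    (x : Vec d) (n N : ℕ) : Measurable (blockRd F t x n N) :=
  (measurable_gRd h.measurable_uncurry t N).comp
    (f := fun q : (ℕ → S) × (ℕ → Vec d) => (x, (fun i => q.1 (n + i)), q.2)) (by fun_prop)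

theorem ae_norm_eq_one_blockLaw (n : ℕ) (u : (i : Finset.Iic n) → S) :
    ∀ᵐ q ∂blockLaw (d := d) Q n u, ∀ i, ‖q.2 i‖ = 1 :=
  Measure.quasiMeasurePreserving_snd.ae ae_norm_eq_one_dirLaw

section Moments

variable (h : TwoPointAssumptions F Q π L μ σ τ) (hσ : 0 ≤ σ) {t : ℝ} (ht : 0 < t)
  (x : Vec d) (n : ℕ) (u : (i : Finset.Iic n) → S)

include h in
omit [NeZero d] in
theorem measurable_blockDirNoise (N : ℕ) : Measurable fun q : (ℕ → S) × (ℕ → Vec d) =>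
    ∑ i ∈ Finset.range N, dirNoise (gradient (fun y => F y (q.1 (n + i))) x) (q.2 i) := by
  refine Finset.measurable_fun_sum _ fun i _ => ?_
  have h1 : Measurable fun q : (ℕ → S) × (ℕ → Vec d) => gradient (fun y => F y (q.1 (n + i))) x :=
    (h.measurable_gradient x).comp
      (f := fun q : (ℕ → S) × (ℕ → Vec d) => q.1 (n + i)) (by fun_prop)
  have h2 : Measurable fun q : (ℕ → S) × (ℕ → Vec d) => q.2 i := by fun_prop
  exact h1.dirNoise h2

include h hσ in
theorem ae_norm_blockDirNoise_le (N : ℕ) : ∀ᵐ q ∂blockLaw (d := d) Q n u,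
    ‖∑ i ∈ Finset.range N, dirNoise (gradient (fun y => F y (q.1 (n + i))) x) (q.2 i)‖
      ≤ N * ((d + 1) * (‖gradient (objective F π) x‖ + σ)) := by
  filter_upwards [ae_norm_eq_one_blockLaw n u] with q hq
  refine (norm_sum_le_of_le (Finset.range N) fun i _ => (norm_dirNoise_le _ (hq i)).trans
    (mul_le_mul_of_nonneg_left (h.norm_gradient_le hσ x _) (by positivity))).trans (by simp)

include h hσ in
theorem integrable_blockDirNoise (N : ℕ) : Integrable (fun q : (ℕ → S) × (ℕ → Vec d) =>
    ∑ i ∈ Finset.range N, dirNoise (gradient (fun y => F y (q.1 (n + i))) x) (q.2 i))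
      (blockLaw Q n u) :=
  Integrable.of_bound (measurable_blockDirNoise h x n N).aestronglyMeasurable _
    (ae_norm_blockDirNoise_le h hσ x n u N)

include h hσ in
theorem integrable_norm_blockDirNoise_sq (N : ℕ) : Integrable (fun q : (ℕ → S) × (ℕ → Vec d) =>
    ‖∑ i ∈ Finset.range N, dirNoise (gradient (fun y => F y (q.1 (n + i))) x) (q.2 i)‖ ^ 2)
      (blockLaw Q n u) := by
  refine Integrable.of_bound ((measurable_blockDirNoise h x n N).norm.pow_const
    2).aestronglyMeasurable ((N * ((d + 1) * (‖gradient (objective F π) x‖ + σ))) ^ 2) ?_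
  filter_upwards [ae_norm_blockDirNoise_le h hσ x n u N] with q hq
  rw [norm_pow, norm_norm]
  gcongr

-- The noise path is frozen, the bound for independent directions is applied to the resulting fixed
-- gradients, and the path is averaged afterwards. No mixing enters, so this part carries no factor
-- `τ`.
include h hσ in
theorem integral_norm_blockDirNoise_sq_le (N : ℕ) :
    ∫ q : (ℕ → S) × (ℕ → Vec d), ‖∑ i ∈ Finset.range N,
        dirNoise (gradient (fun y => F y (q.1 (n + i))) x) (q.2 i)‖ ^ 2 ∂blockLaw Q n u
      ≤ N * (d * (‖gradient (objective F π) x‖ + σ) ^ 2) := by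
  rw [blockLaw, integral_prod _ (integrable_norm_blockDirNoise_sq h hσ x n u N)]
  exact integral_le_of_forall_le (by positivity) fun w =>
    integral_norm_sum_dirNoise_sq_le _ (fun i => h.norm_gradient_le hσ x _) N

include h hσ in
theorem integral_blockDirNoise (N : ℕ) :
    ∫ q : (ℕ → S) × (ℕ → Vec d), ∑ i ∈ Finset.range N,
      dirNoise (gradient (fun y => F y (q.1 (n + i))) x) (q.2 i) ∂blockLaw Q n u = 0 := by
  rw [blockLaw, integral_prod _ (integrable_blockDirNoise h hσ x n u N)]
  refine integral_eq_zero_of_ae (Filter.Eventually.of_forall fun w => ?_)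
  simp only [Pi.zero_apply]
  rw [integral_finsetSum _ fun i _ => integrable_dirNoise_eval _ i]
  exact Finset.sum_eq_zero fun i _ => integral_dirNoise_eval _ i

include h in
omit [NeZero d] in
theorem measurable_blockGradNoise (N : ℕ) : Measurable fun w : ℕ → S =>
    ∑ i ∈ Finset.range N, gradNoise F π x (w (n + i)) :=
  Finset.measurable_fun_sum _ fun _ _ => (h.measurable_gradNoise x).comp (measurable_pi_apply _)

include h hσ in
omit [NeZero d] in
theorem norm_blockGradNoise_le (N : ℕ) (w : ℕ → S) :
    ‖∑ i ∈ Finset.range N, gradNoise F π x (w (n + i))‖ ≤ N * σ :=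
  (norm_sum_le_of_le (Finset.range N) fun _ _ => h.norm_gradNoise_le hσ x _).trans (by simp)

include h hσ in
theorem integrable_blockGradNoise (N : ℕ) : Integrable (fun q : (ℕ → S) × (ℕ → Vec d) =>
    ∑ i ∈ Finset.range N, gradNoise F π x (q.1 (n + i))) (blockLaw Q n u) :=
  Integrable.of_bound ((measurable_blockGradNoise h x n N).comp measurable_fst).aestronglyMeasurable
    _ (Filter.Eventually.of_forall fun q => norm_blockGradNoise_le h hσ x n N q.1)

include h hσ in
theorem integrable_norm_blockGradNoise_sq (N : ℕ) : Integrable (fun q : (ℕ → S) × (ℕ → Vec d) =>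
    ‖∑ i ∈ Finset.range N, gradNoise F π x (q.1 (n + i))‖ ^ 2) (blockLaw Q n u) := by
  refine Integrable.of_bound (((measurable_blockGradNoise h x n N).comp measurable_fst).norm.pow_const
    2).aestronglyMeasurable ((N * σ) ^ 2) (Filter.Eventually.of_forall fun q => ?_)
  rw [norm_pow, norm_norm]
  have := norm_blockGradNoise_le h hσ x n N q.1
  gcongr

include h hσ in
theorem integral_norm_blockGradNoise_sq_le [MeasurableEq S] (N : ℕ) :
    ∫ q : (ℕ → S) × (ℕ → Vec d), ‖∑ i ∈ Finset.range N,
      gradNoise F π x (q.1 (n + i))‖ ^ 2 ∂blockLaw Q n u ≤ 6 * N * τ * σ ^ 2 := by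
  rw [blockLaw, integral_fun_fst (fun w : ℕ → S => ‖∑ i ∈ Finset.range N,
    gradNoise F π x (w (n + i))‖ ^ 2), probReal_univ, one_smul]
  exact integral_norm_sum_sq_le h.mixing (h.measurable_gradNoise x) (h.norm_gradNoise_le hσ x)
    (h.integral_gradNoise hσ x) n u N

include h ht in
theorem ae_norm_blockErr_le (N : ℕ) : ∀ᵐ q ∂blockLaw (d := d) Q n u,
    ‖∑ i ∈ Finset.range N, gErr F t x (q.1 (n + i)) (q.2 i)‖ ≤ N * (d * (L * t / 2)) := by
  filter_upwards [ae_norm_eq_one_blockLaw n u] with q hq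
  exact (norm_sum_le_of_le (Finset.range N) fun i _ => norm_gErr_le ht (h.smooth _) x
    (hq i)).trans (by simp)

include h hσ ht in
theorem ae_norm_blockRd_sub_le {N : ℕ} (hN : 1 ≤ N) : ∀ᵐ q ∂blockLaw (d := d) Q n u,
    ‖blockRd F t x n N q - gradient (objective F π) x‖
      ≤ (d + 1) * (‖gradient (objective F π) x‖ + σ) + σ + d * (L * t / 2) := by
  have hN' : (0 : ℝ) < N := by positivity
  filter_upwards [ae_norm_blockErr_le h ht x n u N, ae_norm_blockDirNoise_le h hσ x n u N]
    with q h1 h2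
  have h3 := norm_blockGradNoise_le h hσ x n N q.1
  have hs : ∀ {v : Vec d} {C : ℝ}, ‖v‖ ≤ N * C → ‖(1 / (N : ℝ)) • v‖ ≤ C := fun {v C} hv => by
    rw [norm_smul, Real.norm_of_nonneg (by positivity), one_div_mul_eq_div, div_le_iff₀' hN']
    exact hv
  rw [blockRd, gRd_sub_gradient F π t x hN]
  exact norm_add₃_le.trans (add_le_add_three (hs h2) (hs h3) (hs h1))

include h hσ ht in
theorem integrable_blockRd_sub {N : ℕ} (hN : 1 ≤ N) : Integrable
    (fun q => blockRd F t x n N q - gradient (objective F π) x) (blockLaw Q n u) :=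
  Integrable.of_bound ((h.measurable_blockRd t x n N).sub_const _).aestronglyMeasurable _
    (ae_norm_blockRd_sub_le h hσ ht x n u hN)

include h hσ ht in
theorem integrable_blockRd {N : ℕ} (hN : 1 ≤ N) :
    Integrable (blockRd F t x n N) (blockLaw Q n u) := by
  refine ((integrable_blockRd_sub h hσ ht x n u hN).add
    (integrable_const (gradient (objective F π) x))).congr (Filter.Eventually.of_forall fun q => ?_)
  simp

include h hσ ht in
theorem integrable_norm_blockRd_sub_sq {N : ℕ} (hN : 1 ≤ N) : Integrable
    (fun q => ‖blockRd F t x n N q - gradient (objective F π) x‖ ^ 2) (blockLaw Q n u) := by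
  refine Integrable.of_bound (((h.measurable_blockRd t x n N).sub_const
    _).norm.pow_const 2).aestronglyMeasurable (((d + 1) * (‖gradient (objective F π) x‖ + σ) + σ
      + d * (L * t / 2)) ^ 2) ?_
  filter_upwards [ae_norm_blockRd_sub_le h hσ ht x n u hN] with q hq
  rw [norm_pow, norm_norm]
  gcongr

include h hσ ht in
/-- The mean square error of the batch estimator. -/
theorem integral_norm_blockRd_sub_sq_le [MeasurableEq S] {N : ℕ} (hN : 1 ≤ N) :
    ∫ q, ‖blockRd F t x n N q - gradient (objective F π) x‖ ^ 2 ∂blockLaw (d := d) Q n u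
      ≤ 18 * (d * ‖gradient (objective F π) x‖ ^ 2 + (d + τ) * σ ^ 2) / N
        + 3 * (d * (L * t / 2)) ^ 2 := by
  have hN' : (0 : ℝ) < N := by positivity
  set C := ‖gradient (objective F π) x‖ with hC
  have h1 : ∀ᵐ q ∂blockLaw (d := d) Q n u,
      ‖blockRd F t x n N q - gradient (objective F π) x‖ ^ 2
        ≤ 3 / (N : ℝ) ^ 2 * ‖∑ i ∈ Finset.range N,
            dirNoise (gradient (fun y => F y (q.1 (n + i))) x) (q.2 i)‖ ^ 2
          + (3 / (N : ℝ) ^ 2 * ‖∑ i ∈ Finset.range N, gradNoise F π x (q.1 (n + i))‖ ^ 2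
          + 3 * (d * (L * t / 2)) ^ 2) := by
    filter_upwards [ae_norm_blockErr_le h ht x n u N] with q hq
    rw [blockRd, gRd_sub_gradient F π t x hN, ← smul_add, ← smul_add, norm_smul, mul_pow,
      Real.norm_of_nonneg (by positivity)]
    set a := ∑ i ∈ Finset.range N, dirNoise (gradient (fun y => F y (q.1 (n + i))) x) (q.2 i)
    set b := ∑ i ∈ Finset.range N, gradNoise F π x (q.1 (n + i))
    set c := ∑ i ∈ Finset.range N, gErr F t x (q.1 (n + i)) (q.2 i)
    have e1 : ‖a + b + c‖ ^ 2 ≤ 3 * (‖a‖ ^ 2 + ‖b‖ ^ 2 + ‖c‖ ^ 2) := by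
      have e2 : ‖a + b + c‖ ^ 2 ≤ (‖a‖ + ‖b‖ + ‖c‖) ^ 2 := by gcongr; exact norm_add₃_le
      nlinarith [sq_nonneg (‖a‖ - ‖b‖), sq_nonneg (‖a‖ - ‖c‖), sq_nonneg (‖b‖ - ‖c‖)]
    have e3 : ‖c‖ ^ 2 ≤ (N * (d * (L * t / 2))) ^ 2 := by gcongr
    calc (1 / (N : ℝ)) ^ 2 * ‖a + b + c‖ ^ 2
        ≤ (1 / (N : ℝ)) ^ 2 * (3 * (‖a‖ ^ 2 + ‖b‖ ^ 2 + (N * (d * (L * t / 2))) ^ 2)) := by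
          gcongr; linarith
      _ = _ := by field_simp; ring
  have hi1 := (integrable_norm_blockDirNoise_sq h hσ x n u N).const_mul (3 / (N : ℝ) ^ 2)
  have hi2 := (integrable_norm_blockGradNoise_sq h hσ x n u N).const_mul (3 / (N : ℝ) ^ 2)
  have hi3 : Integrable (fun q : (ℕ → S) × (ℕ → Vec d) => 3 / (N : ℝ) ^ 2 *
      ‖∑ i ∈ Finset.range N, gradNoise F π x (q.1 (n + i))‖ ^ 2 + 3 * (d * (L * t / 2)) ^ 2)
      (blockLaw Q n u) := hi2.add (integrable_const _)
  have h2 := integral_mono_ae (integrable_norm_blockRd_sub_sq h hσ ht x n u hN)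
    (hi1.add hi3) h1
  simp only [Pi.add_apply] at h2
  rw [integral_add hi1 hi3, integral_add hi2 (integrable_const _),
    integral_const_mul, integral_const_mul, integral_const, probReal_univ, one_smul] at h2
  have h3 := integral_norm_blockDirNoise_sq_le h hσ x n u N
  have h4 := integral_norm_blockGradNoise_sq_le h hσ x n u N
  have h5 : (C + σ) ^ 2 ≤ 2 * C ^ 2 + 2 * σ ^ 2 := by nlinarith [sq_nonneg (C - σ)]
  calc _ ≤ _ := h2
    _ ≤ 3 / (N : ℝ) ^ 2 * (N * (d * (2 * C ^ 2 + 2 * σ ^ 2)))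
        + (3 / (N : ℝ) ^ 2 * (6 * N * τ * σ ^ 2) + 3 * (d * (L * t / 2)) ^ 2) := by
        gcongr
        exact h3.trans (by gcongr)
    _ = (6 * d * C ^ 2 + 6 * d * σ ^ 2 + 18 * τ * σ ^ 2) / N + 3 * (d * (L * t / 2)) ^ 2 := by
        field_simp; ring
    _ ≤ _ := by
        gcongr
        have e1 : 0 ≤ (d : ℝ) * C ^ 2 := by positivity
        have e2 : 0 ≤ (d : ℝ) * σ ^ 2 := by positivity
        linarith

include h hσ ht in
/-- The bias of the batch estimator. -/
theorem norm_integral_blockRd_sub_sq_le [MeasurableEq S] {N : ℕ} (hN : 1 ≤ N) :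
    ‖∫ q, blockRd F t x n N q ∂blockLaw (d := d) Q n u - gradient (objective F π) x‖ ^ 2
      ≤ 12 * τ * σ ^ 2 / N + 2 * (d * (L * t / 2)) ^ 2 := by
  have hN' : (0 : ℝ) < N := by positivity
  have hi1 : Integrable (fun q : (ℕ → S) × (ℕ → Vec d) => (1 / (N : ℝ)) • ∑ i ∈ Finset.range N,
      dirNoise (gradient (fun y => F y (q.1 (n + i))) x) (q.2 i)) (blockLaw Q n u) :=
    (integrable_blockDirNoise h hσ x n u N).smul (1 / (N : ℝ))
  have hi2 : Integrable (fun q : (ℕ → S) × (ℕ → Vec d) => (1 / (N : ℝ)) • ∑ i ∈ Finset.range N,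
      gradNoise F π x (q.1 (n + i))) (blockLaw Q n u) :=
    (integrable_blockGradNoise h hσ x n u N).smul (1 / (N : ℝ))
  -- The finite difference error, written as a difference of measurable terms; its integrability is
  -- thus inherited from theirs.
  set R : (ℕ → S) × (ℕ → Vec d) → Vec d := fun q => blockRd F t x n N q
    - gradient (objective F π) x - (1 / (N : ℝ)) • ∑ i ∈ Finset.range N,
      dirNoise (gradient (fun y => F y (q.1 (n + i))) x) (q.2 i)
    - (1 / (N : ℝ)) • ∑ i ∈ Finset.range N, gradNoise F π x (q.1 (n + i)) with hR
  have hiR : Integrable R (blockLaw Q n u) :=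
    ((integrable_blockRd_sub h hσ ht x n u hN).sub hi1).sub hi2
  have hRb : ∀ᵐ q ∂blockLaw Q n u, ‖R q‖ ≤ d * (L * t / 2) := by
    filter_upwards [ae_norm_blockErr_le h ht x n u N] with q hq
    have : R q = (1 / (N : ℝ)) • ∑ i ∈ Finset.range N, gErr F t x (q.1 (n + i)) (q.2 i) := by
      simp only [hR, blockRd]
      rw [gRd_sub_gradient F π t x hN]
      abel
    rw [this, norm_smul, Real.norm_of_nonneg (by positivity), one_div_mul_eq_div, div_le_iff₀' hN']
    exact hq
  -- The direction noise has mean zero given the path, so neither `d` nor `‖∇f(x)‖` enters the bias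
  -- except through the finite difference error.
  have h1 : ∫ q, blockRd F t x n N q ∂blockLaw (d := d) Q n u - gradient (objective F π) x
      = (1 / (N : ℝ)) • ∫ q : (ℕ → S) × (ℕ → Vec d), ∑ i ∈ Finset.range N,
          gradNoise F π x (q.1 (n + i)) ∂blockLaw Q n u + ∫ q, R q ∂blockLaw Q n u := by
    have e1 : ∫ q, blockRd F t x n N q ∂blockLaw (d := d) Q n u - gradient (objective F π) x
        = ∫ q, (blockRd F t x n N q - gradient (objective F π) x) ∂blockLaw Q n u := by
      rw [integral_sub (integrable_blockRd h hσ ht x n u hN) (integrable_const _)]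
      simp
    have e2 : ∀ q, blockRd F t x n N q - gradient (objective F π) x
        = (1 / (N : ℝ)) • ∑ i ∈ Finset.range N,
          dirNoise (gradient (fun y => F y (q.1 (n + i))) x) (q.2 i)
        + ((1 / (N : ℝ)) • ∑ i ∈ Finset.range N, gradNoise F π x (q.1 (n + i)) + R q) := fun q => by
      simp only [hR]; abel
    rw [e1]
    simp only [e2]
    have hi3 : Integrable (fun q : (ℕ → S) × (ℕ → Vec d) => (1 / (N : ℝ)) • ∑ i ∈ Finset.range N,
        gradNoise F π x (q.1 (n + i)) + R q) (blockLaw Q n u) := hi2.add hiR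
    rw [integral_add hi1 hi3, integral_add hi2 hiR, integral_smul, integral_smul,
      integral_blockDirNoise h hσ x n u N, smul_zero, zero_add]
  rw [h1]
  set a := ∫ q : (ℕ → S) × (ℕ → Vec d), ∑ i ∈ Finset.range N,
          gradNoise F π x (q.1 (n + i)) ∂blockLaw Q n u
  have h2 : ‖a‖ ^ 2 ≤ 6 * N * τ * σ ^ 2 :=
    (norm_integral_sq_le (integrable_blockGradNoise h hσ x n u N)
      (integrable_norm_blockGradNoise_sq h hσ x n u N)).trans
      (integral_norm_blockGradNoise_sq_le h hσ x n u N)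
  have h3 : ‖∫ q, R q ∂blockLaw Q n u‖ ≤ d * (L * t / 2) := by
    simpa using norm_integral_le_of_norm_le_const hRb
  set b := ∫ q, R q ∂blockLaw Q n u
  have h4 : ‖(1 / (N : ℝ)) • a + b‖ ^ 2 ≤ 2 * ((1 / (N : ℝ)) ^ 2 * ‖a‖ ^ 2) + 2 * ‖b‖ ^ 2 := by
    have e1 : ‖(1 / (N : ℝ)) • a + b‖ ^ 2 ≤ (‖(1 / (N : ℝ)) • a‖ + ‖b‖) ^ 2 := by
      gcongr; exact norm_add_le _ _
    have e2 : ‖(1 / (N : ℝ)) • a‖ ^ 2 = (1 / (N : ℝ)) ^ 2 * ‖a‖ ^ 2 := by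
      rw [norm_smul, mul_pow, Real.norm_of_nonneg (by positivity)]
    nlinarith [sq_nonneg (‖(1 / (N : ℝ)) • a‖ - ‖b‖)]
  calc _ ≤ _ := h4
    _ ≤ 2 * ((1 / (N : ℝ)) ^ 2 * (6 * N * τ * σ ^ 2)) + 2 * (d * (L * t / 2)) ^ 2 := by gcongr
    _ = _ := by field_simp; ring

end Moments

end Batch

/-! ### The truncated geometric level -/

theorem two_pow_le_iff {M : ℝ} (hM : 1 ≤ M) (j : ℕ) :
    (2 : ℝ) ^ j ≤ M ↔ j ≤ ⌊Real.logb 2 M⌋₊ := by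
  rw [Nat.le_floor_iff (Real.logb_nonneg one_lt_two hM), Real.le_logb_iff_rpow_le one_lt_two
    (by linarith), Real.rpow_natCast]

theorem le_two_mul_two_pow_floor_logb {M : ℝ} (hM : 1 ≤ M) :
    M ≤ 2 * 2 ^ ⌊Real.logb 2 M⌋₊ := by
  rw [← pow_succ']
  exact (not_le.1 ((two_pow_le_iff hM _).not.2 (by simp))).le

/-- The average of a sequence that is constant equal to `c` beyond `K`, for the geometric
distribution on the positive integers. -/
noncomputable def levelAvg {E : Type*} [AddCommGroup E] [Module ℝ E] (K : ℕ) (φ : ℕ → E) (c : E) :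
    E :=
  ∑ i ∈ Finset.range K, (1 / 2 : ℝ) ^ (i + 1) • φ i + (1 / 2 : ℝ) ^ K • c

/-- The prescribed masses at `j ≥ 1` already add up to 1, so none is left for 0. -/
theorem measure_level_zero {lev : Measure ℕ} [IsProbabilityMeasure lev]
    (hlev : ∀ j, 1 ≤ j → lev {j} = (1 / 2 : ℝ≥0∞) ^ j) : lev {0} = 0 := by
  have h1 : ∑' j, lev {j} = 1 := by
    have := lintegral_countable' (μ := lev) (fun _ => 1)
    simpa using this.symm
  have h2 : ∑' j : ℕ, lev {j + 1} = 1 := by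
    have : ∀ j : ℕ, lev {j + 1} = 2⁻¹ * (2⁻¹ : ℝ≥0∞) ^ j := fun j => by
      rw [hlev _ (by simp), pow_succ', one_div]
    simp_rw [this, ENNReal.tsum_mul_left, ENNReal.tsum_geometric, ENNReal.one_sub_inv_two, inv_inv]
    exact ENNReal.inv_mul_cancel (by simp) (by simp)
  rw [tsum_eq_zero_add' ENNReal.summable, h2] at h1
  have h3 : lev {0} + 1 = 0 + 1 := by rw [h1, zero_add]
  exact (ENNReal.add_left_inj (by simp)).1 h3

theorem lintegral_level {lev : Measure ℕ} [IsProbabilityMeasure lev]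
    (hlev : ∀ j, 1 ≤ j → lev {j} = (1 / 2 : ℝ≥0∞) ^ j) (K : ℕ) {φ : ℕ → ℝ≥0∞} {c : ℝ≥0∞}
    (hφ : ∀ j, K < j → φ j = c) :
    ∫⁻ j, φ j ∂lev
      = ∑ i ∈ Finset.range K, (1 / 2 : ℝ≥0∞) ^ (i + 1) * φ (i + 1) + (1 / 2 : ℝ≥0∞) ^ K * c := by
  have h0 : ∀ g : ℕ → ℝ≥0∞, ∑' j, g j
      = g 0 + (∑ i ∈ Finset.range K, g (i + 1) + ∑' i, g (i + K + 1)) := fun g => by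
    rw [tsum_eq_zero_add' ENNReal.summable,
      ← (ENNReal.summable (f := fun i => g (i + K + 1))).sum_add_tsum_nat_add' (f := fun i => g (i + 1))]
  rw [lintegral_countable', h0, measure_level_zero hlev, mul_zero, zero_add]
  congr 1
  · exact Finset.sum_congr rfl fun i _ => by rw [hlev _ (by simp), mul_comm]
  · have : ∀ i : ℕ, φ (i + K + 1) * lev {i + K + 1}
        = (c * ((2⁻¹ : ℝ≥0∞) ^ K * 2⁻¹)) * (2⁻¹ : ℝ≥0∞) ^ i := fun i => by
      rw [hlev _ (by simp), hφ _ (by omega), one_div, pow_succ, pow_add]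
      ring
    simp_rw [this, ENNReal.tsum_mul_left, ENNReal.tsum_geometric, ENNReal.one_sub_inv_two, inv_inv]
    rw [mul_assoc, mul_assoc, ENNReal.inv_mul_cancel (by simp) (by simp), mul_one, one_div, mul_comm]

/-- The integral of a nonnegative truncated sequence against the geometric distribution. -/
theorem lintegral_level_le_ofReal {lev : Measure ℕ} [IsProbabilityMeasure lev]
    (hlev : ∀ j, 1 ≤ j → lev {j} = (1 / 2 : ℝ≥0∞) ^ j) (K : ℕ) {φ : ℕ → ℝ≥0∞} {a : ℕ → ℝ} {c : ℝ}
    (ha : ∀ i < K, 0 ≤ a i) (hc : 0 ≤ c) (hφ : ∀ i < K, φ (i + 1) ≤ ENNReal.ofReal (a i))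
    (hφc : ∀ j, K < j → φ j ≤ ENNReal.ofReal c) :
    ∫⁻ j, φ j ∂lev ≤ ENNReal.ofReal (levelAvg K a c) := by
  set ψ : ℕ → ℝ≥0∞ := fun j => if K < j then ENNReal.ofReal c else φ j with hψ
  have h1 : ∫⁻ j, φ j ∂lev ≤ ∫⁻ j, ψ j ∂lev := lintegral_mono fun j => by
    simp only [hψ]
    split_ifs with hj
    · exact hφc j hj
    · exact le_rfl
  refine h1.trans ?_
  rw [lintegral_level hlev K (c := ENNReal.ofReal c) fun j hj => if_pos hj, levelAvg,
    ENNReal.ofReal_add (Finset.sum_nonneg fun i hi => by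
      have := ha i (Finset.mem_range.1 hi); positivity) (by positivity),
    ENNReal.ofReal_sum_of_nonneg fun i hi => by
      have := ha i (Finset.mem_range.1 hi); positivity]
  have hhalf : ∀ i : ℕ, ENNReal.ofReal ((1 / 2 : ℝ) ^ i) = (1 / 2 : ℝ≥0∞) ^ i := fun i => by
    rw [ENNReal.ofReal_pow (by positivity), ENNReal.ofReal_div_of_pos two_pos]; simp
  gcongr with i hi
  · rw [smul_eq_mul, ENNReal.ofReal_mul (by positivity), hhalf]
    gcongr
    have hi' := Finset.mem_range.1 hi
    rw [if_neg (by omega)]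
    exact hφ i hi'
  · rw [smul_eq_mul, ENNReal.ofReal_mul (by positivity), hhalf]

theorem sum_half_pow_add (K : ℕ) :
    ∑ i ∈ Finset.range K, (1 / 2 : ℝ) ^ (i + 1) + (1 / 2) ^ K = 1 := by
  induction K with
  | zero => simp
  | succ K ih => rw [Finset.sum_range_succ, pow_succ (1 / 2 : ℝ) K]; linarith

section LevelAvg

variable {E : Type*} [AddCommGroup E] [Module ℝ E]

theorem levelAvg_add (K : ℕ) (φ ψ : ℕ → E) (c c' : E) :
    levelAvg K (fun i => φ i + ψ i) (c + c') = levelAvg K φ c + levelAvg K ψ c' := by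
  simp only [levelAvg, smul_add, Finset.sum_add_distrib]
  abel

theorem levelAvg_const (K : ℕ) (c : E) : levelAvg K (fun _ => c) c = c := by
  rw [levelAvg, ← Finset.sum_smul, ← add_smul, sum_half_pow_add, one_smul]

theorem map_levelAvg {E' : Type*} [AddCommGroup E'] [Module ℝ E'] (T : E →ₗ[ℝ] E') (K : ℕ)
    (φ : ℕ → E) (c : E) : T (levelAvg K φ c) = levelAvg K (fun i => T (φ i)) (T c) := by
  simp [levelAvg]

theorem levelAvg_mono {K : ℕ} {φ ψ : ℕ → ℝ} {c c' : ℝ} (h : ∀ i, φ i ≤ ψ i) (hc : c ≤ c') :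
    levelAvg K φ c ≤ levelAvg K ψ c' := by
  unfold levelAvg
  simp only [smul_eq_mul]
  gcongr with i
  exact h i

/-- The multilevel estimator telescopes to the finest level. -/
theorem levelAvg_telescope (K : ℕ) (m : ℕ → E) :
    levelAvg K (fun i => m 0 + (2 : ℝ) ^ (i + 1) • (m (i + 1) - m i)) (m 0) = m K := by
  -- The weight `2^{-(i+1)}` of a level cancels its amplification `2^{i+1}`, leaving a bare
  -- telescoping sum.
  have h1 := levelAvg_add K (fun _ => m 0) (fun i => (2 : ℝ) ^ (i + 1) • (m (i + 1) - m i)) (m 0) 0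
  rw [add_zero, levelAvg_const] at h1
  have h2 : levelAvg K (fun i => (2 : ℝ) ^ (i + 1) • (m (i + 1) - m i)) 0 = m K - m 0 := by
    rw [levelAvg, smul_zero, add_zero, ← Finset.sum_range_sub m]
    refine Finset.sum_congr rfl fun i _ => ?_
    rw [smul_smul, ← mul_pow]
    norm_num
  rw [h1, h2, add_sub_cancel]

end LevelAvg

/-- The three terms are the three effects in the second moment of the estimator: amplification `4^j`
times batch variance of order `2^{-j}` gives `2^j`, each level then contributing equally; the finite
difference error does not shrink with the batch, keeps `4^j`, and sums to order `2^K ≤ M`. -/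
theorem levelAvg_pow_le {K : ℕ} {A b c : ℝ} (hc : 0 ≤ c) :
    levelAvg K (fun i => A + b * 2 ^ (i + 1) + c * 4 ^ (i + 1)) A ≤ A + b * K + c * (2 * 2 ^ K) := by
  have h1 : levelAvg K (fun i => A + b * 2 ^ (i + 1) + c * 4 ^ (i + 1)) A
      = A + (b * K + c * ∑ i ∈ Finset.range K, 2 ^ (i + 1)) := by
    have h2 := levelAvg_add K (fun _ => A) (fun i => b * 2 ^ (i + 1) + c * 4 ^ (i + 1)) A 0
    rw [add_zero, levelAvg_const] at h2
    simp only [add_assoc]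
    rw [h2, levelAvg, smul_zero, add_zero, Finset.mul_sum]
    congr 1
    have h3 : ∀ i : ℕ, (1 / 2 : ℝ) ^ (i + 1) • (b * 2 ^ (i + 1) + c * 4 ^ (i + 1))
        = b + c * 2 ^ (i + 1) := fun i => by
      rw [show (4 : ℝ) = 2 * 2 by norm_num, mul_pow, smul_eq_mul, one_div, inv_pow]
      field_simp
    simp only [h3, Finset.sum_add_distrib, Finset.sum_const, Finset.card_range, nsmul_eq_mul]
    ring
  have h4 : ∑ i ∈ Finset.range K, (2 : ℝ) ^ (i + 1) = 2 * 2 ^ K - 2 := by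
    simp only [pow_succ', ← Finset.mul_sum, geom_sum_eq (show (2 : ℝ) ≠ 1 by norm_num) K]
    ring
  rw [h1, h4]
  nlinarith

/-! ### One iteration -/

section OneStep

theorem ofReal_integral_bound {α : Type*} [MeasurableSpace α] {ν : Measure α} {φ ψ : α → ℝ}
    (hφ : ∀ q, 0 ≤ φ q) (h : ∀ q, φ q ≤ ψ q) (hψ : Integrable ψ ν) :
    ∫⁻ q, ENNReal.ofReal (φ q) ∂ν ≤ ENNReal.ofReal (∫ q, ψ q ∂ν) ∧ 0 ≤ ∫ q, ψ q ∂ν := by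
  refine ⟨?_, integral_nonneg fun q => (hφ q).trans (h q)⟩
  rw [ofReal_integral_eq_lintegral_ofReal hψ
    (Filter.Eventually.of_forall fun q => (hφ q).trans (h q))]
  exact lintegral_mono fun q => ENNReal.ofReal_le_ofReal (h q)

variable {d : ℕ} {S : Type*} [MeasurableSpace S] {F : Vec d → S → ℝ} {Q : Kernel S S}
  [IsMarkovKernel Q] {π : Measure S} {L μ σ : ℝ} {τ : ℕ} [NeZero d]

/-- The multilevel estimator on the block that starts at time `n`. -/
noncomputable def blockMl (F : Vec d → S → ℝ) (a : Params) (x : Vec d) (n j : ℕ)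
    (q : (ℕ → S) × (ℕ → Vec d)) : Vec d :=
  gMl F a x j (fun i => q.1 (n + i)) q.2

omit [MeasurableSpace S] [NeZero d] in
theorem blockMl_succ {a : Params} (x : Vec d) (n : ℕ) {i : ℕ} (hi : (2 : ℝ) ^ (i + 1) ≤ a.M)
    (q : (ℕ → S) × (ℕ → Vec d)) :
    blockMl F a x n (i + 1) q = blockRd F a.t x n a.l q + (2 : ℝ) ^ (i + 1) •
      (blockRd F a.t x n (2 ^ (i + 1) * a.l) q - blockRd F a.t x n (2 ^ i * a.l) q) := by
  simp [blockMl, gMl, hi, blockRd]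

omit [MeasurableSpace S] [NeZero d] in
theorem blockMl_of_not_le {a : Params} (x : Vec d) (n : ℕ) {j : ℕ} (hj : ¬ (2 : ℝ) ^ j ≤ a.M)
    (q : (ℕ → S) × (ℕ → Vec d)) : blockMl F a x n j q = blockRd F a.t x n a.l q := by
  simp [blockMl, gMl, hj, blockRd]

-- The factor in front of `‖G‖²` has to stay bounded while `r = 2^j` is large; this holds because
-- `G` cancels in the correction term, so `r` multiplies errors only.
omit [NeZero d] in
theorem norm_multilevel_sq_le (G E₀ E₁ E₂ : Vec d) (r : ℝ) :
    ‖(E₀ + G) + r • ((E₂ + G) - (E₁ + G))‖ ^ 2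
      ≤ 2 * ‖G‖ ^ 2 + 4 * ‖E₀‖ ^ 2 + 8 * r ^ 2 * (‖E₁‖ ^ 2 + ‖E₂‖ ^ 2) := by
  have e0 : (E₀ + G) + r • ((E₂ + G) - (E₁ + G)) = G + (E₀ + r • (E₂ - E₁)) := by
    rw [add_sub_add_right_eq_sub]; abel
  have e1 : ∀ u v : Vec d, ‖u + v‖ ^ 2 ≤ 2 * ‖u‖ ^ 2 + 2 * ‖v‖ ^ 2 := fun u v => by
    have := norm_add_le u v
    nlinarith [sq_nonneg (‖u‖ - ‖v‖), norm_nonneg (u + v), norm_nonneg u, norm_nonneg v]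
  have e2 := e1 G (E₀ + r • (E₂ - E₁))
  have e3 := e1 E₀ (r • (E₂ - E₁))
  have e4 : ‖r • (E₂ - E₁)‖ ^ 2 ≤ r ^ 2 * (2 * ‖E₂‖ ^ 2 + 2 * ‖E₁‖ ^ 2) := by
    rw [norm_smul, mul_pow, Real.norm_eq_abs, sq_abs]
    gcongr
    have := e1 E₂ (-E₁)
    rwa [norm_neg, ← sub_eq_add_neg] at this
  rw [e0]
  linarith

section Moments

variable (H : TwoPointAssumptions F Q π L μ σ τ) (hσ : 0 ≤ σ) {t : ℝ} (ht : 0 < t)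
  (x : Vec d) (n : ℕ) (u : (i : Finset.Iic n) → S) {l : ℕ} (hl : 1 ≤ l)

/-- The level `i + 1` term of the multilevel estimator. -/
noncomputable def blockLevel (F : Vec d → S → ℝ) (t : ℝ) (x : Vec d) (n l i : ℕ)
    (q : (ℕ → S) × (ℕ → Vec d)) : Vec d :=
  blockRd F t x n l q + (2 : ℝ) ^ (i + 1) •
      (blockRd F t x n (2 ^ (i + 1) * l) q - blockRd F t x n (2 ^ i * l) q)

include H hσ ht hl in
theorem integrable_blockLevel (i : ℕ) : Integrable (blockLevel F t x n l i) (blockLaw Q n u) :=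
  (integrable_blockRd H hσ ht x n u hl).add
    (((integrable_blockRd H hσ ht x n u (N := 2 ^ (i + 1) * l) (Nat.mul_pos (by positivity) hl)).sub
      (integrable_blockRd H hσ ht x n u (N := 2 ^ i * l) (Nat.mul_pos (by positivity) hl))).smul
        ((2 : ℝ) ^ (i + 1)))

include H hσ ht hl in
theorem integral_blockLevel (i : ℕ) : ∫ q, blockLevel F t x n l i q ∂blockLaw Q n u
    = ∫ q, blockRd F t x n l q ∂blockLaw Q n u + (2 : ℝ) ^ (i + 1) •
      (∫ q, blockRd F t x n (2 ^ (i + 1) * l) q ∂blockLaw Q n u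
        - ∫ q, blockRd F t x n (2 ^ i * l) q ∂blockLaw Q n u) := by
  have h1 := integrable_blockRd H hσ ht x n u hl
  have h2 := integrable_blockRd H hσ ht x n u (N := 2 ^ (i + 1) * l) (Nat.mul_pos (by positivity) hl)
  have h3 := integrable_blockRd H hσ ht x n u (N := 2 ^ i * l) (Nat.mul_pos (by positivity) hl)
  have h4 : Integrable (fun q => (2 : ℝ) ^ (i + 1) • (blockRd F t x n (2 ^ (i + 1) * l) q
    - blockRd F t x n (2 ^ i * l) q)) (blockLaw Q n u) := (h2.sub h3).smul ((2 : ℝ) ^ (i + 1))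
  unfold blockLevel
  rw [integral_add h1 h4, integral_smul, integral_sub h2 h3]

/-- An upper bound for the squared norm of the level `i + 1` term of the multilevel estimator. -/
noncomputable def blockLevelBound (F : Vec d → S → ℝ) (π : Measure S) (t : ℝ) (x : Vec d)
    (n l i : ℕ) (q : (ℕ → S) × (ℕ → Vec d)) : ℝ :=
  2 * ‖gradient (objective F π) x‖ ^ 2
    + (4 * ‖blockRd F t x n l q - gradient (objective F π) x‖ ^ 2
    + 8 * (2 ^ (i + 1)) ^ 2 * (‖blockRd F t x n (2 ^ i * l) q - gradient (objective F π) x‖ ^ 2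
      + ‖blockRd F t x n (2 ^ (i + 1) * l) q - gradient (objective F π) x‖ ^ 2))

omit [NeZero d] in
theorem norm_blockLevel_sq_le (i : ℕ) (q : (ℕ → S) × (ℕ → Vec d)) :
    ‖blockLevel F t x n l i q‖ ^ 2 ≤ blockLevelBound F π t x n l i q := by
  have := norm_multilevel_sq_le (gradient (objective F π) x)
    (blockRd F t x n l q - gradient (objective F π) x)
    (blockRd F t x n (2 ^ i * l) q - gradient (objective F π) x)
    (blockRd F t x n (2 ^ (i + 1) * l) q - gradient (objective F π) x) (2 ^ (i + 1))
  simp only [sub_add_cancel] at this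
  rw [blockLevelBound, ← add_assoc]
  exact this

include H hσ ht hl in
theorem integrable_blockLevelBound (i : ℕ) :
    Integrable (blockLevelBound F π t x n l i) (blockLaw Q n u) :=
  (integrable_const _).add (((integrable_norm_blockRd_sub_sq H hσ ht x n u hl).const_mul _).add
    (((integrable_norm_blockRd_sub_sq H hσ ht x n u (Nat.mul_pos (by positivity) hl)).add
      (integrable_norm_blockRd_sub_sq H hσ ht x n u (Nat.mul_pos (by positivity) hl))).const_mul _))

include H hσ ht hl in
theorem integral_blockLevelBound_le [MeasurableEq S] (i : ℕ) {v δ : ℝ}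
    (hv : v = 18 * (d * ‖gradient (objective F π) x‖ ^ 2 + (d + τ) * σ ^ 2))
    (hδ : δ = d * (L * t / 2)) :
    ∫ q, blockLevelBound F π t x n l i q ∂blockLaw Q n u
      ≤ (2 * ‖gradient (objective F π) x‖ ^ 2 + 4 * (v / l) + 12 * δ ^ 2)
        + 24 * (v / l) * 2 ^ (i + 1) + 48 * δ ^ 2 * 4 ^ (i + 1) := by
  have h1 := integrable_norm_blockRd_sub_sq H hσ ht x n u hl
  have h2 := integrable_norm_blockRd_sub_sq H hσ ht x n u (N := 2 ^ i * l)
    (Nat.mul_pos (by positivity) hl)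
  have h3 := integrable_norm_blockRd_sub_sq H hσ ht x n u (N := 2 ^ (i + 1) * l)
    (Nat.mul_pos (by positivity) hl)
  have h23 : Integrable (fun q =>
      8 * (2 ^ (i + 1)) ^ 2 * (‖blockRd F t x n (2 ^ i * l) q - gradient (objective F π) x‖ ^ 2
      + ‖blockRd F t x n (2 ^ (i + 1) * l) q - gradient (objective F π) x‖ ^ 2)) (blockLaw Q n u) :=
    (h2.add h3).const_mul _
  have h123 : Integrable (fun q => 4 * ‖blockRd F t x n l q - gradient (objective F π) x‖ ^ 2
      + 8 * (2 ^ (i + 1)) ^ 2 * (‖blockRd F t x n (2 ^ i * l) q - gradient (objective F π) x‖ ^ 2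
      + ‖blockRd F t x n (2 ^ (i + 1) * l) q - gradient (objective F π) x‖ ^ 2)) (blockLaw Q n u) :=
    (h1.const_mul 4).add h23
  unfold blockLevelBound
  rw [integral_add (integrable_const _) h123, integral_add (h1.const_mul 4) h23,
    integral_const_mul, integral_const_mul, integral_const_mul, integral_add h2 h3, integral_const,
    probReal_univ, one_smul]
  have k1 := integral_norm_blockRd_sub_sq_le H hσ ht x n u hl
  have k2 := integral_norm_blockRd_sub_sq_le H hσ ht x n u (N := 2 ^ i * l)
    (Nat.mul_pos (by positivity) hl)
  have k3 := integral_norm_blockRd_sub_sq_le H hσ ht x n u (N := 2 ^ (i + 1) * l)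
    (Nat.mul_pos (by positivity) hl)
  rw [← hv, ← hδ] at k1 k2 k3
  have hl' : (0 : ℝ) < l := by positivity
  calc _ ≤ 2 * ‖gradient (objective F π) x‖ ^ 2 + (4 * (v / l + 3 * δ ^ 2)
        + 8 * (2 ^ (i + 1)) ^ 2 * ((v / (2 ^ i * l : ℕ) + 3 * δ ^ 2)
          + (v / (2 ^ (i + 1) * l : ℕ) + 3 * δ ^ 2))) := by gcongr
    _ = _ := by
        rw [show (4 : ℝ) ^ (i + 1) = (2 ^ (i + 1)) ^ 2 by rw [← pow_mul, mul_comm, pow_mul]; norm_num]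
        push_cast
        rw [pow_succ]
        field_simp
        ring

end Moments

/-- The expected Lyapunov function after one iteration, given the past. -/
theorem lintegral_lyapunov_step_le [MeasurableEq S] {p h t : ℝ} {B : ℕ}
    (H : TwoPointAssumptions F Q π L μ σ τ) (hσ : 0 ≤ σ) (ht : 0 < t) (hμ : 0 < μ)
    (hp : 0 < p) (hp1 : p ≤ 1) (hh : 0 < h) (hph : p * h ≤ 1 / 2) (hLh : L * (3 * h ^ 2 / μ) ≤ 3 / 4)
    (hB : 1 ≤ B) (hpB : 432 * (1 + (d : ℝ) / B) ≤ 4 / (7 * p))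
    {lev : Measure ℕ} [IsProbabilityMeasure lev]
    (hlev : ∀ j, 1 ≤ j → lev {j} = (1 / 2 : ℝ≥0∞) ^ j) {xstar : Vec d}
    (hx : ∀ y, objective F π xstar ≤ objective F π y) (s : AlgState d) (n : ℕ)
    (u : (i : Finset.Iic n) → S) :
    ∫⁻ j, ∫⁻ q, ENNReal.ofReal (lyapunov (objective F π) μ xstar
        (step F (paramsOf p h t μ B) (fun i => q.1 (n + i)) q.2 j ⟨s.x, s.xf, 0⟩))
          ∂blockLaw Q n u ∂lev
      ≤ ENNReal.ofReal ((1 - p * h) * lyapunov (objective F π) μ xstar s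
        + 9 * (p ^ 2 * h ^ 2 / μ ^ 2) * (780 * ((d + τ) * σ ^ 2 / B)
          + 191 * (1 / p + 1 / (p * h)) * (d * (L * t / 2)) ^ 2)) := by
  set a := paramsOf p h t μ B with ha
  set f := objective F π with hf
  set x := extrapolate a s with hxdef
  set G := gradient f x with hG
  have hpos : 0 < p * h := by positivity
  have hM : a.M = 1 / p + 1 / (p * h) := paramsOf_M hp hh hμ
  have hM1 : 1 ≤ a.M := by
    rw [hM]
    have : 1 ≤ 1 / p := by rw [le_div_iff₀ hp]; linarith
    have : 0 < 1 / (p * h) := by positivity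
    linarith
  set K := ⌊Real.logb 2 a.M⌋₊ with hK
  have hKle : (2 : ℝ) ^ K ≤ a.M := (two_pow_le_iff hM1 K).2 le_rfl
  have hKge : a.M ≤ 2 * 2 ^ K := le_two_mul_two_pow_floor_logb hM1
  have hl : a.l = (K + 1) * B := rfl
  have hl1 : 1 ≤ a.l := by rw [hl]; exact Nat.mul_pos (by simp) hB
  have hat : a.t = t := rfl
  have hBr : (0 : ℝ) < B := by positivity
  set A : ℝ := ‖anchor a s - xstar‖ ^ 2 + 6 / μ * (f x - f xstar) with hA
  set b : Vec d := -(6 * (p * h) / μ) • (anchor a s - xstar) - (18 * p * h ^ 2 / μ ^ 2) • G with hb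
  set c : ℝ := 63 / 4 * (p ^ 2 * h ^ 2 / μ ^ 2) with hc
  have hc0 : 0 ≤ c := by positivity
  have hstep : ∀ (j : ℕ) (q : (ℕ → S) × (ℕ → Vec d)),
      lyapunov f μ xstar (step F a (fun i => q.1 (n + i)) q.2 j ⟨s.x, s.xf, 0⟩)
        ≤ A + inner ℝ b (blockMl F a x n j q) + c * ‖blockMl F a x n j q‖ ^ 2 := fun j q => by
    refine lyapunov_step_le (H.isLSmooth_objective hσ) hp hh hμ hph hLh F _ q.2 j ⟨s.x, s.xf, 0⟩
      xstar (xg := x) (g := blockMl F a x n j q) rfl ?_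
    simp only [zero_add]
    rfl
  have hnn : ∀ (j : ℕ) (q : (ℕ → S) × (ℕ → Vec d)), 0 ≤ lyapunov f μ xstar
      (step F a (fun i => q.1 (n + i)) q.2 j ⟨s.x, s.xf, 0⟩) := fun j q => lyapunov_nonneg hμ hx _
  set ν := blockLaw (d := d) Q n u with hν
  set m : ℕ → Vec d := fun i => ∫ q, blockRd F t x n (2 ^ i * a.l) q ∂ν with hm
  set δ : ℝ := d * (L * t / 2) with hδ
  set v : ℝ := 18 * (d * ‖G‖ ^ 2 + (d + τ) * σ ^ 2) with hv
  have hm0 : m 0 = ∫ q, blockRd F t x n a.l q ∂ν := by simp [hm]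
  -- the levels below the threshold
  have hlow : ∀ i < K, ∫⁻ q, ENNReal.ofReal (lyapunov f μ xstar
        (step F a (fun i => q.1 (n + i)) q.2 (i + 1) ⟨s.x, s.xf, 0⟩)) ∂ν
      ≤ ENNReal.ofReal (A + inner ℝ b (m 0 + (2 : ℝ) ^ (i + 1) • (m (i + 1) - m i))
        + c * ∫ q, blockLevelBound F π t x n a.l i q ∂ν) ∧
      0 ≤ A + inner ℝ b (m 0 + (2 : ℝ) ^ (i + 1) • (m (i + 1) - m i))
        + c * ∫ q, blockLevelBound F π t x n a.l i q ∂ν := fun i hi => by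
    have hi' : (2 : ℝ) ^ (i + 1) ≤ a.M := (two_pow_le_iff hM1 _).2 hi
    have i1 : Integrable (fun q => inner ℝ b (blockLevel F t x n a.l i q)) ν :=
      (integrable_blockLevel H hσ ht x n u hl1 i).const_inner b
    have i2 : Integrable (fun q => c * blockLevelBound F π t x n a.l i q) ν :=
      (integrable_blockLevelBound H hσ ht x n u hl1 i).const_mul c
    have i3 : Integrable (fun q => A + inner ℝ b (blockLevel F t x n a.l i q)) ν :=
      (integrable_const A).add i1
    have hint : ∫ q, (A + inner ℝ b (blockLevel F t x n a.l i q)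
        + c * blockLevelBound F π t x n a.l i q) ∂ν
        = A + inner ℝ b (m 0 + (2 : ℝ) ^ (i + 1) • (m (i + 1) - m i))
        + c * ∫ q, blockLevelBound F π t x n a.l i q ∂ν := by
      rw [integral_add i3 i2, integral_add (integrable_const A) i1, integral_const, probReal_univ,
        one_smul, integral_const_mul,
        integral_inner (integrable_blockLevel H hσ ht x n u hl1 i) b,
        integral_blockLevel H hσ ht x n u hl1 i, hm0]
    rw [← hint]
    refine ofReal_integral_bound (hnn (i + 1)) (fun q => ?_) (i3.add i2)
    have e1 := hstep (i + 1) q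
    rw [blockMl_succ x n hi', hat] at e1
    have e2 := norm_blockLevel_sq_le (F := F) (π := π) (t := t) x n (l := a.l) i q
    refine e1.trans ?_
    change A + inner ℝ b (blockLevel F t x n a.l i q) + c * ‖blockLevel F t x n a.l i q‖ ^ 2 ≤ _
    gcongr
  -- the levels above the threshold
  set E₀ : ℝ := ∫ q, (2 * ‖G‖ ^ 2 + 4 * ‖blockRd F t x n a.l q - G‖ ^ 2) ∂ν with hE₀
  have hi0 : Integrable (fun q => 2 * ‖G‖ ^ 2 + 4 * ‖blockRd F t x n a.l q - G‖ ^ 2) ν :=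
    (integrable_const _).add ((integrable_norm_blockRd_sub_sq H hσ ht x n u hl1).const_mul 4)
  have hhigh : ∀ j, K < j → ∫⁻ q, ENNReal.ofReal (lyapunov f μ xstar
        (step F a (fun i => q.1 (n + i)) q.2 j ⟨s.x, s.xf, 0⟩)) ∂ν
      ≤ ENNReal.ofReal (A + inner ℝ b (m 0) + c * E₀) ∧ 0 ≤ A + inner ℝ b (m 0) + c * E₀ := by
    intro j hj
    have hj' : ¬ (2 : ℝ) ^ j ≤ a.M := fun h' => by
      have := (two_pow_le_iff hM1 j).1 h'
      omega
    have i1 : Integrable (fun q => inner ℝ b (blockRd F t x n a.l q)) ν :=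
      (integrable_blockRd H hσ ht x n u hl1).const_inner b
    have i3 : Integrable (fun q => A + inner ℝ b (blockRd F t x n a.l q)) ν :=
      (integrable_const A).add i1
    have hint : ∫ q, (A + inner ℝ b (blockRd F t x n a.l q)
        + c * (2 * ‖G‖ ^ 2 + 4 * ‖blockRd F t x n a.l q - G‖ ^ 2)) ∂ν
        = A + inner ℝ b (m 0) + c * E₀ := by
      rw [integral_add i3 (hi0.const_mul c), integral_add (integrable_const A) i1, integral_const,
        probReal_univ, one_smul, integral_const_mul,
        integral_inner (integrable_blockRd H hσ ht x n u hl1) b, hm0]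
    rw [← hint]
    refine ofReal_integral_bound (hnn j) (fun q => ?_) (i3.add (hi0.const_mul c))
    have e1 := hstep j q
    rw [blockMl_of_not_le x n hj', hat] at e1
    have e2 := norm_multilevel_sq_le G (blockRd F t x n a.l q - G) 0 0 0
    simp only [sub_add_cancel, zero_smul, add_zero, norm_zero, ne_eq, OfNat.ofNat_ne_zero,
      not_false_eq_true, zero_pow, mul_zero] at e2
    refine e1.trans ?_
    gcongr
  refine (lintegral_level_le_ofReal hlev K (fun i hi => (hlow i hi).2)
    (hhigh (K + 1) (by simp)).2 (fun i hi => (hlow i hi).1)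
    (fun j hj => (hhigh j hj).1)).trans (ENNReal.ofReal_le_ofReal ?_)
  -- averaging over the levels
  set s₂ : ℝ := levelAvg K (fun i => ∫ q, blockLevelBound F π t x n a.l i q ∂ν) E₀ with hs₂
  have havg : levelAvg K (fun i => A + inner ℝ b (m 0 + (2 : ℝ) ^ (i + 1) • (m (i + 1) - m i))
        + c * ∫ q, blockLevelBound F π t x n a.l i q ∂ν) (A + inner ℝ b (m 0) + c * E₀)
      = A + inner ℝ b (m K) + c * s₂ := by
    rw [levelAvg_add, levelAvg_add, levelAvg_const]
    congr 1
    · congr 1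
      rw [← levelAvg_telescope K m]
      exact (map_levelAvg (innerₛₗ ℝ b) K _ _).symm
    · exact (map_levelAvg (LinearMap.lsmul ℝ ℝ c) K _ _).symm
  rw [havg]
  have hl0 : (0 : ℝ) < a.l := by positivity
  have hlr : (a.l : ℝ) = (K + 1) * B := by rw [hl]; push_cast; ring
  have hv0 : 0 ≤ v := by positivity
  have hq0 : 0 ≤ ‖G‖ ^ 2 := by positivity
  have hw0 : 0 ≤ ((d : ℝ) + τ) * σ ^ 2 := by positivity
  -- The sum of `4v/l` and `24Kv/l` is at most `24v/B`, and `24·18 = 432`; the finite difference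
  -- terms are at most `(12 + 96)Mδ²`.
  have hs₂le : s₂ ≤ 4 / (7 * p) * ‖G‖ ^ 2 + (432 * ((d + τ) * σ ^ 2 / B) + 108 * a.M * δ ^ 2) := by
    have e1 : E₀ ≤ 2 * ‖G‖ ^ 2 + 4 * (v / a.l) + 12 * δ ^ 2 := by
      have k := integral_norm_blockRd_sub_sq_le H hσ ht x n u hl1
      rw [hE₀, integral_add (integrable_const _)
        ((integrable_norm_blockRd_sub_sq H hσ ht x n u hl1).const_mul 4), integral_const_mul,
        integral_const_mul, integral_const, probReal_univ, one_smul]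
      change _ ≤ v / a.l + 3 * δ ^ 2 at k
      change 2 * ‖G‖ ^ 2 + 4 * ∫ q, ‖blockRd F t x n a.l q - gradient (objective F π) x‖ ^ 2
        ∂blockLaw Q n u ≤ _
      linarith
    have e2 : s₂ ≤ _ := (levelAvg_mono (K := K)
      (fun i => integral_blockLevelBound_le H hσ ht x n u hl1 i hv hδ) e1).trans
      (levelAvg_pow_le (by positivity))
    -- The factor `K + 1` in the base batch size absorbs the number of levels.
    have e3 : v / a.l * (K + 1) = v / B := by rw [hlr]; field_simp
    have e4 : v / a.l * 4 ≤ v / a.l * 24 := by gcongr; norm_num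
    have e5 : v / B = 18 * (d / B) * ‖G‖ ^ 2 + 18 * ((d + τ) * σ ^ 2 / B) := by
      rw [hv]; field_simp
    have e6 : 432 * (1 + (d : ℝ) / B) * ‖G‖ ^ 2 ≤ 4 / (7 * p) * ‖G‖ ^ 2 := by gcongr
    have e7 : 12 * δ ^ 2 ≤ a.M * (12 * δ ^ 2) := le_mul_of_one_le_left (by positivity) hM1
    have e8 : 48 * δ ^ 2 * (2 * 2 ^ K) ≤ 48 * δ ^ 2 * (2 * a.M) := by gcongr
    linarith
  -- The finest batch has size `2^K l ≥ MB/2`, because `M ≤ 2·2^K`. Multiplied by the weight `M` of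
  -- the bias, the Markov part becomes `24τσ²/B`, comparable with the variance.
  have hmK : ‖m K - G‖ ^ 2 ≤ 24 * τ * σ ^ 2 / (a.M * B) + 2 * δ ^ 2 := by
    have k := norm_integral_blockRd_sub_sq_le H hσ ht x n u (N := 2 ^ K * a.l)
      (Nat.mul_pos (by positivity) hl1)
    refine k.trans ?_
    have e1 : a.M * B ≤ 2 * ((2 ^ K * a.l : ℕ) : ℝ) := by
      push_cast
      rw [hlr]
      calc a.M * B ≤ (2 * 2 ^ K) * (1 * B) := by rw [one_mul]; gcongr
        _ ≤ (2 * 2 ^ K) * ((K + 1) * B) := by gcongr; linarith [(Nat.cast_nonneg K : (0:ℝ) ≤ K)]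
        _ = _ := by ring
    have e2 : 12 * τ * σ ^ 2 / ((2 ^ K * a.l : ℕ) : ℝ) = 24 * τ * σ ^ 2 / (2 * ((2 ^ K * a.l : ℕ) : ℝ)) := by
      field_simp; ring
    rw [e2]
    gcongr
  refine (lyapunov_average_le H.convex hp hh hμ hph s xstar hxdef (m K) hmK hs₂le).trans ?_
  rw [← hM]
  -- The constants are `780 = (7/4)·432 + 24` and `191 = (7/4)·108 + 2`.
  refine add_le_add le_rfl (mul_le_mul_of_nonneg_left ?_ (by positivity))
  have hM0 : 0 < a.M := by linarith
  have e1 : a.M * (24 * τ * σ ^ 2 / (a.M * B) + 2 * δ ^ 2)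
      = 24 * (τ * σ ^ 2 / B) + a.M * (2 * δ ^ 2) := by field_simp
  have e2 : (τ : ℝ) * σ ^ 2 / B ≤ (d + τ) * σ ^ 2 / B := by
    gcongr; linarith [(Nat.cast_nonneg d : (0:ℝ) ≤ d)]
  have e3 : 0 ≤ a.M * δ ^ 2 := by positivity
  rw [e1]
  linarith

end OneStep

/-! ### Dependence of the trajectory on the randomness -/

section Run

variable {d : ℕ} {S : Type*} {F : Vec d → S → ℝ} {a : Params} {x0 : Vec d}

theorem gRd_congr (t : ℝ) (x : Vec d) {N : ℕ} {z z' : ℕ → S} {e e' : ℕ → Vec d}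
    (hz : ∀ i < N, z i = z' i) (he : ∀ i < N, e i = e' i) :
    gRd F t x N z e = gRd F t x N z' e' := by
  rw [gRd, gRd]
  congr 1
  exact Finset.sum_congr rfl fun i hi => by
    rw [hz i (Finset.mem_range.1 hi), he i (Finset.mem_range.1 hi)]

theorem gMl_congr (x : Vec d) (j : ℕ) {z z' : ℕ → S} {e e' : ℕ → Vec d}
    (hz : ∀ i < a.batchSize j, z i = z' i) (he : ∀ i < a.batchSize j, e i = e' i) :
    gMl F a x j z e = gMl F a x j z' e' := by
  have key : ∀ {N : ℕ}, N ≤ a.batchSize j → gRd F a.t x N z e = gRd F a.t x N z' e' := fun hN =>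
    gRd_congr a.t x (fun i hi => hz i (hi.trans_le hN)) (fun i hi => he i (hi.trans_le hN))
  unfold gMl
  by_cases hj : (2 : ℝ) ^ j ≤ a.M
  · have hb : a.batchSize j = 2 ^ j * a.l := if_pos hj
    rw [if_pos hj, if_pos hj, key (hb ▸ Nat.le_mul_of_pos_left _ (by positivity)), key hb.ge,
      key (hb ▸ Nat.mul_le_mul_right _ (Nat.pow_le_pow_right two_pos (Nat.sub_le j 1)))]
  · have hb : a.batchSize j = a.l := if_neg hj
    rw [if_neg hj, if_neg hj, key hb.ge]

/-- The number of oracle calls in the first `k` iterations. -/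
noncomputable def callCount (a : Params) (J : ℕ → ℕ) (k : ℕ) : ℕ :=
  ∑ i ∈ Finset.range k, a.batchSize (J i)

theorem calls_run (z : ℕ → S) (e : ℕ → Vec d) (J : ℕ → ℕ) (k : ℕ) :
    (run F a x0 z e J k).calls = callCount a J k := by
  induction k with
  | zero => rfl
  | succ k ih => rw [callCount, Finset.sum_range_succ, ← callCount, ← ih]; rfl

theorem callCount_congr {J J' : ℕ → ℕ} {k : ℕ} (hJ : ∀ i < k, J i = J' i) :
    callCount a J k = callCount a J' k :=
  Finset.sum_congr rfl fun i hi => by rw [hJ i (Finset.mem_range.1 hi)]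

/-- The first `k` iterations read exactly the indices below `callCount a J k`, a number determined
by the levels; this lets the later noise and directions be resampled. -/
theorem run_congr {z z' : ℕ → S} {e e' : ℕ → Vec d} {J : ℕ → ℕ} {k : ℕ}
    (hz : ∀ i < callCount a J k, z i = z' i) (he : ∀ i < callCount a J k, e i = e' i) :
    run F a x0 z e J k = run F a x0 z' e' J k := by
  induction k with
  | zero => rfl
  | succ k ih =>
    have hc : callCount a J (k + 1) = callCount a J k + a.batchSize (J k) := Finset.sum_range_succ _ _
    have h1 := ih (fun i hi => hz i (by omega)) (fun i hi => he i (by omega))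
    change step F a z e (J k) (run F a x0 z e J k) = step F a z' e' (J k) (run F a x0 z' e' J k)
    rw [h1]
    have hn := calls_run (F := F) (a := a) (x0 := x0) z' e' J k
    simp only [step]
    rw [gMl_congr (F := F) (a := a) (z := fun i => z ((run F a x0 z' e' J k).calls + i))
      (z' := fun i => z' ((run F a x0 z' e' J k).calls + i))
      (e := fun i => e ((run F a x0 z' e' J k).calls + i))
      (e' := fun i => e' ((run F a x0 z' e' J k).calls + i)) _ (J k)
      (fun i hi => hz _ (by omega)) (fun i hi => he _ (by omega))]

theorem run_congr_level {z : ℕ → S} {e : ℕ → Vec d} {J J' : ℕ → ℕ} {k : ℕ}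
    (hJ : ∀ i < k, J i = J' i) : run F a x0 z e J k = run F a x0 z e J' k := by
  induction k with
  | zero => rfl
  | succ k ih =>
    change step F a z e (J k) (run F a x0 z e J k) = step F a z e (J' k) (run F a x0 z e J' k)
    rw [ih fun i hi => hJ i (by omega), hJ k (by omega)]

/-- The Lyapunov function after a step that starts at time `s.calls`. -/
theorem lyapunov_step_shift (f : Vec d → ℝ) (μ : ℝ) (xstar : Vec d) (z : ℕ → S) (e : ℕ → Vec d)
    (j : ℕ) (s : AlgState d) :
    lyapunov f μ xstar (step F a z e j s) = lyapunov f μ xstar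
      (step F a (fun i => z (s.calls + i)) (fun i => e (s.calls + i)) j ⟨s.x, s.xf, 0⟩) := by
  simp [lyapunov, step]

variable [MeasurableSpace S]

theorem measurable_gMl (hF : Measurable (Function.uncurry F)) (a : Params) (j : ℕ) :
    Measurable fun q : Vec d × (ℕ → S) × (ℕ → Vec d) => gMl F a q.1 j q.2.1 q.2.2 := by
  unfold gMl
  by_cases hj : (2 : ℝ) ^ j ≤ a.M
  · simp only [hj, if_true]
    exact (measurable_gRd hF a.t _).add
      (((measurable_gRd hF a.t _).sub (measurable_gRd hF a.t _)).const_smul ((2 : ℝ) ^ j))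
  · simp only [hj, if_false]
    exact (measurable_gRd hF a.t _).add measurable_const

theorem measurable_gMl_shift (hF : Measurable (Function.uncurry F)) (a : Params) :
    Measurable fun q : (Vec d × (ℕ → S) × (ℕ → Vec d)) × (ℕ × ℕ) =>
      gMl F a q.1.1 q.2.1 (fun i => q.1.2.1 (q.2.2 + i)) (fun i => q.1.2.2 (q.2.2 + i)) :=
  measurable_from_prod_countable_left fun y => (measurable_gMl hF a y.1).comp
    (f := fun q : Vec d × (ℕ → S) × (ℕ → Vec d) =>
      (q.1, (fun i => q.2.1 (y.2 + i)), (fun i => q.2.2 (y.2 + i)))) (by fun_prop)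

/-- Measurability of a state of the algorithm. -/
def StateMeasurable {α : Type*} [MeasurableSpace α] (s : α → AlgState d) : Prop :=
  (Measurable fun q => (s q).x) ∧ (Measurable fun q => (s q).xf) ∧ Measurable fun q => (s q).calls

theorem StateMeasurable.step {α : Type*} [MeasurableSpace α] (hF : Measurable (Function.uncurry F))
    {z : α → ℕ → S} {e : α → ℕ → Vec d} {j : α → ℕ} {s : α → AlgState d} (hz : Measurable z)
    (he : Measurable e) (hj : Measurable j) (hs : StateMeasurable s) :
    StateMeasurable fun q => step F a (z q) (e q) (j q) (s q) := by
  obtain ⟨h1, h2, h3⟩ := hs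
  have hxg : Measurable fun q => a.θ • (s q).xf + (1 - a.θ) • (s q).x :=
    (h2.const_smul a.θ).add (h1.const_smul (1 - a.θ))
  have hg : Measurable fun q => gMl F a (a.θ • (s q).xf + (1 - a.θ) • (s q).x) (j q)
      (fun i => z q ((s q).calls + i)) (fun i => e q ((s q).calls + i)) :=
    (measurable_gMl_shift hF a).comp (f := fun q =>
      ((a.θ • (s q).xf + (1 - a.θ) • (s q).x, z q, e q), (j q, (s q).calls)))
      ((hxg.prodMk (hz.prodMk he)).prodMk (hj.prodMk h3))
  have hxf : Measurable fun q => (ZeroOrder.step F a (z q) (e q) (j q) (s q)).xf :=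
    hxg.sub (hg.const_smul (a.p * a.γ))
  refine ⟨?_, hxf, h3.add ((measurable_from_top (f := a.batchSize)).comp hj)⟩
  exact (((hxf.const_smul a.η).add (h2.const_smul (a.p - a.η))).add
    (h1.const_smul ((1 - a.p) * (1 - a.β)))).add (hxg.const_smul ((1 - a.p) * a.β))

theorem StateMeasurable.run {α : Type*} [MeasurableSpace α] (hF : Measurable (Function.uncurry F))
    {z : α → ℕ → S} {e : α → ℕ → Vec d} {J : α → ℕ → ℕ} (hz : Measurable z)
    (he : Measurable e) (hJ : Measurable J) (k : ℕ) :
    StateMeasurable fun q => run F a x0 (z q) (e q) (J q) k := by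
  induction k with
  | zero => exact ⟨measurable_const, measurable_const, measurable_const⟩
  | succ k ih => exact StateMeasurable.step hF hz he ((measurable_pi_apply k).comp hJ) ih

theorem StateMeasurable.lyapunov {α : Type*} [MeasurableSpace α] {s : α → AlgState d}
    (hs : StateMeasurable s) {f : Vec d → ℝ} (hf : Measurable f) (μ : ℝ) (xstar : Vec d) :
    Measurable fun q => lyapunov f μ xstar (s q) :=
  ((hs.1.sub_const xstar).norm.pow_const 2).add
    (((hf.comp hs.2.1).sub_const (f xstar)).const_mul (6 / μ))

end Run

/-! ### Resampling the future -/

/-- Such a function factors through the discrete space of `k`-tuples of naturals. It settles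
measurability in the levels of quantities whose dependence on them runs through `callCount`. -/
theorem measurable_of_forall_lt_eq {β : Type*} [MeasurableSpace β] {k : ℕ} {φ : (ℕ → ℕ) → β}
    (hφ : ∀ J J' : ℕ → ℕ, (∀ i < k, J i = J' i) → φ J = φ J') : Measurable φ := by
  set ext : (Fin k → ℕ) → ℕ → ℕ := fun v i => if hi : i < k then v ⟨i, hi⟩ else 0
  have h1 : φ = (φ ∘ ext) ∘ fun J i => J (i : Fin k) := by
    funext J
    exact hφ _ _ fun i hi => by simp [ext, hi]
  rw [h1]
  exact (Measurable.of_discrete (f := φ ∘ ext)).comp (by fun_prop)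

section Resample

variable {d : ℕ} [NeZero d] {S : Type*} [MeasurableSpace S] {Ω : Type*} [MeasurableSpace Ω]
  {P : Measure Ω} [IsProbabilityMeasure P] {Q : Kernel S S} [IsMarkovKernel Q] {Z : ℕ → Ω → S}

variable (d) in
/-- The joint law of the noise, given its past, and of fresh directions, as a kernel in the path. -/
noncomputable def blockKernel (Q : Kernel S S) [IsMarkovKernel Q] (n : ℕ) :
    Kernel (ℕ → S) ((ℕ → S) × (ℕ → Vec d)) :=
  ((pathKernel Q n).comap (Preorder.frestrictLe (π := fun _ => S) n)
    (Preorder.measurable_frestrictLe n)).prod (Kernel.const _ (dirLaw d))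

instance (n : ℕ) : IsMarkovKernel (blockKernel d Q n) := by unfold blockKernel; infer_instance

theorem blockKernel_apply (n : ℕ) (z : ℕ → S) :
    blockKernel d Q n z = blockLaw Q n (Preorder.frestrictLe (π := fun _ => S) n z) := by
  rw [blockKernel, Kernel.prod_apply, Kernel.comap_apply, Kernel.const_apply, blockLaw]

theorem measurable_lintegral_blockKernel {α : Type*} [MeasurableSpace α] (n : ℕ) {z : α → ℕ → S}
    (hz : Measurable z) {D : α → (ℕ → S) × (ℕ → Vec d) → ℝ≥0∞}
    (hD : Measurable (Function.uncurry D)) :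
    Measurable fun p => ∫⁻ q, D p q ∂blockKernel d Q n (z p) :=
  Measurable.lintegral_kernel_prod_right' (κ := (blockKernel d Q n).comap z hz) hD

/-- Conditionally on the noise up to time `n` and the directions before time `n`, the future is
distributed as a block. -/
theorem lintegral_resample [MeasurableEq S] (hZ : IsMarkovChain P Q Z) (n : ℕ)
    {D : (ℕ → S) → (ℕ → Vec d) → (ℕ → S) × (ℕ → Vec d) → ℝ≥0∞}
    (hD : Measurable fun p : ((ℕ → S) × (ℕ → Vec d)) × ((ℕ → S) × (ℕ → Vec d)) =>
      D p.1.1 p.1.2 p.2)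
    (hdep : ∀ z z' e e' q, (∀ i < n, z i = z' i) → (∀ i < n, e i = e' i) → D z e q = D z' e' q) :
    ∫⁻ e, ∫⁻ z, D z e (z, fun i => e (n + i)) ∂P.map (fun ω i => Z i ω) ∂dirLaw d
      = ∫⁻ e, ∫⁻ z, ∫⁻ q, D z e q ∂blockKernel d Q n z ∂P.map (fun ω i => Z i ω) ∂dirLaw d := by
  have hZm : Measurable fun ω i => Z i ω := measurable_pi_lambda _ hZ.1
  have := Measure.isProbabilityMeasure_map (μ := P) hZm.aemeasurable
  set κ : Kernel (ℕ → S) (ℕ → S) := (pathKernel Q n).comap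
    (Preorder.frestrictLe (π := fun _ => S) n) (Preorder.measurable_frestrictLe n) with hκ
  have h1 : ∀ e, ∫⁻ z, D z e (z, fun i => e (n + i)) ∂P.map (fun ω i => Z i ω)
      = ∫⁻ z, ∫⁻ w, D z e (w, fun i => e (n + i)) ∂κ z ∂P.map (fun ω i => Z i ω) := fun e =>
    hZ.lintegral_eq n (G := fun z w => D z e (w, fun i => e (n + i)))
      (hD.comp (f := fun p : (ℕ → S) × (ℕ → S) => ((p.1, e), (p.2, fun i => e (n + i))))
        (by fun_prop))
      -- The noise is conditioned on times `0, …, n`, one more than the past iterations have used: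
      -- `Z n`, which opens the new block, is also fixed. This provides a state to start from even
      -- for `n = 0`, so the initial law is immaterial.
      (fun w w' z hw => hdep _ _ _ _ _ (fun i hi => hw i hi.le) fun _ _ => rfl)
  simp_rw [h1]
  have hmeas : Measurable fun p : ((ℕ → Vec d) × (ℕ → Vec d)) × (ℕ → S) =>
      ∫⁻ w, D p.2 p.1.1 (w, p.1.2) ∂κ p.2 :=
    Measurable.lintegral_kernel_prod_right' (κ := κ.comap Prod.snd measurable_snd)
      (f := fun p : (((ℕ → Vec d) × (ℕ → Vec d)) × (ℕ → S)) × (ℕ → S) =>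
        D p.1.2 p.1.1.1 (p.2, p.1.1.2))
      (hD.comp (f := fun p : (((ℕ → Vec d) × (ℕ → Vec d)) × (ℕ → S)) × (ℕ → S) =>
        ((p.1.2, p.1.1.1), (p.2, p.1.1.2))) (by fun_prop))
  have h2 := lintegral_infinitePi_eq (uniformSphere d) n
    (G := fun e e' => ∫⁻ z, ∫⁻ w, D z e (w, e') ∂κ z ∂P.map (fun ω i => Z i ω))
    hmeas.lintegral_prod_right'
    (fun e e' e'' he => lintegral_congr fun z => lintegral_congr fun w =>
      hdep _ _ _ _ _ (fun _ _ => rfl) he)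
  refine h2.trans (lintegral_congr fun e => ?_)
  refine (lintegral_lintegral_swap
    (f := fun (e' : ℕ → Vec d) (z : ℕ → S) => ∫⁻ w, D z e (w, e') ∂κ z)
    (hmeas.comp (f := fun p : (ℕ → Vec d) × (ℕ → S) =>
      ((e, p.1), p.2)) (by fun_prop)).aemeasurable).trans (lintegral_congr fun z => ?_)
  rw [blockKernel, Kernel.prod_apply, Kernel.const_apply, ← hκ]
  exact (lintegral_prod_symm' (D z e) (hD.comp
    (f := fun q : (ℕ → S) × (ℕ → Vec d) => ((z, e), q)) (by fun_prop))).symm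

end Resample

/-! ### The recursion for the expected Lyapunov function -/

section Recursion

variable {d : ℕ} [NeZero d] {S : Type*} [MeasurableSpace S] {Ω : Type*} [MeasurableSpace Ω]
  {P : Measure Ω} [IsProbabilityMeasure P] {Q : Kernel S S} [IsMarkovKernel Q] {Z : ℕ → Ω → S}
  {e : ℕ → Ω → Vec d} {J : ℕ → Ω → ℕ}

omit [NeZero d] [IsMarkovKernel Q] in
theorem IsSampling.isProbabilityMeasure_level (h : IsSampling P Q Z e J) (k : ℕ) :
    IsProbabilityMeasure (P.map (J k)) :=
  Measure.isProbabilityMeasure_map (h.measurable_level k).aemeasurable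

omit [NeZero d] [IsProbabilityMeasure P] [IsMarkovKernel Q] in
theorem IsSampling.map_level_singleton (h : IsSampling P Q Z e J) (k j : ℕ) (hj : 1 ≤ j) :
    P.map (J k) {j} = (1 / 2 : ℝ≥0∞) ^ j := by
  rw [Measure.map_apply (h.measurable_level k) (measurableSet_singleton j), ← h.law_level k j hj]
  rfl

omit [NeZero d] [IsMarkovKernel Q] in
theorem IsSampling.map_level_eq (h : IsSampling P Q Z e J) (k : ℕ) :
    P.map (J k) = P.map (J 0) := by
  have := h.isProbabilityMeasure_level k
  have := h.isProbabilityMeasure_level 0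
  refine Measure.ext_of_singleton fun j => ?_
  rcases Nat.eq_zero_or_pos j with rfl | hj
  · rw [measure_level_zero (h.map_level_singleton k), measure_level_zero (h.map_level_singleton 0)]
  · rw [h.map_level_singleton k j hj, h.map_level_singleton 0 j hj]

omit [IsMarkovKernel Q] in
/-- The three sources of randomness are independent, with known laws of directions and levels. -/
theorem IsSampling.lintegral_eq (h : IsSampling P Q Z e J)
    {Φ : (ℕ → S) → (ℕ → Vec d) → (ℕ → ℕ) → ℝ≥0∞}
    (hΦ : Measurable fun q : (ℕ → S) × (ℕ → Vec d) × (ℕ → ℕ) => Φ q.1 q.2.1 q.2.2) :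
    ∫⁻ ω, Φ (fun i => Z i ω) (fun i => e i ω) (fun i => J i ω) ∂P
      = ∫⁻ Y, ∫⁻ y, ∫⁻ z, Φ z y Y ∂P.map (fun ω i => Z i ω) ∂dirLaw d
          ∂Measure.infinitePi fun _ : ℕ => P.map (J 0) := by
  have hZ : Measurable fun ω i => Z i ω := measurable_pi_lambda _ h.chain.1
  have he : Measurable fun ω i => e i ω := measurable_pi_lambda _ h.measurable_dir
  have hJ : Measurable fun ω i => J i ω := measurable_pi_lambda _ h.measurable_level
  have := Measure.isProbabilityMeasure_map (μ := P) hZ.aemeasurable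
  have := h.isProbabilityMeasure_level 0
  have l1 : P.map (fun ω i => e i ω) = dirLaw d := by
    rw [(iIndepFun_iff_map_fun_eq_infinitePi_map h.measurable_dir).1 h.indep_dir, dirLaw]
    simp_rw [h.law_dir]
  have l2 : P.map (fun ω i => J i ω) = Measure.infinitePi fun _ : ℕ => P.map (J 0) := by
    have hp : ∀ k, IsProbabilityMeasure (P.map (J k)) := h.isProbabilityMeasure_level
    rw [(iIndepFun_iff_map_fun_eq_infinitePi_map h.measurable_level).1 h.indep_level]
    congr 1
    funext k
    exact h.map_level_eq k
  have l3 : P.map (fun ω => ((fun i => Z i ω), (fun i => e i ω), fun i => J i ω))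
      = (P.map fun ω i => Z i ω).prod
        ((dirLaw d).prod (Measure.infinitePi fun _ : ℕ => P.map (J 0))) := by
    rw [(indepFun_iff_map_prod_eq_prod_map_map hZ.aemeasurable (he.prodMk hJ).aemeasurable).1
      h.indep_chain, (indepFun_iff_map_prod_eq_prod_map_map he.aemeasurable hJ.aemeasurable).1
      h.indep_dir_level, l1, l2]
  have h1 := lintegral_map (μ := P) hΦ (hZ.prodMk (he.prodMk hJ))
  rw [← h1, l3, lintegral_prod_symm' _ hΦ,
    lintegral_prod_symm' _ (Measurable.lintegral_prod_left' hΦ)]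

variable {F : Vec d → S → ℝ} {π : Measure S} {L μ σ : ℝ} {τ : ℕ}

/-- Averaging over the level and over the block used by one iteration. -/
theorem lintegral_iteration_eq [MeasurableEq S] (hF : Measurable (Function.uncurry F))
    (hZ : IsMarkovChain P Q Z) (a : Params) (x0 : Vec d) {f : Vec d → ℝ} (hf : Measurable f)
    (μ : ℝ) (xstar : Vec d) (lev : Measure ℕ) [IsProbabilityMeasure lev] (k : ℕ) :
    ∫⁻ Y, ∫⁻ y, ∫⁻ z, ENNReal.ofReal (lyapunov f μ xstar (run F a x0 z y Y (k + 1)))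
        ∂P.map (fun ω i => Z i ω) ∂dirLaw d ∂(Measure.infinitePi fun _ : ℕ => lev)
      = ∫⁻ Y, ∫⁻ y, ∫⁻ z, ∫⁻ j, ∫⁻ q, ENNReal.ofReal (lyapunov f μ xstar
          (step F a (fun i => q.1 (callCount a Y k + i)) q.2 j
            ⟨(run F a x0 z y Y k).x, (run F a x0 z y Y k).xf, 0⟩))
          ∂blockKernel d Q (callCount a Y k) z ∂lev
        ∂P.map (fun ω i => Z i ω) ∂dirLaw d ∂(Measure.infinitePi fun _ : ℕ => lev) := by
  have hZm : Measurable fun ω i => Z i ω := measurable_pi_lambda _ hZ.1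
  have := Measure.isProbabilityMeasure_map (μ := P) hZm.aemeasurable
  set D : (ℕ → ℕ) → ℕ → (ℕ → S) → (ℕ → Vec d) → (ℕ → S) × (ℕ → Vec d) → ℝ≥0∞ :=
    fun Y j z y q => ENNReal.ofReal (lyapunov f μ xstar
      (step F a (fun i => q.1 (callCount a Y k + i)) q.2 j
        ⟨(run F a x0 z y Y k).x, (run F a x0 z y Y k).xf, 0⟩)) with hD
  have hDm : ∀ Y, Measurable fun p : (ℕ × (ℕ → S) × (ℕ → Vec d)) × ((ℕ → S) × (ℕ → Vec d)) =>
      D Y p.1.1 p.1.2.1 p.1.2.2 p.2 := fun Y => by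
    have hs : StateMeasurable fun p : (ℕ × (ℕ → S) × (ℕ → Vec d)) × ((ℕ → S) × (ℕ → Vec d)) =>
        run F a x0 p.1.2.1 p.1.2.2 Y k :=
      StateMeasurable.run hF (by fun_prop) (by fun_prop) measurable_const k
    have hs0 : StateMeasurable fun p : (ℕ × (ℕ → S) × (ℕ → Vec d)) × ((ℕ → S) × (ℕ → Vec d)) =>
        (⟨(run F a x0 p.1.2.1 p.1.2.2 Y k).x, (run F a x0 p.1.2.1 p.1.2.2 Y k).xf, 0⟩ :
          AlgState d) := ⟨hs.1, hs.2.1, measurable_const⟩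
    exact ((StateMeasurable.step hF
      (z := fun p : (ℕ × (ℕ → S) × (ℕ → Vec d)) × ((ℕ → S) × (ℕ → Vec d)) =>
        fun i => p.2.1 (callCount a Y k + i))
      (e := fun p => p.2.2) (j := fun p => p.1.1) (by fun_prop) (by fun_prop)
      (by fun_prop) hs0).lyapunov hf μ xstar).ennreal_ofReal
  have hshift : ∀ Y y z, ENNReal.ofReal (lyapunov f μ xstar (run F a x0 z y Y (k + 1)))
      = D Y (Y k) z y (z, fun i => y (callCount a Y k + i)) := fun Y y z => by
    simp only [hD]
    rw [run, lyapunov_step_shift, calls_run]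
  have hres : ∀ Y j, ∫⁻ y, ∫⁻ z, D Y j z y (z, fun i => y (callCount a Y k + i))
        ∂P.map (fun ω i => Z i ω) ∂dirLaw d
      = ∫⁻ y, ∫⁻ z, ∫⁻ q, D Y j z y q ∂blockKernel d Q (callCount a Y k) z
        ∂P.map (fun ω i => Z i ω) ∂dirLaw d := fun Y j =>
    lintegral_resample hZ (callCount a Y k) (D := D Y j)
      ((hDm Y).comp (f := fun p : ((ℕ → S) × (ℕ → Vec d)) × ((ℕ → S) × (ℕ → Vec d)) =>
        ((j, p.1), p.2)) (by fun_prop))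
      (fun z z' y y' q hz hy => by simp only [hD]; rw [run_congr hz hy])
  set W : (ℕ → ℕ) → ℕ → ℝ≥0∞ := fun Y j => ∫⁻ y, ∫⁻ z, ∫⁻ q, D Y j z y q
    ∂blockKernel d Q (callCount a Y k) z ∂P.map (fun ω i => Z i ω) ∂dirLaw d with hW
  have hWc : ∀ Y Y' j, (∀ i < k, Y i = Y' i) → W Y j = W Y' j := fun Y Y' j hY => by
    simp only [hW, hD]
    rw [callCount_congr hY]
    simp_rw [run_congr_level hY]
  have hWm : Measurable fun p : (ℕ → ℕ) × (ℕ → ℕ) => W p.1 (p.2 0) :=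
    (measurable_from_prod_countable_left (f := fun p : (ℕ → ℕ) × ℕ => W p.1 p.2)
      fun j => measurable_of_forall_lt_eq (k := k) fun Y Y' hY => hWc Y Y' j hY).comp
      (f := fun p : (ℕ → ℕ) × (ℕ → ℕ) => (p.1, p.2 0)) (by fun_prop)
  -- Levels before `k` fix the block boundary, while `J k` is independent of them and becomes
  -- coordinate 0 of a fresh sequence.
  have hlev := lintegral_infinitePi_eq lev k (G := fun Y Y' => W Y (Y' 0)) hWm
    (fun Y Y' Y'' hY => hWc Y Y' _ hY)
  simp_rw [hshift, hres]
  refine hlev.trans (lintegral_congr fun Y => ?_)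
  have hmp : MeasurePreserving (Function.eval 0) (Measure.infinitePi fun _ : ℕ => lev) lev :=
    measurePreserving_eval_infinitePi (fun _ : ℕ => lev) 0
  have h1 : ∫⁻ Y', W Y (Y' 0) ∂(Measure.infinitePi fun _ : ℕ => lev) = ∫⁻ j, W Y j ∂lev :=
    hmp.lintegral_comp measurable_from_top
  rw [h1]
  have hI : Measurable fun p : ℕ × (ℕ → S) × (ℕ → Vec d) =>
      ∫⁻ q, D Y p.1 p.2.1 p.2.2 q ∂blockKernel d Q (callCount a Y k) p.2.1 :=
    measurable_lintegral_blockKernel (callCount a Y k) (z := fun p : ℕ × (ℕ → S) × (ℕ → Vec d) =>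
      p.2.1) (by fun_prop) (hDm Y)
  have hI' : Measurable fun p : (ℕ × (ℕ → Vec d)) × (ℕ → S) =>
      ∫⁻ q, D Y p.1.1 p.2 p.1.2 q ∂blockKernel d Q (callCount a Y k) p.2 :=
    hI.comp (f := fun p : (ℕ × (ℕ → Vec d)) × (ℕ → S) => (p.1.1, p.2, p.1.2)) (by fun_prop)
  simp only [hW]
  refine (lintegral_lintegral_swap (f := fun (j : ℕ) (y : ℕ → Vec d) => ∫⁻ z, ∫⁻ q, D Y j z y q
    ∂blockKernel d Q (callCount a Y k) z ∂P.map (fun ω i => Z i ω))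
    hI'.lintegral_prod_right'.aemeasurable).trans (lintegral_congr fun y => ?_)
  exact lintegral_lintegral_swap (f := fun (j : ℕ) (z : ℕ → S) => ∫⁻ q, D Y j z y q
    ∂blockKernel d Q (callCount a Y k) z)
    (hI'.comp (f := fun p : ℕ × (ℕ → S) => ((p.1, y), p.2)) (by fun_prop)).aemeasurable

/-- One step of the recursion. -/
theorem lintegral_lyapunov_succ_le [MeasurableEq S] {p h t : ℝ} {B : ℕ}
    (H : TwoPointAssumptions F Q π L μ σ τ) (hS : IsSampling P Q Z e J) (hσ : 0 ≤ σ) (ht : 0 < t)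
    (hμ : 0 < μ) (hp : 0 < p) (hp1 : p ≤ 1) (hh : 0 < h) (hph : p * h ≤ 1 / 2)
    (hLh : L * (3 * h ^ 2 / μ) ≤ 3 / 4) (hB : 1 ≤ B)
    (hpB : 432 * (1 + (d : ℝ) / B) ≤ 4 / (7 * p)) (x0 : Vec d) {xstar : Vec d}
    (hx : ∀ y, objective F π xstar ≤ objective F π y) (k : ℕ) :
    ∫⁻ ω, ENNReal.ofReal (lyapunov (objective F π) μ xstar
        (trajectory F (paramsOf p h t μ B) x0 Z e J (k + 1) ω)) ∂P
      ≤ ENNReal.ofReal (1 - p * h) * ∫⁻ ω, ENNReal.ofReal (lyapunov (objective F π) μ xstar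
          (trajectory F (paramsOf p h t μ B) x0 Z e J k ω)) ∂P
        + ENNReal.ofReal (9 * (p ^ 2 * h ^ 2 / μ ^ 2) * (780 * ((d + τ) * σ ^ 2 / B)
          + 191 * (1 / p + 1 / (p * h)) * (d * (L * t / 2)) ^ 2)) := by
  have hF := H.measurable_uncurry
  have hf : Measurable (objective F π) := H.convex.1.continuous.measurable
  have := hS.isProbabilityMeasure_level 0
  have hZm : Measurable fun ω i => Z i ω := measurable_pi_lambda _ hS.chain.1
  have := Measure.isProbabilityMeasure_map (μ := P) hZm.aemeasurable
  have hΦ : ∀ k, Measurable fun q : (ℕ → S) × (ℕ → Vec d) × (ℕ → ℕ) =>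
      ENNReal.ofReal (lyapunov (objective F π) μ xstar
        (run F (paramsOf p h t μ B) x0 q.1 q.2.1 q.2.2 k)) := fun k =>
    ((StateMeasurable.run hF measurable_fst (measurable_fst.comp measurable_snd)
      (measurable_snd.comp measurable_snd) k).lyapunov hf μ xstar).ennreal_ofReal
  have hE : ∀ k, ∫⁻ ω, ENNReal.ofReal (lyapunov (objective F π) μ xstar
        (trajectory F (paramsOf p h t μ B) x0 Z e J k ω)) ∂P
      = ∫⁻ Y, ∫⁻ y, ∫⁻ z, ENNReal.ofReal (lyapunov (objective F π) μ xstar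
        (run F (paramsOf p h t μ B) x0 z y Y k)) ∂P.map (fun ω i => Z i ω) ∂dirLaw d
          ∂Measure.infinitePi fun _ : ℕ => P.map (J 0) := fun k => hS.lintegral_eq
      (Φ := fun z y Y => ENNReal.ofReal (lyapunov (objective F π) μ xstar
        (run F (paramsOf p h t μ B) x0 z y Y k))) (hΦ k)
  set c : ℝ≥0∞ := ENNReal.ofReal (9 * (p ^ 2 * h ^ 2 / μ ^ 2) * (780 * ((d + τ) * σ ^ 2 / B)
          + 191 * (1 / p + 1 / (p * h)) * (d * (L * t / 2)) ^ 2)) with hc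
  rw [hE, hE, lintegral_iteration_eq hF hS.chain _ x0 hf μ xstar (P.map (J 0)) k]
  calc _ ≤ ∫⁻ Y, ∫⁻ y, ∫⁻ z, (ENNReal.ofReal (1 - p * h) * ENNReal.ofReal
          (lyapunov (objective F π) μ xstar (run F (paramsOf p h t μ B) x0 z y Y k)) + c)
          ∂P.map (fun ω i => Z i ω) ∂dirLaw d ∂Measure.infinitePi fun _ : ℕ => P.map (J 0) := by
        refine lintegral_mono fun Y => lintegral_mono fun y => lintegral_mono fun z => ?_
        simp only [blockKernel_apply]
        refine (lintegral_lyapunov_step_le H hσ ht hμ hp hp1 hh hph hLh hB hpB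
          (hS.map_level_singleton 0) hx (run F (paramsOf p h t μ B) x0 z y Y k) _ _).trans ?_
        rw [hc, ← ENNReal.ofReal_mul (by linarith)]
        exact ENNReal.ofReal_add_le
    _ = _ := by
        simp_rw [lintegral_add_right _ measurable_const, lintegral_const, measure_univ, mul_one]
        simp_rw [lintegral_const_mul' _ _ ENNReal.ofReal_ne_top]

/-- The expected Lyapunov function after `N` iterations. -/
theorem lintegral_lyapunov_le [MeasurableEq S] {p h t : ℝ} {B : ℕ}
    (H : TwoPointAssumptions F Q π L μ σ τ) (hS : IsSampling P Q Z e J) (hσ : 0 ≤ σ) (ht : 0 < t)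
    (hμ : 0 < μ) (hp : 0 < p) (hp1 : p ≤ 1) (hh : 0 < h) (hph : p * h ≤ 1 / 2)
    (hLh : L * (3 * h ^ 2 / μ) ≤ 3 / 4) (hB : 1 ≤ B)
    (hpB : 432 * (1 + (d : ℝ) / B) ≤ 4 / (7 * p)) (x0 : Vec d) {xstar : Vec d}
    (hx : ∀ y, objective F π xstar ≤ objective F π y) (N : ℕ) :
    ∫⁻ ω, ENNReal.ofReal (lyapunov (objective F π) μ xstar
        (trajectory F (paramsOf p h t μ B) x0 Z e J N ω)) ∂P
      ≤ ENNReal.ofReal ((1 - p * h) ^ N * lyapunov (objective F π) μ xstar ⟨x0, x0, 0⟩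
        + 9 * (p * h / μ ^ 2) * (780 * ((d + τ) * σ ^ 2 / B)
          + 191 * (1 / p + 1 / (p * h)) * (d * (L * t / 2)) ^ 2)) := by
  have hpos : 0 < p * h := by positivity
  have h1p : 0 ≤ 1 - p * h := by linarith
  set w : ℝ := 780 * ((d + τ) * σ ^ 2 / B)
          + 191 * (1 / p + 1 / (p * h)) * (d * (L * t / 2)) ^ 2 with hw
  have hw0 : 0 ≤ w := by positivity
  have hl0 := lyapunov_nonneg hμ hx (⟨x0, x0, 0⟩ : AlgState d)
  induction N with
  | zero =>
    have h1 : ∀ ω, trajectory F (paramsOf p h t μ B) x0 Z e J 0 ω = ⟨x0, x0, 0⟩ := fun _ => rfl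
    simp only [h1, lintegral_const, measure_univ, mul_one, pow_zero, one_mul]
    refine ENNReal.ofReal_le_ofReal ?_
    have : 0 ≤ 9 * (p * h / μ ^ 2) * w := by positivity
    linarith
  | succ N ih =>
    refine (lintegral_lyapunov_succ_le H hS hσ ht hμ hp hp1 hh hph hLh hB hpB x0 hx N).trans ?_
    rw [← hw]
    refine (add_le_add (mul_le_mul_right ih _) le_rfl).trans ?_
    rw [← ENNReal.ofReal_mul h1p, ← ENNReal.ofReal_add (by positivity) (by positivity)]
    -- The additive constant is the fixed point of the recursion: the per-step noise divided by the
    -- contraction rate `p h`.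
    refine ENNReal.ofReal_le_ofReal (le_of_eq ?_)
    rw [pow_succ]
    ring

omit [NeZero d] [IsMarkovKernel Q] in
/-- The expected number of oracle calls. -/
theorem IsSampling.lintegral_calls_le (hS : IsSampling P Q Z e J) {a : Params} (hM : 1 ≤ a.M)
    (F : Vec d → S → ℝ) (x0 : Vec d) (N : ℕ) :
    ∫⁻ ω, ((trajectory F a x0 Z e J N ω).calls : ℝ≥0∞) ∂P
      ≤ ENNReal.ofReal (N * (((⌊Real.logb 2 a.M⌋₊ : ℝ) + 1) ^ 2 * a.B)) := by
  set K := ⌊Real.logb 2 a.M⌋₊ with hK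
  have hl : a.l = (K + 1) * a.B := rfl
  have h1 : ∀ k, ∫⁻ ω, (a.batchSize (J k ω) : ℝ≥0∞) ∂P ≤ (((K + 1) * a.l : ℕ) : ℝ≥0∞) := by
    intro k
    have := hS.isProbabilityMeasure_level k
    rw [← lintegral_map (f := fun j : ℕ => (a.batchSize j : ℝ≥0∞)) measurable_from_top
      (hS.measurable_level k)]
    rw [lintegral_level (hS.map_level_singleton k) K (c := (a.l : ℝ≥0∞)) fun j hj => by
      rw [Params.batchSize, if_neg fun h' => ?_]
      have := (two_pow_le_iff hM j).1 h'
      omega]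
    have h2 : ∀ i ∈ Finset.range K, (1 / 2 : ℝ≥0∞) ^ (i + 1) * (a.batchSize (i + 1) : ℝ≥0∞)
        = a.l := fun i hi => by
      rw [Params.batchSize, if_pos ((two_pow_le_iff hM _).2 (Finset.mem_range.1 hi))]
      push_cast
      rw [← mul_assoc, ← mul_pow, one_div, ENNReal.inv_mul_cancel (by simp) (by simp), one_pow,
        one_mul]
    rw [Finset.sum_congr rfl h2, Finset.sum_const, Finset.card_range, nsmul_eq_mul]
    push_cast
    rw [add_mul, one_mul]
    gcongr
    exact mul_le_of_le_one_left' (pow_le_one₀ (by simp) (by simp))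
  have h3 : ∀ ω, ((trajectory F a x0 Z e J N ω).calls : ℝ≥0∞)
      = ∑ k ∈ Finset.range N, (a.batchSize (J k ω) : ℝ≥0∞) := fun ω => by
    rw [trajectory, calls_run, callCount]
    push_cast
    rfl
  simp_rw [h3]
  rw [lintegral_finsetSum (f := fun k ω => (a.batchSize (J k ω) : ℝ≥0∞)) _ fun k _ =>
    (measurable_from_top (f := fun j : ℕ => (a.batchSize j : ℝ≥0∞))).comp (hS.measurable_level k)]
  refine (Finset.sum_le_sum fun k _ => h1 k).trans ?_
  rw [Finset.sum_const, Finset.card_range, nsmul_eq_mul, ← Nat.cast_mul, ← ENNReal.ofReal_natCast]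
  refine ENNReal.ofReal_le_ofReal (le_of_eq ?_)
  rw [hl]
  push_cast
  ring

end Recursion

/-! ### Choice of the parameters -/

/-- Elementary estimate of the number of oracle calls: `Q` stands for `1 / (p h)`, `N` for the
number of iterations and `K` for the largest admissible level. -/
theorem mul_sq_le_poly_log {D V ε Q N K s : ℝ} (hD : 1 ≤ D) (hV : 0 ≤ V) (hε : 0 < ε)
    (hε2 : ε ≤ 1 / 2) (hQ1 : 1 ≤ Q) (hQ : Q ≤ 28800 * (D + V)) (hs : s = D * Real.log (1 / ε) + V)
    (hN : N ≤ 1 + Q * Real.log (9 * D ^ 2 / ε ^ 2)) (hN0 : 0 ≤ N) (hK0 : 0 ≤ K)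
    (hK : K ≤ Real.logb 2 (2 * Q)) :
    N * (K + 1) ^ 2 ≤ 115200 * (9 + 6 * Real.log (s / ε)) * (20 + 2 * Real.log (s / ε)) ^ 2 * s ∧
    (V ≤ D ∨ 1 / √ε ≤ V →
      N * (K + 1) ^ 2 ≤ 115200 * (9 + 6 * Real.log s) * (20 + 2 * Real.log s) ^ 2 * s) := by
  have hlog2 := Real.log_two_gt_d9
  have hlog2' := Real.log_two_lt_d9
  set ℓ := Real.log (1 / ε) with hℓ
  have hℓ2 : Real.log 2 ≤ ℓ := by
    refine Real.log_le_log two_pos ?_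
    rw [le_div_iff₀ hε]; linarith
  -- Here `1.45` exceeds `1/log 2`, and `ℓ ≥ log 2` because `ε ≤ 1/2`.
  have hDℓ : D ≤ 1.45 * (D * ℓ) := by nlinarith
  have hs0 : 0.69 ≤ s := by nlinarith
  have hspos : 0 < s := by linarith
  set y := Real.log s with hy
  have hy0 : -0.45 ≤ y := by
    have h1 := Real.one_sub_inv_le_log_of_pos hspos
    have h2 : s⁻¹ ≤ 1.45 := by
      rw [inv_le_comm₀ hspos (by norm_num)]
      exact le_trans (by norm_num) hs0
    linarith
  have hDs : D ≤ 1.45 * s := by linarith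
  have hQs : Q ≤ 41760 * s := by linarith
  have hlogD : Real.log D ≤ 0.45 + y := by
    have h1 := Real.log_le_log (by linarith) hDs
    rw [Real.log_mul (by norm_num) hspos.ne'] at h1
    have h2 := Real.log_le_sub_one_of_pos (show (0 : ℝ) < 1.45 by norm_num)
    linarith
  have hlogD0 : 0 ≤ Real.log D := Real.log_nonneg hD
  set Λ := Real.log (9 * D ^ 2 / ε ^ 2) with hΛ
  have hlog9 : Real.log 9 ≤ 2.8 := by
    have h1 : Real.log 9 ≤ Real.log (2 ^ 4) := Real.log_le_log (by norm_num) (by norm_num)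
    rw [Real.log_pow] at h1
    push_cast at h1
    linarith
  have hlog9' : 1 ≤ Real.log 9 := by
    have h1 : Real.log (2 ^ 3) ≤ Real.log 9 := Real.log_le_log (by norm_num) (by norm_num)
    rw [Real.log_pow] at h1
    push_cast at h1
    linarith
  have hΛeq : Λ = Real.log 9 + 2 * Real.log D + 2 * ℓ := by
    have h0 : D ≠ 0 := by linarith
    rw [hΛ, Real.log_div (by positivity) (by positivity), Real.log_mul (by norm_num) (by positivity),
      Real.log_pow, Real.log_pow, hℓ, one_div, Real.log_inv]
    push_cast
    ring
  have hΛ1 : 1 ≤ Λ := by linarith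
  have hN2 : N ≤ 2 * (Q * Λ) := by nlinarith
  -- As `2·41760 ≤ 2^17`, the level `K` is at most `17 + log₂ s`, and `log₂ s ≤ 2 + 2y` holds since
  -- `y ≥ -0.45`.
  have hK1 : K + 1 ≤ 20 + 2 * y := by
    have h1 : Real.logb 2 (2 * Q) ≤ Real.logb 2 (2 ^ 17 * s) :=
      Real.logb_le_logb_of_le one_lt_two (by linarith) (by linarith)
    rw [Real.logb_mul (by norm_num) hspos.ne', Real.logb_pow, Real.logb_self_eq_one one_lt_two] at h1
    have h2 : Real.logb 2 s ≤ 2 + 2 * y := by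
      rw [Real.logb, div_le_iff₀ (by linarith)]
      nlinarith
    push_cast at h1
    linarith
  have main : ∀ x, N ≤ 115200 * (9 + 6 * x) * s → K + 1 ≤ 20 + 2 * x →
      N * (K + 1) ^ 2 ≤ 115200 * (9 + 6 * x) * (20 + 2 * x) ^ 2 * s := fun x h1 h2 => by
    have h3 : (K + 1) ^ 2 ≤ (20 + 2 * x) ^ 2 := by gcongr
    calc N * (K + 1) ^ 2 ≤ 115200 * (9 + 6 * x) * s * (20 + 2 * x) ^ 2 :=
          mul_le_mul h1 h3 (by positivity) (hN0.trans h1)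
      _ = _ := by ring
  have hQΛ : Q * Λ ≤ 41760 * s * Λ := mul_le_mul_of_nonneg_right hQs (by linarith)
  refine ⟨?_, fun hcase => main y ?_ hK1⟩
  · have hx : Real.log (s / ε) = y + ℓ := by
      rw [Real.log_div hspos.ne' hε.ne', hℓ, one_div, Real.log_inv]
      ring
    rw [hx]
    refine main _ ?_ (by linarith)
    have h1 : s * Λ ≤ s * (3.7 + 2 * (y + ℓ)) := by gcongr; linarith
    have h2 : 0 ≤ s * (y + ℓ) := mul_nonneg hspos.le (by linarith)
    linarith
  · rcases hcase with hVD | hV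
    -- In the case `V ≤ D` the factor `log(1/ε)` in `Λ` multiplies `D` only, and `D log(1/ε) ≤ s`.
    · have h1 : Q * Λ ≤ 57600 * D * Λ := mul_le_mul_of_nonneg_right (by linarith) (by linarith)
      have h2 : D * (2.8 + 2 * Real.log D) ≤ 1.45 * s * (3.7 + 2 * y) :=
        mul_le_mul hDs (by linarith) (by linarith) (by positivity)
      have h3 : D * Real.log 9 ≤ D * 2.8 := by gcongr
      have h4 : 0 ≤ s * (y + 0.45) := mul_nonneg hspos.le (by linarith)
      have h5 : D * Λ = D * Real.log 9 + D * (2 * Real.log D) + 2 * (D * ℓ) := by rw [hΛeq]; ring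
      linarith
    -- In the case `V ≥ ε^{-1/2}` also `s ≥ ε^{-1/2}`, so `log(1/ε)` is at most `2 log s`.
    · have hℓy : ℓ ≤ 2 * y := by
        have h1 : 1 / √ε ≤ s := by nlinarith
        have h2 := Real.log_le_log (by positivity) h1
        rw [one_div, Real.log_inv, Real.log_sqrt hε.le] at h2
        rw [hℓ, one_div, Real.log_inv]
        linarith
      have h1 : s * Λ ≤ s * (3.7 + 6 * y) := by gcongr; linarith
      have h4 : 0 ≤ s * (y + 0.45) := mul_nonneg hspos.le (by linarith)
      linarith

/-- Accuracy reached by the chosen number of iterations. -/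
theorem contraction_pow_mul_le {r X ψ ε : ℝ} (hr : 0 < r) (hr1 : r ≤ 1) (hε : 0 < ε) (hX : 0 ≤ X)
    (hψ : ψ ≤ X * (ε / 2)) {N : ℕ} (hN : 1 / r * Real.log (1 + X) ≤ N) :
    (1 - r) ^ N * ψ ≤ ε / 2 := by
  have h1 : (1 - r) ^ N ≤ Real.exp (-r) ^ N :=
    pow_le_pow_left₀ (by linarith) (by linarith [Real.add_one_le_exp (-r)]) N
  have h2 : Real.log (1 + X) ≤ N * r := by
    rwa [one_div_mul_eq_div, div_le_iff₀ hr] at hN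
  have h3 : Real.exp (-r) ^ N ≤ (1 + X)⁻¹ := by
    rw [← Real.exp_nat_mul, mul_neg, Real.exp_neg]
    refine inv_anti₀ (by positivity) ?_
    rw [← Real.log_le_iff_le_exp (by positivity)]
    exact h2
  have h4 : 0 ≤ (1 - r) ^ N := pow_nonneg (by linarith) N
  calc (1 - r) ^ N * ψ ≤ (1 - r) ^ N * (X * (ε / 2)) := by gcongr
    _ ≤ (1 + X)⁻¹ * (X * (ε / 2)) := by gcongr; exact h1.trans h3
    _ = (X / (1 + X)) * (ε / 2) := by field_simp
    _ ≤ 1 * (ε / 2) := by gcongr; rw [div_le_one (by positivity)]; linarith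
    _ = ε / 2 := one_mul _

/-- Smallness of the stationary error for the chosen stepsize and approximation step. -/
theorem stationary_error_le {d B τ : ℕ} {L μ σ ε p h t V : ℝ} (hμ : 0 < μ) (hε : 0 < ε)
    (hp : 0 < p) (hh : 0 < h) (hB : 1 ≤ B) (hV : V = stochPart d B τ μ σ ε)
    (hphV : 28800 * (p * h * V) ≤ 1) (ht : 1719 * (h + 1) * (d * L * t) ^ 2 ≤ μ ^ 2 * ε) :
    9 * (p * h / μ ^ 2) * (780 * ((d + τ) * σ ^ 2 / B)
      + 191 * (1 / p + 1 / (p * h)) * (d * (L * t / 2)) ^ 2) ≤ ε / 2 := by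
  have hB' : (0 : ℝ) < B := by positivity
  have h1 : 9 * (p * h / μ ^ 2) * (780 * ((d + τ) * σ ^ 2 / B)) = 7020 * (p * h * V) * ε := by
    rw [hV, stochPart]
    field_simp
    ring
  have h2 : 9 * (p * h / μ ^ 2) * (191 * (1 / p + 1 / (p * h)) * (d * (L * t / 2)) ^ 2)
      = 1719 * (h + 1) * (d * L * t) ^ 2 / (4 * μ ^ 2) := by
    field_simp
    ring
  rw [mul_add, h1, h2]
  have h3 : 1719 * (h + 1) * (d * L * t) ^ 2 / (4 * μ ^ 2) ≤ ε / 4 := by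
    rw [div_le_iff₀ (by positivity)]
    linarith
  have h4 : 28800 * (p * h * V) * ε ≤ 1 * ε := by gcongr
  linarith

end ZeroOrder

/-! ### Choice of the parameters and conclusion -/

theorem mainTheorem2 :
    -- universal: the constant in `p = c B / (B + d)`, and the polynomial hidden in `Õ`
    ∃ (c : ℝ) (poly : Polynomial ℝ), 0 < c ∧ c ≤ 1 ∧
      ∀ (d B τ : ℕ) (L μ σ R ε : ℝ), 1 ≤ d → 1 ≤ B → 0 < L → 0 < μ → 0 ≤ σ → 0 < ε →
        -- the parameters of the algorithm, chosen before the problem instance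
        ∃ (γ t : ℝ) (N : ℕ), 0 < γ ∧ γ ≤ 3 / (4 * L) ∧ 0 < t ∧
          ∀ (S : Type u) [TopologicalSpace S] [PolishSpace S] [MeasurableSpace S] [BorelSpace S]
            (Q : Kernel S S) [IsMarkovKernel Q] (π : Measure S) (F : Vec d → S → ℝ),
            TwoPointAssumptions F Q π L μ σ τ →
            ∀ (Ω : Type v) [MeasurableSpace Ω] (P : Measure Ω) [IsProbabilityMeasure P]
              (Z : ℕ → Ω → S) (e : ℕ → Ω → Vec d) (J : ℕ → Ω → ℕ),
              IsSampling P Q Z e J →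
              ∀ x0 xstar : Vec d, (∀ x, objective F π xstar ≤ objective F π x) →
                ‖x0 - xstar‖ ≤ R →
                -- accuracy `ε` is reached after `N` iterations
                ∫⁻ ω, ENNReal.ofReal
                    (‖(trajectory F ⟨c * (B / (B + d)), γ, t, μ, B⟩ x0 Z e J N ω).x - xstar‖ ^ 2) ∂P
                  ≤ ENNReal.ofReal ε ∧
                -- bounds on the expected number of two-point oracle calls, for small `ε`
                (ε ≤ 1 / 2 → ε * R ^ 2 ≤ 1 →
                  ∫⁻ ω, ((trajectory F ⟨c * (B / (B + d)), γ, t, μ, B⟩ x0 Z e J N ω).calls : ℝ≥0∞) ∂P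
                    ≤ ENNReal.ofReal (B * (poly.eval (Real.log (rate d B τ L μ σ ε / ε))
                        * rate d B τ L μ σ ε)) ∧
                  (stochPart d B τ μ σ ε ≤ detPart d B L μ ∨ 1 / √ε ≤ stochPart d B τ μ σ ε →
                    ∫⁻ ω, ((trajectory F ⟨c * (B / (B + d)), γ, t, μ, B⟩ x0 Z e J N ω).calls : ℝ≥0∞) ∂P
                      ≤ ENNReal.ofReal (B * (poly.eval (Real.log (rate d B τ L μ σ ε))
                          * rate d B τ L μ σ ε)))) := by
  -- With `c = 1/1000` one has `4/(7p) = (4000/7)(1 + d/B)`, above the required `432(1 + d/B)`. The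
  -- polynomial is the one in `mul_sq_le_poly_log`.
  refine ⟨1 / 1000, Polynomial.C 115200 * (Polynomial.C 9 + Polynomial.C 6 * Polynomial.X)
    * (Polynomial.C 20 + Polynomial.C 2 * Polynomial.X) ^ 2, by norm_num, by norm_num, ?_⟩
  intro d B τ L μ σ R ε hd hB hL hμ hσ hε
  have : NeZero d := ⟨by omega⟩
  have hBr : (0 : ℝ) < B := by positivity
  have hdr : (0 : ℝ) < d := by positivity
  set p : ℝ := 1 / 1000 * (B / (B + d)) with hp_def
  have hp : 0 < p := by positivity
  have hp1000 : p ≤ 1 / 1000 := by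
    have : (B : ℝ) / (B + d) ≤ 1 := by rw [div_le_one (by positivity)]; linarith
    linarith
  have hpinv : 1 / p = 1000 * (1 + (d : ℝ) / B) := by rw [hp_def]; field_simp
  have hpB : 432 * (1 + (d : ℝ) / B) ≤ 4 / (7 * p) := by
    have h1 : 4 / (7 * p) = 4 / 7 * (1 / p) := by field_simp
    have h2 : (0 : ℝ) < d / B := by positivity
    rw [h1, hpinv]
    linarith
  set V : ℝ := stochPart d B τ μ σ ε with hV
  have hV0 : 0 ≤ V := by rw [hV, stochPart]; positivity
  set κ : ℝ := √(L / μ) with hκ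
  have hκ0 : 0 < κ := Real.sqrt_pos.2 (by positivity)
  have hκsq : κ ^ 2 = L / μ := Real.sq_sqrt (by positivity)
  -- The two summands in the denominator enforce the two constraints on `h`: `2κ` gives `γ ≤
  -- 3/(4L)`, and `28800pV` keeps the stationary variance `7020·phV·ε` below `ε/4`.
  set h : ℝ := 1 / (2 * κ + 28800 * (p * V)) with hh_def
  have hden : 0 < 2 * κ + 28800 * (p * V) := by positivity
  have hh : 0 < h := by positivity
  have hhinv : 1 / h = 2 * κ + 28800 * (p * V) := by rw [hh_def, one_div_one_div]
  have hhκ : h * (2 * κ) ≤ 1 := by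
    have h1 : h * (2 * κ + 28800 * (p * V)) = 1 := by rw [hh_def]; field_simp
    have h2 : 0 ≤ h * (28800 * (p * V)) := by positivity
    linarith
  have hphV : 28800 * (p * h * V) ≤ 1 := by
    have h1 : h * (2 * κ + 28800 * (p * V)) = 1 := by rw [hh_def]; field_simp
    have h2 : 0 ≤ h * (2 * κ) := by positivity
    linarith
  have hLh : L * (3 * h ^ 2 / μ) ≤ 3 / 4 := by
    have h1 : L * (3 * h ^ 2 / μ) = 3 / 4 * (h * (2 * κ)) ^ 2 := by
      rw [mul_pow, mul_pow, hκsq]; field_simp; norm_num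
    have h2 : (h * (2 * κ)) ^ 2 ≤ 1 := pow_le_one₀ (by positivity) hhκ
    linarith
  -- Makes the finite difference contribution at most `ε/4`; here `1719 = 9·191`.
  set t : ℝ := √(μ ^ 2 * ε / (1719 * (h + 1) * (d * L) ^ 2)) with ht_def
  have ht : 0 < t := Real.sqrt_pos.2 (by positivity)
  have htle : 1719 * (h + 1) * (d * L * t) ^ 2 ≤ μ ^ 2 * ε := by
    rw [mul_pow, ht_def, Real.sq_sqrt (by positivity)]
    apply le_of_eq
    field_simp
  -- The bound for the initial potential divided by the target `ε/2`. Using `log(1 + X)` keeps the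
  -- iteration count meaningful when `X` is small or zero.
  set X : ℝ := 2 * (R ^ 2 * (1 + 3 * (L / μ))) / ε with hX
  have hX0 : 0 ≤ X := by positivity
  set N : ℕ := ⌈1 / (p * h) * Real.log (1 + X)⌉₊ with hN
  refine ⟨3 * h ^ 2 / μ, t, N, by positivity, ?_, ht, ?_⟩
  · rw [le_div_iff₀ (by positivity)]
    linarith
  intro S _ _ _ _ Q _ π F H Ω _ P _ Z e J hS x0 xstar hx hR
  change ∫⁻ ω, ENNReal.ofReal (‖(trajectory F (paramsOf p h t μ B) x0 Z e J N ω).x - xstar‖ ^ 2) ∂P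
      ≤ ENNReal.ofReal ε ∧ (ε ≤ 1 / 2 → ε * R ^ 2 ≤ 1 →
        ∫⁻ ω, ((trajectory F (paramsOf p h t μ B) x0 Z e J N ω).calls : ℝ≥0∞) ∂P ≤ _ ∧ (_ →
          ∫⁻ ω, ((trajectory F (paramsOf p h t μ B) x0 Z e J N ω).calls : ℝ≥0∞) ∂P ≤ _))
  have hsmooth := H.isLSmooth_objective hσ
  -- The inequality `μ ≤ L` becomes available only here, from the existence of a problem instance;
  -- the parameters above were fixed without it.
  have hμL : μ ≤ L := H.convex.le_of_isLSmooth hd hsmooth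
  have hLμ : 1 ≤ L / μ := by rw [le_div_iff₀ hμ]; linarith
  have hκ1 : 1 ≤ κ := Real.one_le_sqrt.2 hLμ
  have hh1 : h ≤ 1 / 2 := by
    have : h * 2 ≤ h * (2 * κ) := by gcongr; linarith
    linarith
  have hph : p * h ≤ 1 / 2 := by
    calc p * h ≤ 1 * (1 / 2) := by gcongr; linarith
      _ = 1 / 2 := one_mul _
  have hph0 : 0 < p * h := by positivity
  refine ⟨?_, fun hε2 hεR => ?_⟩
  · refine (lintegral_mono fun ω => ENNReal.ofReal_le_ofReal
      (norm_sq_le_lyapunov hμ hx _)).trans ((lintegral_lyapunov_le H hS hσ ht hμ hp (by linarith) hh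
        hph hLh hB hpB x0 hx N).trans (ENNReal.ofReal_le_ofReal ?_))
    have h1 := lyapunov_init_le hμ hL hsmooth hx hR 0
    have h2 : lyapunov (objective F π) μ xstar ⟨x0, x0, 0⟩ ≤ X * (ε / 2) := by
      refine h1.trans (le_of_eq ?_)
      rw [hX]
      field_simp
    have h3 := contraction_pow_mul_le hph0 (by linarith) hε hX0 h2 (Nat.le_ceil _)
    have h4 := stationary_error_le (d := d) (B := B) (τ := τ) (L := L) (σ := σ) hμ hε hp hh hB hV
      hphV htle
    linarith
  · set D : ℝ := detPart d B L μ with hD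
    have hm1 : 1 ≤ max 1 ((d : ℝ) / B) := le_max_left _ _
    have hκD : κ ≤ D := by rw [hD, detPart]; exact le_mul_of_one_le_left hκ0.le hm1
    have hM : (paramsOf p h t μ B).M = 1 / p + 1 / (p * h) := paramsOf_M hp hh hμ
    have hp1 : 1000 ≤ 1 / p := by rw [le_div_iff₀ hp]; linarith
    have hQM : 1 / p ≤ 1 / (p * h) := by gcongr; exact mul_le_of_le_one_right hp.le (by linarith)
    have hM1 : 1 ≤ (paramsOf p h t μ B).M := by rw [hM]; linarith
    -- The part of `1/h` proportional to `p` contributes `28800V` after division by `p`, free of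
    -- `d/B`; the other part is `2κ/p ≤ 4000D`.
    have hQ : 1 / (p * h) ≤ 28800 * (D + V) := by
      have h1 : 1 / (p * h) = 2 * (1 / p) * κ + 28800 * V := by
        rw [← one_div_mul_one_div, hhinv]
        field_simp
      have h2 : 1 / p ≤ 2000 * max 1 ((d : ℝ) / B) := by
        rw [hpinv]
        have := le_max_right 1 ((d : ℝ) / B)
        linarith
      have h3 : 2 * (1 / p) * κ ≤ 2 * (2000 * max 1 ((d : ℝ) / B)) * κ := by gcongr
      have h4 : 2 * (2000 * max 1 ((d : ℝ) / B)) * κ = 4000 * D := by rw [hD, detPart]; ring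
      linarith
    have hX9 : 1 + X ≤ 9 * D ^ 2 / ε ^ 2 := by
      have h1 : R ^ 2 ≤ 1 / ε := by rw [le_div_iff₀ hε]; linarith
      have h2 : L / μ ≤ D ^ 2 := by rw [← hκsq]; gcongr
      have h3 : X ≤ 2 * (1 / ε * (D ^ 2 + 3 * D ^ 2)) / ε := by
        rw [hX]; gcongr; linarith
      have h4 : 2 * (1 / ε * (D ^ 2 + 3 * D ^ 2)) / ε = 8 * D ^ 2 / ε ^ 2 := by field_simp; ring
      have h5 : 1 ≤ D ^ 2 / ε ^ 2 := by
        rw [le_div_iff₀ (by positivity)]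
        have : ε ^ 2 ≤ 1 := pow_le_one₀ hε.le (by linarith)
        linarith
      have h6 : 9 * D ^ 2 / ε ^ 2 = 8 * D ^ 2 / ε ^ 2 + D ^ 2 / ε ^ 2 := by ring
      linarith
    have hNle : (N : ℝ) ≤ 1 + 1 / (p * h) * Real.log (9 * D ^ 2 / ε ^ 2) := by
      have h1 : 0 ≤ Real.log (1 + X) := Real.log_nonneg (by linarith)
      have h2 := (Nat.ceil_lt_add_one (a := 1 / (p * h) * Real.log (1 + X)) (by positivity)).le
      have h3 : 1 / (p * h) * Real.log (1 + X) ≤ 1 / (p * h) * Real.log (9 * D ^ 2 / ε ^ 2) := by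
        gcongr
      linarith
    -- Since `h ≤ 1`, the summand `1/p` of `M` is at most `1/(ph)`, so `M ≤ 2/(ph)`.
    have hK : (⌊Real.logb 2 (paramsOf p h t μ B).M⌋₊ : ℝ) ≤ Real.logb 2 (2 * (1 / (p * h))) := by
      refine (Nat.floor_le (Real.logb_nonneg one_lt_two hM1)).trans
        (Real.logb_le_logb_of_le one_lt_two (by linarith) ?_)
      rw [hM]
      linarith
    have hcalls := hS.lintegral_calls_le hM1 F x0 N
    have hkey := mul_sq_le_poly_log (hκ1.trans hκD) hV0 hε hε2 (by linarith) hQ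
      (show rate d B τ L μ σ ε = D * Real.log (1 / ε) + V from rfl) hNle (Nat.cast_nonneg _)
      (Nat.cast_nonneg _) hK
    have hfin : ∀ y, (N : ℝ) * ((⌊Real.logb 2 (paramsOf p h t μ B).M⌋₊ : ℝ) + 1) ^ 2
        ≤ 115200 * (9 + 6 * y) * (20 + 2 * y) ^ 2 * rate d B τ L μ σ ε →
        ∫⁻ ω, ((trajectory F (paramsOf p h t μ B) x0 Z e J N ω).calls : ℝ≥0∞) ∂P
        ≤ ENNReal.ofReal (B * (Polynomial.eval y (Polynomial.C 115200 *
          (Polynomial.C 9 + Polynomial.C 6 * Polynomial.X)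
          * (Polynomial.C 20 + Polynomial.C 2 * Polynomial.X) ^ 2) * rate d B τ L μ σ ε)) := by
      intro y hy
      refine hcalls.trans (ENNReal.ofReal_le_ofReal ?_)
      simp only [Polynomial.eval_mul, Polynomial.eval_add, Polynomial.eval_pow, Polynomial.eval_C,
        Polynomial.eval_X]
      rw [← mul_assoc, mul_comm]
      exact mul_le_mul_of_nonneg_left hy hBr.le
    exact ⟨hfin _ hkey.1, fun hcase => hfin _ (hkey.2 hcase)⟩
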